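/- **Setting.** Let $P$ be the co-weight lattice of the root system $A_2$, with simple roots $\alpha_1,\alpha_2$, $\alpha_0=\alpha_1+\alpha_2$, and fundamental co-weights $\lambda_1,\lambda_2$ (the basis dual to $\alpha_1,\alpha_2$), and let $\Sigma$ be the $\tilde A_2$ Coxeter complex, whose vertex set is $P$. Let $\mathscr{X}$ be a triangle building (a building of type $\tilde A_2$) with its complete system of apartments, in which every edge lies in precisely $q+1$ chambers, $q<\infty$. Let $\Omega$ be its boundary, i.e. the set of equivalence classes of sectors, where two sectors are equivalent if they contain a common subsector. Two points $\omega,\omega'\in\Omega$ are opposite if there is a unique apartment $[\omega,\omega']$ that contains sectors representing both, and in it these sectors point in opposite directions. Fix $\omega_0\in\Omega$ and a vertex $O$ of the same type as the origin of $\Sigma$, let $\mathscr{A}_0$ be an apartment containing the sector $[O,\omega_0]$ with base vertex $O$ that represents $\omega_0$, and let $\psi:\mathscr{A}_0\to\Sigma$ be the type-preserving isomorphism that takes $[O,\omega_0]$ to the sector $-\mathcal S_0$ opposite to the fundamental sector $\mathcal S_0$. Let $\rho=\psi\circ\rho_0:\mathscr{X}\to\Sigma$, where $\rho_0:\mathscr{X}\to\mathscr{A}_0$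 is the retraction centred at $\omega_0$. Let $\Omega_0$ be the set of all $\omega\in\Omega$ opposite to $\omega_0$. For a vertex $x$ let $E_x=\{\omega\in\Omega_0: x\in[\omega,\omega_0]\}$; for $\lambda\in P$ let $\mathcal{F}_\lambda$ be the $\sigma$-field generated by the sets $E_x$ with $\rho(x)=\lambda$, and let $\mathcal{F}=\sigma\big(\bigcup_{\lambda\in P}\mathcal{F}_\lambda\big)$. There is a unique measure $\pi$ on $(\Omega_0,\mathcal{F})$ such that $\pi(E_x)=q^{-2\langle\rho(x),\alpha_0\rangle}$ for every vertex $x$. All $\sigma$-fields are understood to be extended by the $\pi$-null sets. A function on $\Omega_0$ is called locally integrable if it is $\pi$-integrable on each set $E_x$. Write $\mathbb{E}[f\,|\,\mathcal{F}']$ for conditional expectation with respect to $\pi$, $\mathbb{E}[f\,|\,\mathcal{F}'\,|\,\mathcal{F}'']=\mathbb{E}\big[\mathbb{E}[f\,|\,\mathcal{F}']\,\big|\,\mathcal{F}''\big]$, $f_\lambda=\mathbb{E}_\lambda f=\mathbb{E}[f\,|\,\mathcal{F}_\lambda]$, and $\mathcal{F}'\vee\mathcal{F}''$ for the $\sigma$-field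 generated by $\mathcal{F}'\cup\mathcal{F}''$. **Lemma.** For every locally integrable real- or complex-valued function $f$ on $\Omega_0$ and every $\lambda\in P$, $\pi$-almost everywhere $$\mathbb{E}[f_{\lambda+\lambda_1}\,|\,\mathcal{F}_{\lambda+\lambda_2}\,|\,\mathcal{F}_{\lambda+\lambda_1}]=q^{-1}f_{\lambda+\lambda_1}-q^{-1}\,\mathbb{E}[f_{\lambda+\lambda_1}\,|\,\mathcal{F}_{\lambda+\lambda_1-\lambda_2}\vee\mathcal{F}_\lambda]+f_\lambda$$ and $$\big(\mathbb{E}_{\lambda+\lambda_2}\mathbb{E}_{\lambda+\lambda_1}\big)^2f=q^{-1}\,\mathbb{E}_{\lambda+\lambda_2}\mathbb{E}_{\lambda+\lambda_1}f+(1-q^{-1})\,\mathbb{E}_\lambda f .$$ Both identities also hold with $\lambda_1$ and $\lambda_2$ exchanged. -/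

import Mathlib

open MeasureTheory
open scoped ENNReal

noncomputable section

/-! ## The Coxeter complex of type `Ã₂` -/

/-- The co-weight lattice `P` of the root system `A₂`; the pair `(i, j)` stands for
`i λ₁ + j λ₂`, so `i = ⟨·, α₁⟩`, `j = ⟨·, α₂⟩`, and `⟨·, α₀⟩ = i + j` because `α₀ = α₁ + α₂`.
The product order of `ℤ × ℤ` is the order in which `λ ⪯ μ` if and only if
`⟨λ - μ, α₁⟩ ≤ 0` and `⟨λ - μ, α₂⟩ ≤ 0`. -/
abbrev CoweightLattice : Type := ℤ × ℤ

namespace CoweightLattice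

/-- The fundamental co-weight `λ₁`. -/
def fund1 : CoweightLattice := (1, 0)

/-- The fundamental co-weight `λ₂`. -/
def fund2 : CoweightLattice := (0, 1)

/-- The vertical level `⟨v, α₀⟩`. -/
def level (v : CoweightLattice) : ℤ := v.1 + v.2

/-- The type of a vertex of the Coxeter complex: `0`, `λ₁`, `λ₂` have types `0`, `1`, `2`, and the
type is constant on the orbits of the affine Weyl group, the cosets of the lattice spanned by
`α₁ = 2 λ₁ - λ₂` and `α₂ = 2 λ₂ - λ₁`. -/
def vertexType (v : CoweightLattice) : ZMod 3 := ((v.1 + 2 * v.2 : ℤ) : ZMod 3)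

/-- The vertex sets of the chambers: the connected components of the complement of the walls
`⟨x, α_j⟩ = k` (`j = 0, 1, 2`, `k ∈ ℤ`) are the triangles with vertices `v, v + λ₁, v + λ₂` and
those with vertices `v + λ₁, v + λ₂, v + λ₁ + λ₂`, for `v ∈ P`. -/
def IsChamber (c : Finset CoweightLattice) : Prop :=
  ∃ v : CoweightLattice, c = {v, v + fund1, v + fund2} ∨
    c = {v + fund1, v + fund2, v + fund1 + fund2}

/-- The Coxeter complex `Σ`: the simplexes are the nonempty sets of vertices of a chamber. -/
def coxeterComplex : AbstractSimplicialComplex CoweightLattice where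
  faces := {s | s.Nonempty ∧ ∃ c, IsChamber c ∧ s ⊆ c}
  isRelLowerSet_faces := by
    rintro s ⟨hs, c, hc, hsc⟩
    exact ⟨hs, fun t hts ht => ⟨ht, c, hc, hts.trans hsc⟩⟩
  singleton_mem := fun v =>
    ⟨Finset.singleton_nonempty v, {v, v + fund1, v + fund2}, ⟨v, Or.inl rfl⟩, by simp⟩

/-- The reflection `r₁ x = x - ⟨x, α₁⟩ α₁`, where `α₁ = 2 λ₁ - λ₂`. -/
def reflection1 : Equiv.Perm CoweightLattice where
  toFun x := (-x.1, x.1 + x.2)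
  invFun x := (-x.1, x.1 + x.2)
  left_inv x := by simp
  right_inv x := by simp

/-- The reflection `r₂ x = x - ⟨x, α₂⟩ α₂`, where `α₂ = 2 λ₂ - λ₁`. -/
def reflection2 : Equiv.Perm CoweightLattice where
  toFun x := (x.1 + x.2, -x.2)
  invFun x := (x.1 + x.2, -x.2)
  left_inv x := by simp
  right_inv x := by simp

/-- The finite Weyl group `W₀`, generated by `r₁` and `r₂`. -/
def finiteWeylGroup : Subgroup (Equiv.Perm CoweightLattice) :=
  Subgroup.closure {reflection1, reflection2}

/-- The vertices of the sector `v + w 𝒮₀` with base vertex `v`, where `𝒮₀` is the fundamental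
sector `⟨x, α₁⟩ > 0, ⟨x, α₂⟩ > 0` (as a subcomplex, it contains the vertices on its boundary). -/
def sector (v : CoweightLattice) (w : Equiv.Perm CoweightLattice) : Set CoweightLattice :=
  {x | ∃ y : CoweightLattice, 0 ≤ y ∧ x = v + w y}

end CoweightLattice

open CoweightLattice

/-! ## Triangle buildings -/

/-- A simplicial complex with a type in `{0, 1, 2}` assigned to each vertex. -/
structure TypedComplex (V : Type*) where
  /-- The simplexes. -/
  complex : AbstractSimplicialComplex V
  /-- The type of each vertex. -/
  type : V → ZMod 3

namespace TypedComplex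

variable {V : Type*}

/-- A type-preserving isomorphism of `Σ` onto a subcomplex of `X`. -/
structure Chart (X : TypedComplex V) where
  /-- The map on vertices. -/
  toEmb : CoweightLattice ↪ V
  map_face : ∀ s ∈ coxeterComplex.faces, s.map toEmb ∈ X.complex.faces
  type_eq : ∀ v, X.type (toEmb v) = vertexType v

instance (X : TypedComplex V) : CoeFun (Chart X) (fun _ => CoweightLattice → V) where
  coe φ := φ.toEmb

/-- The simplexes of the subcomplex which is the image of a chart. -/
def Chart.image {X : TypedComplex V} (φ : Chart X) : Set (Finset V) :=
  {t | ∃ s ∈ coxeterComplex.faces, t = s.map φ.toEmb}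

/-- `X` is a building of type `Ã₂` (a triangle building). The system of apartments is complete:
every subcomplex that is type-isomorphic to `Σ` is an apartment. Thus the apartments are
precisely the images of the charts. -/
structure IsTriangleBuilding (X : TypedComplex V) : Prop where
  /-- Any two simplexes lie in a common apartment. -/
  exists_apartment : ∀ s ∈ X.complex.faces, ∀ t ∈ X.complex.faces,
    ∃ φ : Chart X, s ∈ φ.image ∧ t ∈ φ.image
  /-- If the apartments `A = φ(Σ)` and `A' = φ'(Σ)` have a chamber in common, there is a
  type-preserving isomorphism `ψ : A → A'` that fixes `A ∩ A'` pointwise; here `ψ` is given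
  through `φ'' = ψ ∘ φ`. -/
  exists_isom : ∀ φ φ' : Chart X, (∃ c ∈ φ.image ∩ φ'.image, c.card = 3) →
    ∃ φ'' : Chart X, φ''.image = φ'.image ∧ ∀ v, φ v ∈ Set.range φ' → φ'' v = φ v

/-- Every edge lies in precisely `q + 1` chambers, that is, `q_i(C) = q` for every chamber `C` and
every `i`. -/
def HasOrder (X : TypedComplex V) (q : ℕ) : Prop :=
  ∀ e ∈ X.complex.faces, e.card = 2 →
    {c : Finset V | c ∈ X.complex.faces ∧ c.card = 3 ∧ e ⊆ c}.ncard = q + 1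

/-! ### Sectors and the boundary

In a building, an apartment contains every simplex whose vertices it contains. So apartments and
sectors are determined by their vertices, and are treated as sets of vertices from here on. -/

/-- The vertex set of an apartment. -/
def IsApartment (X : TypedComplex V) (A : Set V) : Prop :=
  ∃ φ : Chart X, A = Set.range φ

/-- A sector of `X` is a sector in some apartment. -/
def IsSector (X : TypedComplex V) (S : Set V) : Prop :=
  ∃ (φ : Chart X) (v : CoweightLattice) (w : Equiv.Perm CoweightLattice),
    w ∈ finiteWeylGroup ∧ S = φ '' sector v w

/-- Two sectors are equivalent if they contain a common subsector. -/
def SectorEquiv (X : TypedComplex V) (S S' : Set V) : Prop :=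
  ∃ T, X.IsSector T ∧ T ⊆ S ∧ T ⊆ S'

/-- The boundary `Ω`: the set of equivalence classes of sectors. -/
def Boundary (X : TypedComplex V) : Type _ :=
  {c : Set (Set V) // ∃ S, X.IsSector S ∧ c = {S' | X.IsSector S' ∧ X.SectorEquiv S S'}}

/-- `A` is an apartment that contains sectors representing `ω` and `ω'`. -/
def Joins (X : TypedComplex V) (A : Set V) (ω ω' : X.Boundary) : Prop :=
  X.IsApartment A ∧ ∃ S ∈ ω.1, ∃ S' ∈ ω'.1, S ⊆ A ∧ S' ⊆ A

/-- `ω` and `ω'` are opposite: there is precisely one apartment that contains sectors representing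
both, and in it these sectors point in opposite directions (the sets `Set.Ici 0` and `Set.Iic 0`
of vertices of `Σ` are the sectors `𝒮₀` and `-𝒮₀`). -/
def Opposite (X : TypedComplex V) (ω ω' : X.Boundary) : Prop :=
  ∃ φ : Chart X, φ '' Set.Ici 0 ∈ ω.1 ∧ φ '' Set.Iic 0 ∈ ω'.1 ∧
    ∀ A, X.Joins A ω ω' → A = Set.range φ

/-- The set `Ω₀` of the boundary points opposite to `ω₀`. -/
def OppositeBoundary (X : TypedComplex V) (ω₀ : X.Boundary) : Type _ :=
  {ω : X.Boundary // X.Opposite ω ω₀}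

/-! ### The filtration -/

/-- `E_x`: the set of those `ω ∈ Ω₀` for which `x` belongs to the apartment `[ω, ω₀]`. -/
def throughVertex (X : TypedComplex V) (ω₀ : X.Boundary) (x : V) :
    Set (X.OppositeBoundary ω₀) :=
  {ω | ∃ A, X.Joins A ω.1 ω₀ ∧ x ∈ A}

/-- `x` retracts to `lam`: some apartment contains `x` and has a subsector of `φ₀(-𝒮₀)` in common
with the apartment `φ₀(Σ)`, and the isomorphism onto `Σ` that agrees with `φ₀⁻¹` on this subsector
takes `x` to `lam`. -/
def RetractsTo {X : TypedComplex V} (φ₀ : Chart X) (x : V) (lam : CoweightLattice) : Prop :=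
  ∃ φ : Chart X, φ lam = x ∧ ∃ v : CoweightLattice, ∀ u ≤ v, φ u = φ₀ u

/-- The retraction `ρ : X → Σ` centred at the boundary point represented by `φ₀(-𝒮₀)`. In a
triangle building, every vertex retracts to precisely one `lam`. -/
def retraction {X : TypedComplex V} (φ₀ : Chart X) (x : V) : CoweightLattice :=
  Classical.epsilon (RetractsTo φ₀ x)

/-- The σ-field `ℱ` on `Ω₀`, generated by all the sets `E_x`; see `iSup_field` below. -/
instance instMeasurableSpaceOppositeBoundary (X : TypedComplex V) (ω₀ : X.Boundary) :
    MeasurableSpace (X.OppositeBoundary ω₀) :=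
  MeasurableSpace.generateFrom (Set.range (X.throughVertex ω₀))

/-- The σ-field `ℱ_lam`, generated by the sets `E_x` with `ρ(x) = lam`. -/
@[reducible] def field {X : TypedComplex V} (ω₀ : X.Boundary) (φ₀ : Chart X) (lam : CoweightLattice) :
    MeasurableSpace (X.OppositeBoundary ω₀) :=
  MeasurableSpace.generateFrom (X.throughVertex ω₀ '' {x | retraction φ₀ x = lam})

/-- `ℱ` is the σ-field generated by the union of the `ℱ_lam`. -/
theorem iSup_field {X : TypedComplex V} (ω₀ : X.Boundary) (φ₀ : Chart X) :
    ⨆ lam, field ω₀ φ₀ lam = instMeasurableSpaceOppositeBoundary X ω₀ := by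
  apply le_antisymm
  · exact iSup_le fun lam => MeasurableSpace.generateFrom_mono (Set.image_subset_range _ _)
  · refine MeasurableSpace.generateFrom_le ?_
    rintro _ ⟨x, rfl⟩
    exact le_iSup (field ω₀ φ₀) (retraction φ₀ x) _
      (MeasurableSpace.measurableSet_generateFrom ⟨x, rfl, rfl⟩)

/-- The property that determines the measure `π` on `(Ω₀, ℱ)`:
`π(E_x) = q ^ (-2 ⟨ρ(x), α₀⟩)` for all vertices `x`. -/
def IsBoundaryMeasure {X : TypedComplex V} (ω₀ : X.Boundary) (φ₀ : Chart X) (q : ℕ)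
    (π : Measure (X.OppositeBoundary ω₀)) : Prop :=
  ∀ x : V, π (X.throughVertex ω₀ x) = (q : ℝ≥0∞) ^ (-2 * level (retraction φ₀ x))

/-- Local integrability on `Ω₀`: integrability on each set `E_x`. -/
def LocIntegrable {X : TypedComplex V} (ω₀ : X.Boundary)
    {𝕜 : Type*} [RCLike 𝕜] (π : Measure (X.OppositeBoundary ω₀))
    (f : X.OppositeBoundary ω₀ → 𝕜) : Prop :=
  ∀ x : V, IntegrableOn f (X.throughVertex ω₀ x) π

end TypedComplex

/-! ## Conditional expectation of functions that need not be integrable -/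

/-- `g` is (a version of) the Radon–Nikodym derivative of `f μ` with respect to `μ` on the
σ-field `m` extended by the null sets: `g` is measurable with respect to the latter, and has the
same integral as `f` over each set of `m` on which `f` is integrable. -/
structure IsLocalCondExp {Ω 𝕜 : Type*} [RCLike 𝕜] {m₀ : MeasurableSpace Ω} (μ : Measure Ω)
    (m : MeasurableSpace Ω) (f g : Ω → 𝕜) : Prop where
  aestronglyMeasurable : AEStronglyMeasurable[m] g μ
  integrableOn : ∀ s, MeasurableSet[m] s → IntegrableOn f s μ → IntegrableOn g s μ
  setIntegral_eq : ∀ s, MeasurableSet[m] s → IntegrableOn f s μ →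
    ∫ ω in s, g ω ∂μ = ∫ ω in s, f ω ∂μ

open Classical in
/-- The conditional expectation `𝔼[f | m]`. Mathlib's `μ[f|m]` is `0` unless `f` is integrable on
the whole space; this one is meant for functions `f` such that the space is a countable union of
sets of `m` of finite measure on which `f` is integrable. -/
def localCondExp {Ω 𝕜 : Type*} [RCLike 𝕜] {m₀ : MeasurableSpace Ω} (μ : Measure Ω)
    (m : MeasurableSpace Ω) (f : Ω → 𝕜) : Ω → 𝕜 :=
  if h : ∃ g, IsLocalCondExp μ m f g then h.choose else 0

/-- The operator `𝔼_lam f = 𝔼[f | ℱ_lam]`. -/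
def TypedComplex.condExpAt {V 𝕜 : Type*} [RCLike 𝕜] {X : TypedComplex V} (ω₀ : X.Boundary)
    (φ₀ : X.Chart) (π : Measure (X.OppositeBoundary ω₀)) (lam : CoweightLattice)
    (f : X.OppositeBoundary ω₀ → 𝕜) : X.OppositeBoundary ω₀ → 𝕜 :=
  localCondExp π (TypedComplex.field ω₀ φ₀ lam) f

end

/-! The identities are incidence counts in the link of a vertex, which is a projective plane of
order q. Let x be a vertex with ρ(x) = `lam`. The sector from x towards ω₀ marks a flag in the link
of x: a line, the vertex at `lam - a`, and a point on it, the vertex at `lam - b`. Removing that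
line leaves an affine plane. Its q² points are the neighbours of x at `lam + a`; its lines are the
q² neighbours at `lam + b` and the q neighbours at `lam + a - b`, and the latter form one parallel
class, the special one.

An apartment [ω, ω₀] through x has a point y at `lam + a` and a line z at `lam + b` incident with
it. Given z, the point is uniform among the q points of z; given y, the line is uniform among the q
nonspecial lines through y. Hence 𝔼_{λ+a}𝔼_{λ+b}𝔼_{λ+a} f at y is q⁻² times a sum over pairs (z, y')
with y, y' on z. It counts y itself q times, each point off the special line through y once, and the
other points of that special line never (`sum_nbr_sum_nbr`). This is the first identity. Averaging
it over the points y of a line z gives the second, because the special lines through the points of z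
partition the plane (`sum_nbr_sum_side`).

The building enters through `eq_of_between`: vertices on a monotone geodesic between two vertices of
an apartment lie in that apartment. It makes the retractions centred at chambers stabilise as the
chamber tends to ω₀ (`exists_eventually_retr`). The limiting retraction `lev`, the sectors towards
ω₀ (`proj`) and the structure of links (`ncard_thirds`, `existsUnique_join`) are collected in
`HoroSystem`, and the counting uses nothing else. Points of Ω₀ correspond to coordinate families
compatible with `proj` (`exists_isFamily_of_opposite`, `exists_opposite_of_isFamily`).

The measure π is built from independent uniform diagonal steps, and a π-system of nested sets gives
uniqueness. Each ℱ_λ is generated by a variable with countably many values, so conditional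
expectations are averages over fibres (`localCondExp_comap_ae_eq`). -/

namespace CoweightLattice

/-! ### Adjacency and type-preserving maps of the Coxeter complex. -/

/-- Equality or adjacency of vertices in the Coxeter complex. -/
def Near (u v : CoweightLattice) : Prop :=
  (-1 ≤ v.1 - u.1 ∧ v.1 - u.1 ≤ 1) ∧ (-1 ≤ v.2 - u.2 ∧ v.2 - u.2 ≤ 1) ∧
    (-1 ≤ (v.1 - u.1) + (v.2 - u.2) ∧ (v.1 - u.1) + (v.2 - u.2) ≤ 1)

theorem Near.symm {u v : CoweightLattice} (h : Near u v) : Near v u := by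
  unfold Near at *; omega

theorem Near.refl (u : CoweightLattice) : Near u u := by
  unfold Near; omega

theorem vertexType_eq_iff {u v : CoweightLattice} :
    vertexType u = vertexType v ↔ (3 : ℤ) ∣ (v.1 + 2 * v.2) - (u.1 + 2 * u.2) := by
  unfold vertexType
  exact ZMod.intCast_eq_intCast_iff_dvd_sub _ _ 3

theorem ext_iff {u v : CoweightLattice} : u = v ↔ u.1 = v.1 ∧ u.2 = v.2 := Prod.ext_iff

theorem Near.eq_of_vertexType_eq {u v : CoweightLattice} (h : Near u v)
    (ht : vertexType u = vertexType v) : u = v := by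
  rw [vertexType_eq_iff] at ht
  rw [ext_iff]
  unfold Near at h
  omega

theorem mem_coxeterComplex_faces {s : Finset CoweightLattice} :
    s ∈ coxeterComplex.faces ↔ s.Nonempty ∧ ∀ u ∈ s, ∀ v ∈ s, Near u v := by
  constructor
  · rintro ⟨hs, c, ⟨v, hc⟩, hsc⟩
    refine ⟨hs, fun x hx y hy => ?_⟩
    have hx := hsc hx
    have hy := hsc hy
    rcases hc with rfl | rfl <;>
    · simp only [Finset.mem_insert, Finset.mem_singleton, ext_iff, fund1, fund2, Prod.fst_add,
        Prod.snd_add] at hx hy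
      unfold Near
      omega
  · rintro ⟨hs, h⟩
    refine ⟨hs, ?_⟩
    -- The corner is formed from the two coordinatewise minima. If it lies in `s`, then `s` lies in
    -- the triangle above that corner; otherwise it lies in the opposite triangle.
    obtain ⟨x, hx, hxm⟩ := s.exists_min_image (fun u => u.1) hs
    obtain ⟨y, hy, hym⟩ := s.exists_min_image (fun u => u.2) hs
    by_cases hv : ((x.1, y.2) : CoweightLattice) ∈ s
    · refine ⟨_, ⟨(x.1, y.2), Or.inl rfl⟩, fun u hu => ?_⟩
      have h1 := h _ hv _ hu
      have h2 := hxm u hu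
      have h3 := hym u hu
      simp only [Finset.mem_insert, Finset.mem_singleton, ext_iff, fund1, fund2, Prod.fst_add,
        Prod.snd_add]
      unfold Near at h1
      simp only at h1 h2 h3
      omega
    · refine ⟨_, ⟨(x.1, y.2), Or.inr rfl⟩, fun u hu => ?_⟩
      have h1 := h _ hx _ hu
      have h4 := h _ hy _ hu
      have h2 := hxm u hu
      have h3 := hym u hu
      have h5 : ¬ (u.1 = x.1 ∧ u.2 = y.2) := fun hh => hv (by
        rwa [show ((x.1, y.2) : CoweightLattice) = u from Prod.ext hh.1.symm hh.2.symm])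
      simp only [Finset.mem_insert, Finset.mem_singleton, ext_iff, fund1, fund2, Prod.fst_add,
        Prod.snd_add]
      unfold Near at h1 h4
      omega

theorem pair_mem_faces {u v : CoweightLattice} (h : Near u v) :
    ({u, v} : Finset CoweightLattice) ∈ coxeterComplex.faces := by
  rw [mem_coxeterComplex_faces]
  refine ⟨by simp, ?_⟩
  simp [Near.refl, h, h.symm]

/-- The base chamber `{v, v + λ₁, v + λ₂}` at `v`. -/
def baseChamber (v : CoweightLattice) : Finset CoweightLattice := {v, v + fund1, v + fund2}

theorem baseChamber_mem_faces (v : CoweightLattice) : baseChamber v ∈ coxeterComplex.faces :=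
  ⟨by simp [baseChamber], _, ⟨v, Or.inl rfl⟩, subset_rfl⟩

theorem self_mem_baseChamber (v : CoweightLattice) : v ∈ baseChamber v := by simp [baseChamber]

theorem card_baseChamber (v : CoweightLattice) : (baseChamber v).card = 3 := by
  rw [baseChamber, Finset.card_eq_three]
  refine ⟨_, _, _, ?_, ?_, ?_, rfl⟩ <;> simp [fund1, fund2]

theorem le_of_mem_baseChamber {u v : CoweightLattice} (h : u ∈ baseChamber v) : v ≤ u := by
  simp only [baseChamber, Finset.mem_insert, Finset.mem_singleton, ext_iff, fund1, fund2,
    Prod.fst_add, Prod.snd_add] at h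
  rw [Prod.le_def]
  omega

theorem le_add_of_mem_baseChamber {u v : CoweightLattice} (h : u ∈ baseChamber v) :
    u ≤ v + (1, 1) := by
  simp only [baseChamber, Finset.mem_insert, Finset.mem_singleton, ext_iff, fund1, fund2,
    Prod.fst_add, Prod.snd_add] at h
  rw [Prod.le_def]
  simp only [Prod.fst_add, Prod.snd_add]
  omega

/-- The three neighbours of the origin of type `1`. -/
def step : Fin 3 → CoweightLattice := ![(1, 0), (-1, 1), (0, -1)]

theorem near_add_step (v : CoweightLattice) (i : Fin 3) : Near v (v + step i) := by
  fin_cases i <;> simp [Near, step]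

theorem step_injective : Function.Injective step := by decide

theorem vertexType_add (u v : CoweightLattice) :
    vertexType (u + v) = vertexType u + vertexType v := by
  simp only [vertexType, Prod.fst_add, Prod.snd_add]
  push_cast
  ring

theorem vertexType_step : ∀ i, vertexType (step i) = 1 := by decide

theorem exists_step {u v : CoweightLattice} (h : Near u v)
    (ht : vertexType v = vertexType u + 1) : ∃ i, v = u + step i := by
  rw [show (1 : ZMod 3) = vertexType (1, 0) by decide, ← vertexType_add, vertexType_eq_iff] at ht
  simp only [Prod.fst_add, Prod.snd_add] at ht
  unfold Near at h
  have : (v.1 = u.1 + 1 ∧ v.2 = u.2) ∨ (v.1 = u.1 - 1 ∧ v.2 = u.2 + 1) ∨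
      (v.1 = u.1 ∧ v.2 = u.2 - 1) := by omega
  rcases this with h | h | h
  · exact ⟨0, by rw [ext_iff]; simp [step]; omega⟩
  · exact ⟨1, by rw [ext_iff]; simp [step]; omega⟩
  · exact ⟨2, by rw [ext_iff]; simp [step]; omega⟩

theorem step_add_step : ∀ i j k l : Fin 3, step i + step j = step k + step l → i ≠ k → i = l := by
  decide

theorem fin3_eq {σ τ : Fin 3 → Fin 3} (hσ : Function.Injective σ) (hτ : Function.Injective τ)
    {i : Fin 3} (h : ∀ k ≠ i, τ k = σ k) : τ i = σ i := by
  revert σ τ i; decide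

/-- With `α := Prop` this also serves as an induction along edges over the whole lattice. -/
theorem eq_of_add_fund {α : Type*} {g : CoweightLattice → α} (h1 : ∀ x, g (x + (1, 0)) = g x)
    (h2 : ∀ x, g (x + (0, 1)) = g x) (x : CoweightLattice) : g x = g 0 := by
  have H1 : ∀ (n : ℤ) x, g (x + (n, 0)) = g x := by
    intro n
    induction n using Int.induction_on with
    | zero => intro x; exact congrArg g (add_zero x)
    | succ n ih => intro x; rw [← ih x, ← h1 (x + ((n : ℤ), 0))]; congr 1; ext <;> simp; ring
    | pred n ih =>
      intro x; rw [← ih x, ← h1 (x + (-(n : ℤ) - 1, 0))]; congr 1; ext <;> simp; ring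
  have H2 : ∀ (n : ℤ) x, g (x + (0, n)) = g x := by
    intro n
    induction n using Int.induction_on with
    | zero => intro x; exact congrArg g (add_zero x)
    | succ n ih => intro x; rw [← ih x, ← h2 (x + (0, (n : ℤ)))]; congr 1; ext <;> simp; ring
    | pred n ih =>
      intro x; rw [← ih x, ← h2 (x + (0, -(n : ℤ) - 1))]; congr 1; ext <;> simp; ring
  have := H1 x.1 0
  rw [← this, ← H2 x.2 (0 + (x.1, 0))]
  congr 1
  ext <;> simp

/-- Type-preserving simplicial injections of the Coxeter complex into itself are affine. -/
theorem exists_affine {f : CoweightLattice → CoweightLattice} (hf : Function.Injective f)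
    (hn : ∀ u v, Near u v → Near (f u) (f v)) (ht : ∀ u, vertexType (f u) = vertexType u) :
    ∃ i k : Fin 3, ∀ u, f u = f 0 + (u.1 • step i - u.2 • step k) := by
  have key : ∀ x i, ∃ j, f (x + step i) = f x + step j := fun x i =>
    exists_step (hn _ _ (near_add_step x i)) (by rw [ht, ht, vertexType_add, vertexType_step])
  choose σ hσ using key
  have hinj : ∀ x, Function.Injective (σ x) := by
    intro x i j hij
    have h1 := hσ x i
    rw [hij, ← hσ x j] at h1
    exact step_injective (add_left_cancel (hf h1))
  -- The two routes around the parallelogram spanned by `step i` and `step j` end at the same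
  -- vertex, so the image steps have equal sums, and `step_add_step` matches opposite sides.
  have h1 : ∀ x i j, i ≠ j → σ (x + step j) i = σ x i := by
    intro x i j hij
    have h1 := hσ (x + step j) i
    have h2 := hσ (x + step i) j
    rw [add_right_comm, h1, hσ, hσ, add_assoc, add_assoc] at h2
    exact (step_add_step _ _ _ _ (add_left_cancel h2).symm (fun h => hij (hinj x h))).symm
  -- An injection of three letters is determined by two of its values, which settles `i = j`.
  have h2 : ∀ x i j, σ (x + step j) i = σ x i := by
    intro x i j
    by_cases hij : i = j
    · subst hij
      exact fin3_eq (hinj x) (hinj _) fun k hk => h1 x k i hk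
    · exact h1 x i j hij
  have hc : ∀ x, σ x = σ 0 := by
    apply eq_of_add_fund
    · intro x; ext1 i; exact h2 x i 0
    · intro x; ext1 i
      have := h2 (x + (0, 1)) i 2
      rw [← this]
      congr 1
      ext <;> simp [step]
  refine ⟨σ 0 0, σ 0 2, fun u => ?_⟩
  have := eq_of_add_fund (g := fun u => f u - (u.1 • step (σ 0 0) - u.2 • step (σ 0 2))) ?_ ?_ u
  · simp only [Prod.fst_zero, Prod.snd_zero, zero_smul, sub_zero] at this
    rw [← this]; abel
  · intro x
    simp only [Prod.fst_add, Prod.snd_add, add_smul]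
    rw [show x + (1, 0) = x + step 0 from rfl, hσ x 0, hc x]
    simp only [one_smul, zero_smul]
    abel
  · intro x
    have := hσ (x + (0, 1)) 2
    rw [hc, show x + (0, 1) + step 2 = x by ext <;> simp [step]] at this
    simp only [Prod.fst_add, Prod.snd_add, add_smul, one_smul, zero_smul, this]
    abel

/-- Rigidity: the map is affine by `exists_affine`, hence determined by its values on one chamber.
-/
theorem eq_self_of_fixes_baseChamber {f : CoweightLattice → CoweightLattice}
    (hf : Function.Injective f) (hn : ∀ u v, Near u v → Near (f u) (f v))
    (ht : ∀ u, vertexType (f u) = vertexType u) {v : CoweightLattice}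
    (hv : ∀ u ∈ baseChamber v, f u = u) (u : CoweightLattice) : f u = u := by
  obtain ⟨i, k, h⟩ := exists_affine hf hn ht
  have h0 := hv v (by simp [baseChamber])
  have h1 := hv (v + fund1) (by simp [baseChamber])
  have h2 := hv (v + fund2) (by simp [baseChamber])
  rw [h] at h0 h1 h2
  simp only [fund1, fund2, Prod.fst_add, Prod.snd_add, add_smul, one_smul,
    add_zero] at h1 h2
  have e1 : step i = (1, 0) := by
    have : f 0 + (v.1 • step i + step i - v.2 • step k) = v + step i := by
      conv_rhs => rw [← h0]
      abel
    rw [this] at h1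
    exact add_left_cancel h1
  have e2 : - step k = (0, 1) := by
    have : f 0 + (v.1 • step i - (v.2 • step k + step k)) = v + - step k := by
      conv_rhs => rw [← h0]
      abel
    rw [this] at h2
    exact add_left_cancel h2
  have e3 : v.1 • step i - v.2 • step k = v := by
    rw [sub_eq_add_neg, ← smul_neg, e1, e2]; ext <;> simp
  have e4 : f 0 = 0 := by rw [e3] at h0; simpa using h0
  rw [h, e4, sub_eq_add_neg, ← smul_neg, e1, e2]
  ext <;> simp

end CoweightLattice

-- The induction is on the level difference: a vertex of the interval other than `b` can be raised
-- by λ₁ or by λ₂ without leaving the interval.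
open CoweightLattice in
theorem CoweightLattice.le_induction {P : CoweightLattice → Prop} {a b : CoweightLattice}
    (hab : a ≤ b) (h0 : P b)
    (h1 : ∀ u, a ≤ u → u + fund1 ≤ b → P (u + fund1) → P u)
    (h2 : ∀ u, a ≤ u → u + fund2 ≤ b → P (u + fund2) → P u) : P a := by
  suffices H : ∀ n : ℕ, ∀ u, a ≤ u → u ≤ b → level b - level u = n → P u by
    refine H (level b - level a).toNat a le_rfl hab ?_
    rw [Prod.le_def] at hab
    unfold level
    omega
  intro n
  induction n with
  | zero =>
    intro u _ hub h
    have : u = b := by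
      rw [Prod.le_def] at hub
      unfold level at h
      rw [CoweightLattice.ext_iff]
      omega
    rwa [this]
  | succ n ih =>
    intro u hau hub h
    by_cases hu : u.1 < b.1
    · have hle : u + fund1 ≤ b := by
        rw [Prod.le_def] at *
        simp only [fund1, Prod.fst_add, Prod.snd_add]
        omega
      refine h1 u hau hle (ih _ (hau.trans ?_) hle ?_)
      · rw [Prod.le_def]; simp [fund1]
      · simp only [level, fund1, Prod.fst_add, Prod.snd_add] at *; push_cast at h; omega
    · have hle : u + fund2 ≤ b := by
        rw [Prod.le_def] at *
        simp only [fund2, Prod.fst_add, Prod.snd_add, level] at *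
        omega
      refine h2 u hau hle (ih _ (hau.trans ?_) hle ?_)
      · rw [Prod.le_def]; simp [fund2]
      · simp only [level, fund2, Prod.fst_add, Prod.snd_add] at *; push_cast at h; omega

/-! ### Retractions centred at a chamber and convexity of apartments. -/

namespace TypedComplex

open CoweightLattice hiding ext_iff

variable {V : Type*} {X : TypedComplex V}

/-- Equality or adjacency of vertices. -/
def Near (X : TypedComplex V) (x y : V) : Prop := ∃ s ∈ X.complex.faces, x ∈ s ∧ y ∈ s

theorem Near.symm {x y : V} (h : X.Near x y) : X.Near y x := by
  obtain ⟨s, hs, hx, hy⟩ := h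
  exact ⟨s, hs, hy, hx⟩

theorem Near.refl (x : V) : X.Near x x :=
  ⟨{x}, X.complex.singleton_mem x, by simp, by simp⟩

theorem Chart.near (φ : X.Chart) {u v : CoweightLattice} (h : CoweightLattice.Near u v) :
    X.Near (φ u) (φ v) :=
  ⟨_, φ.map_face _ (pair_mem_faces h), Finset.mem_map_of_mem _ (by simp),
    Finset.mem_map_of_mem _ (by simp)⟩

theorem Chart.injective (φ : X.Chart) : Function.Injective φ := φ.toEmb.injective

theorem Chart.mem_range_of_mem {φ : X.Chart} {s : Finset V} (hs : s ∈ φ.image) {x : V}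
    (hx : x ∈ s) : x ∈ Set.range φ := by
  obtain ⟨t, -, rfl⟩ := hs
  obtain ⟨u, -, rfl⟩ := Finset.mem_map.1 hx
  exact ⟨u, rfl⟩

theorem Chart.near_of_mem_image {φ : X.Chart} {s : Finset V} (hs : s ∈ φ.image)
    {u v : CoweightLattice} (hu : φ u ∈ s) (hv : φ v ∈ s) : CoweightLattice.Near u v := by
  obtain ⟨t, ht, rfl⟩ := hs
  have hu := (Finset.mem_map' _).1 hu
  have hv := (Finset.mem_map' _).1 hv
  exact (mem_coxeterComplex_faces.1 ht).2 u hu v hv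

theorem Chart.map_mem_image (φ : X.Chart) {s : Finset CoweightLattice}
    (hs : s ∈ coxeterComplex.faces) : s.map φ.toEmb ∈ φ.image := ⟨s, hs, rfl⟩

theorem Chart.image_subset_faces (φ : X.Chart) : φ.image ⊆ X.complex.faces := by
  rintro _ ⟨s, hs, rfl⟩
  exact φ.map_face s hs

theorem Chart.range_subset_of_image_subset {φ φ' : X.Chart} (h : φ.image ⊆ φ'.image) :
    Set.range φ ⊆ Set.range φ' := by
  rintro _ ⟨u, rfl⟩
  exact Chart.mem_range_of_mem (h (φ.map_mem_image (coxeterComplex.singleton_mem u)))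
    (Finset.mem_map_of_mem _ (by simp))

/-- Two charts with the same image differ by a type-preserving automorphism of `Σ`. -/
theorem Chart.exists_reparam {φ φ' : X.Chart} (h : φ.image = φ'.image) :
    ∃ f : CoweightLattice → CoweightLattice, Function.Injective f ∧
      (∀ u v, CoweightLattice.Near u v → CoweightLattice.Near (f u) (f v)) ∧
      (∀ u, vertexType (f u) = vertexType u) ∧ ∀ u, φ u = φ' (f u) := by
  have : ∀ u, ∃ w, φ' w = φ u := fun u => Chart.range_subset_of_image_subset h.subset ⟨u, rfl⟩
  choose f hf using this
  refine ⟨f, fun u v huv => φ.injective ?_, fun u v huv => ?_, fun u => ?_, fun u => (hf u).symm⟩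
  · rw [← hf u, huv, hf v]
  · have := φ.map_mem_image (pair_mem_faces huv)
    rw [h] at this
    refine Chart.near_of_mem_image this ?_ ?_ <;> rw [hf] <;>
      exact Finset.mem_map_of_mem _ (by simp)
  · rw [← φ'.type_eq, ← φ.type_eq]
    exact congrArg _ (hf u)

/-- The charts agree on the base chamber at `v`. -/
def Chart.Agree (φ φ' : X.Chart) (v : CoweightLattice) : Prop := ∀ u ∈ baseChamber v, φ u = φ' u

theorem Chart.Agree.symm {φ φ' : X.Chart} {v : CoweightLattice} (h : φ.Agree φ' v) :
    φ'.Agree φ v := fun u hu => (h u hu).symm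

theorem Chart.Agree.trans {φ φ' φ'' : X.Chart} {v : CoweightLattice} (h : φ.Agree φ' v)
    (h' : φ'.Agree φ'' v) : φ.Agree φ'' v := fun u hu => (h u hu).trans (h' u hu)

theorem Chart.mem_image_of_forall {φ φ' : X.Chart} {s : Finset CoweightLattice}
    (hs : s ∈ coxeterComplex.faces) (h : ∀ u ∈ s, φ u = φ' u) : s.map φ.toEmb ∈ φ'.image := by
  refine ⟨s, hs, ?_⟩
  ext x
  simp only [Finset.mem_map]
  constructor
  · rintro ⟨u, hu, rfl⟩; exact ⟨u, hu, (h u hu).symm⟩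
  · rintro ⟨u, hu, rfl⟩; exact ⟨u, hu, h u hu⟩

namespace IsTriangleBuilding

/-- The isomorphism supplied by the building axiom is `φ'` composed with an automorphism of Σ that
fixes a chamber, and such an automorphism is the identity. -/
theorem eq_on_range (hX : X.IsTriangleBuilding) {φ φ' : X.Chart} {v : CoweightLattice}
    (h : φ.Agree φ' v) {u : CoweightLattice} (hu : φ u ∈ Set.range φ') : φ' u = φ u := by
  obtain ⟨ψ, hψ, hψφ⟩ := hX.exists_isom φ φ' ⟨(baseChamber v).map φ.toEmb,
    ⟨φ.map_mem_image (baseChamber_mem_faces v),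
      Chart.mem_image_of_forall (baseChamber_mem_faces v) h⟩,
    by rw [Finset.card_map, card_baseChamber]⟩
  obtain ⟨f, hf, hn, ht, hfψ⟩ := Chart.exists_reparam hψ
  have hfix : ∀ u, f u = u := by
    refine eq_self_of_fixes_baseChamber hf hn ht (v := v) fun w hw => φ'.injective ?_
    rw [← hfψ, hψφ w ⟨w, (h w hw).symm⟩, h w hw]
  rw [← hψφ u hu, hfψ, hfix]

/-- This makes the retraction centred at a chamber independent of the chosen chart. -/
theorem eq_of_agree (hX : X.IsTriangleBuilding) {φ φ' : X.Chart} {v : CoweightLattice}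
    (h : φ.Agree φ' v) {u u' : CoweightLattice} (hu : φ u = φ' u') : u = u' :=
  φ'.injective ((hX.eq_on_range h ⟨u', hu.symm⟩).trans hu)

/-- An apartment containing both the base chamber and `s` is recoordinatised by the isomorphism that
fixes its intersection with the apartment of `φ`. -/
theorem exists_agree_of_mem_faces (hX : X.IsTriangleBuilding) (φ : X.Chart) (v : CoweightLattice)
    {s : Finset V} (hs : s ∈ X.complex.faces) : ∃ χ : X.Chart, χ.Agree φ v ∧ s ∈ χ.image := by
  have hD := φ.map_mem_image (baseChamber_mem_faces v)
  obtain ⟨χ₀, hD', hs'⟩ := hX.exists_apartment _ (φ.image_subset_faces hD) s hs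
  obtain ⟨χ, hχ, hχφ⟩ := hX.exists_isom φ χ₀ ⟨_, ⟨hD, hD'⟩,
    by rw [Finset.card_map, card_baseChamber]⟩
  exact ⟨χ, fun u hu => hχφ u (Chart.mem_range_of_mem hD' (Finset.mem_map_of_mem _ hu)),
    hχ.symm ▸ hs'⟩

theorem exists_agree (hX : X.IsTriangleBuilding) (φ : X.Chart) (v : CoweightLattice) (x : V) :
    ∃ u, ∃ χ : X.Chart, χ.Agree φ v ∧ χ u = x := by
  obtain ⟨χ, h, hx⟩ := hX.exists_agree_of_mem_faces φ v (X.complex.singleton_mem x)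
  obtain ⟨u, hu⟩ := Chart.mem_range_of_mem hx (by simp : x ∈ _)
  exact ⟨u, χ, h, hu⟩

/-- The retraction onto the apartment of `φ` centred at the base chamber at `v`. -/
noncomputable def retr (hX : X.IsTriangleBuilding) (φ : X.Chart) (v : CoweightLattice) (x : V) :
    CoweightLattice := (hX.exists_agree φ v x).choose

theorem exists_chart_retr (hX : X.IsTriangleBuilding) (φ : X.Chart) (v : CoweightLattice) (x : V) :
    ∃ χ : X.Chart, χ.Agree φ v ∧ χ (hX.retr φ v x) = x := (hX.exists_agree φ v x).choose_spec

theorem retr_eq (hX : X.IsTriangleBuilding) {φ χ : X.Chart} {v : CoweightLattice}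
    (h : χ.Agree φ v) (u : CoweightLattice) : hX.retr φ v (χ u) = u := by
  obtain ⟨χ', h', hx⟩ := hX.exists_chart_retr φ v (χ u)
  exact hX.eq_of_agree (h'.trans h.symm) hx

theorem retr_apply (hX : X.IsTriangleBuilding) (φ : X.Chart) (v u : CoweightLattice) :
    hX.retr φ v (φ u) = u := hX.retr_eq (fun _ _ => rfl) u

/-- One chart agreeing with `φ` at `v` covers a simplex through `x` and `y`, so both images are read
off in the same coordinates. -/
theorem retr_near (hX : X.IsTriangleBuilding) (φ : X.Chart) (v : CoweightLattice) {x y : V}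
    (h : X.Near x y) : CoweightLattice.Near (hX.retr φ v x) (hX.retr φ v y) := by
  obtain ⟨s, hs, hx, hy⟩ := h
  obtain ⟨χ, hχ, hsχ⟩ := hX.exists_agree_of_mem_faces φ v hs
  obtain ⟨a, rfl⟩ := Chart.mem_range_of_mem hsχ hx
  obtain ⟨b, rfl⟩ := Chart.mem_range_of_mem hsχ hy
  rw [hX.retr_eq hχ, hX.retr_eq hχ]
  exact Chart.near_of_mem_image hsχ hx hy

theorem vertexType_retr (hX : X.IsTriangleBuilding) (φ : X.Chart) (v : CoweightLattice) (x : V) :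
    vertexType (hX.retr φ v x) = X.type x := by
  obtain ⟨χ, -, h⟩ := hX.exists_chart_retr φ v x
  conv_rhs => rw [← h]
  exact (χ.type_eq _).symm

theorem apply_retr (hX : X.IsTriangleBuilding) (φ : X.Chart) (v : CoweightLattice) {x : V}
    (h : hX.retr φ v x ∈ baseChamber v) : φ (hX.retr φ v x) = x := by
  obtain ⟨χ, hχ, hx⟩ := hX.exists_chart_retr φ v x
  rw [← hχ _ h, hx]

theorem near_of_near_apply (hX : X.IsTriangleBuilding) (φ : X.Chart) {u v : CoweightLattice}
    (h : X.Near (φ u) (φ v)) : CoweightLattice.Near u v := by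
  simpa [hX.retr_apply] using hX.retr_near φ 0 h

/-- A retraction is simplicial, so the level rises by at most one along each edge of a monotone path
from `a` to `b`. -/
theorem level_retr_le (hX : X.IsTriangleBuilding) (φ χ : X.Chart) (v : CoweightLattice)
    {a b : CoweightLattice} (hab : a ≤ b) :
    level (hX.retr φ v (χ b)) - level (hX.retr φ v (χ a)) ≤ level b - level a := by
  have key : ∀ u w, CoweightLattice.Near u w →
      level (hX.retr φ v (χ w)) - level (hX.retr φ v (χ u)) ≤ 1 := by
    intro u w h
    have := hX.retr_near φ v (χ.near h)
    unfold CoweightLattice.Near at this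
    unfold level
    omega
  refine CoweightLattice.le_induction (P := fun a =>
    level (hX.retr φ v (χ b)) - level (hX.retr φ v (χ a)) ≤ level b - level a) hab (by omega)
    (fun u _ _ ih => ?_) fun u _ _ ih => ?_
  · have := key u (u + fund1) (by simp [CoweightLattice.Near, fund1])
    simp only [level, fund1, Prod.fst_add, Prod.snd_add] at *
    omega
  · have := key u (u + fund2) (by simp [CoweightLattice.Near, fund2])
    simp only [level, fund2, Prod.fst_add, Prod.snd_add] at *
    omega

/-- Vertices on a geodesic between two vertices of an apartment belong to the apartment. -/
theorem eq_of_between (hX : X.IsTriangleBuilding) {φ χ ψ : X.Chart} {a b c : CoweightLattice}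
    (hab : a ≤ b) (hbc : b ≤ c) (ha : φ a = χ a) (hb : χ b = ψ b) (hc : ψ c = φ c) :
    φ b = χ b := by
  have key : ∀ u t, u + t ≤ b → (t = fund1 ∨ t = fund2) → φ u = χ u →
      φ (u + t) = χ (u + t) := by
    intro u t hub ht hu
    have hnear : CoweightLattice.Near u (u + t) := by
      rcases ht with rfl | rfl <;> simp [CoweightLattice.Near, fund1, fund2]
    -- Retract the path that follows `χ` to `b` and `ψ` to `c`. Its ends are fixed and the total
    -- rise is the largest possible, so the first edge must rise by one level. Adjacency and type
    -- then force the image `u + t`. This lies in the base chamber at `u`, where the retraction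
    -- moves nothing.
    have h1 := hX.level_retr_le φ χ u hub
    have h2 := hX.level_retr_le φ ψ u hbc
    rw [hc, hX.retr_apply, ← hb] at h2
    have h3 := hX.retr_near φ u (χ.near hnear)
    rw [← hu, hX.retr_apply] at h3
    have h4 := (hX.vertexType_retr φ u (χ (u + t))).trans (χ.type_eq _)
    have h5 : hX.retr φ u (χ (u + t)) = u + t := by
      generalize hX.retr φ u (χ (u + t)) = w at *
      rw [vertexType_eq_iff] at h4
      rw [CoweightLattice.ext_iff]
      unfold CoweightLattice.Near at h3
      rcases ht with rfl | rfl <;>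
      · simp only [level, fund1, fund2, Prod.fst_add, Prod.snd_add] at *
        omega
    have h6 := hX.apply_retr φ u (x := χ (u + t)) (by
      rw [h5]; rcases ht with rfl | rfl <;> simp [baseChamber])
    rwa [h5] at h6
  exact CoweightLattice.le_induction (P := fun a => φ a = χ a → φ b = χ b) hab id
    (fun u _ hle ih h => ih (key u _ hle (Or.inl rfl) h))
    (fun u _ hle ih h => ih (key u _ hle (Or.inr rfl) h)) ha

theorem eq_on_Icc (hX : X.IsTriangleBuilding) {φ χ : X.Chart} {a c : CoweightLattice}
    (ha : φ a = χ a) (hc : φ c = χ c) {b : CoweightLattice} (hab : a ≤ b) (hbc : b ≤ c) :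
    φ b = χ b := hX.eq_of_between hab hbc ha rfl hc.symm

end IsTriangleBuilding

end TypedComplex

/-! ### The retraction centred at a boundary point, and sectors towards that point. -/

namespace TypedComplex

open CoweightLattice hiding ext_iff
open Filter

variable {V : Type*} {X : TypedComplex V}

namespace IsTriangleBuilding

theorem exists_chart_mem_mem (hX : X.IsTriangleBuilding) (x y : V) :
    ∃ (χ : X.Chart) (a b : CoweightLattice), χ a = x ∧ χ b = y := by
  obtain ⟨χ, hx, hy⟩ := hX.exists_apartment _ (X.complex.singleton_mem x) _
    (X.complex.singleton_mem y)
  obtain ⟨a, ha⟩ := Chart.mem_range_of_mem hx (by simp : x ∈ _)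
  obtain ⟨b, hb⟩ := Chart.mem_range_of_mem hy (by simp : y ∈ _)
  exact ⟨χ, a, b, ha, hb⟩

/-- The bound is zero at `φ₀ 0` and grows by at most one per edge on a path to `x`, whatever the
centre `v` is. -/
theorem exists_retr_mem_Icc (hX : X.IsTriangleBuilding) (φ₀ : X.Chart) (x : V) :
    ∃ K : ℤ, ∀ v, hX.retr φ₀ v x ∈ Set.Icc ((-K, -K) : CoweightLattice) (K, K) := by
  have step : ∀ y z, X.Near y z →
      (∃ K : ℤ, ∀ v, hX.retr φ₀ v y ∈ Set.Icc ((-K, -K) : CoweightLattice) (K, K)) →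
      ∃ K : ℤ, ∀ v, hX.retr φ₀ v z ∈ Set.Icc ((-K, -K) : CoweightLattice) (K, K) := by
    rintro y z h ⟨K, hK⟩
    refine ⟨K + 1, fun v => ?_⟩
    have h1 := hK v
    have h2 := hX.retr_near φ₀ v h
    simp only [Set.mem_Icc, Prod.le_def] at *
    unfold CoweightLattice.Near at h2
    omega
  obtain ⟨χ, a, b, ha, rfl⟩ := hX.exists_chart_mem_mem (φ₀ 0) x
  -- Having some bound is a property that passes along edges in both directions, so it is constant
  -- on the apartment of `χ`.
  have hg := eq_of_add_fund (g := fun u =>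
    ∃ K : ℤ, ∀ v, hX.retr φ₀ v (χ u) ∈ Set.Icc ((-K, -K) : CoweightLattice) (K, K)) ?_ ?_
  · rw [hg b, ← hg a, ha]
    exact ⟨0, fun v => by rw [hX.retr_apply]; simp; rfl⟩
  · intro u
    have hn : X.Near (χ u) (χ (u + (1, 0))) := χ.near (by simp [CoweightLattice.Near])
    exact propext ⟨step _ _ hn.symm, step _ _ hn⟩
  · intro u
    have hn : X.Near (χ u) (χ (u + (0, 1))) := χ.near (by simp [CoweightLattice.Near])
    exact propext ⟨step _ _ hn.symm, step _ _ hn⟩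

/-- The images lie in a finite box, so some `lam` recurs along the diagonal. Two recurrences at `d m
≤ d n` force the chart through `x` to follow `φ₀` throughout the interval between them, so every
intermediate centre also gives `lam`. -/
theorem exists_eventually_retr (hX : X.IsTriangleBuilding) (φ₀ : X.Chart) (x : V) :
    ∃ lam, ∀ᶠ v in atBot, hX.retr φ₀ v x = lam := by
  obtain ⟨K, hK⟩ := hX.exists_retr_mem_Icc φ₀ x
  let d : ℕ → CoweightLattice := fun n => (-(n : ℤ), -(n : ℤ))
  obtain ⟨⟨lam, hlam⟩, hinf⟩ := Finite.exists_infinite_fiber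
    (fun n : ℕ => (⟨hX.retr φ₀ (d n) x, hK (d n)⟩ :
      Set.Icc ((-K, -K) : CoweightLattice) (K, K)))
  have hfreq : ∀ N : ℕ, ∃ n > N, hX.retr φ₀ (d n) x = lam := by
    intro N
    obtain ⟨n, hn, hN⟩ := (Set.infinite_coe_iff.1 hinf).exists_gt N
    exact ⟨n, hN, congrArg Subtype.val hn⟩
  -- The index is chosen so large that `d n ≤ lam`.
  obtain ⟨n, hn, hnlam⟩ := hfreq (lam.1.natAbs + lam.2.natAbs)
  have hdn : d n ≤ lam := by
    rw [Prod.le_def]; simp only [d]; omega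
  -- The shift by `(1, 1)` keeps the whole base chamber at `v` below `d n`.
  refine ⟨lam, eventually_atBot.2 ⟨d n - (1, 1), fun v hv => ?_⟩⟩
  obtain ⟨m, hm, hmlam⟩ := hfreq (v.1.natAbs + v.2.natAbs)
  have hdm : d m ≤ v := by
    rw [Prod.le_def]; simp only [d]; omega
  obtain ⟨χ, hχ, hχx⟩ := hX.exists_chart_retr φ₀ (d m) x
  obtain ⟨ψ, hψ, hψx⟩ := hX.exists_chart_retr φ₀ (d n) x
  rw [hmlam] at hχx
  rw [hnlam] at hψx
  have hm0 := hχ _ (self_mem_baseChamber _)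
  have hvn : v + (1, 1) ≤ d n := by rwa [le_sub_iff_add_le] at hv
  have hvn' : v ≤ d n := le_trans (by rw [Prod.le_def]; simp) hvn
  -- The path from `d m` to `d n` along `φ₀` and then to `lam` along `ψ` is a geodesic with both
  -- ends on `χ`.
  have h := hX.eq_of_between (hdm.trans hvn') hdn hm0 (hψ _ (self_mem_baseChamber _)).symm
    (hψx.trans hχx.symm)
  have hag : χ.Agree φ₀ v := fun u hu =>
    hX.eq_on_Icc hm0 h (hdm.trans (le_of_mem_baseChamber hu))
      ((le_add_of_mem_baseChamber hu).trans hvn)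
  rw [← hχx, hX.retr_eq hag]

/-- The level of a vertex: its image under the retraction centred at the boundary point that is
represented by the sectors `φ₀ (Set.Iic v)`. -/
noncomputable def lev (hX : X.IsTriangleBuilding) (φ₀ : X.Chart) (x : V) : CoweightLattice :=
  (hX.exists_eventually_retr φ₀ x).choose

theorem eventually_retr_eq_lev (hX : X.IsTriangleBuilding) (φ₀ : X.Chart) (x : V) :
    ∀ᶠ v in atBot, hX.retr φ₀ v x = hX.lev φ₀ x :=
  (hX.exists_eventually_retr φ₀ x).choose_spec

theorem lev_eq (hX : X.IsTriangleBuilding) {φ₀ : X.Chart} {x : V} {lam : CoweightLattice}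
    (h : ∀ᶠ v in atBot, ∃ χ : X.Chart, χ.Agree φ₀ v ∧ χ lam = x) : hX.lev φ₀ x = lam := by
  obtain ⟨v, h1, χ, h2, rfl⟩ := ((hX.eventually_retr_eq_lev φ₀ x).and h).exists
  rw [← h1, hX.retr_eq h2]

theorem eventually_exists_chart (hX : X.IsTriangleBuilding) (φ₀ : X.Chart) {s : Finset V}
    (hs : s ∈ X.complex.faces) :
    ∀ᶠ v in atBot, ∃ χ : X.Chart, χ.Agree φ₀ v ∧ s ∈ χ.image ∧
      ∀ x ∈ s, χ (hX.lev φ₀ x) = x := by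
  have h : ∀ᶠ v in atBot, ∀ x ∈ s, hX.retr φ₀ v x = hX.lev φ₀ x :=
    (Finset.eventually_all s).2 fun x _ => hX.eventually_retr_eq_lev φ₀ x
  filter_upwards [h] with v hv
  obtain ⟨χ, hχ, hsχ⟩ := hX.exists_agree_of_mem_faces φ₀ v hs
  refine ⟨χ, hχ, hsχ, fun x hx => ?_⟩
  obtain ⟨u, rfl⟩ := Chart.mem_range_of_mem hsχ hx
  rw [← hv _ hx, hX.retr_eq hχ]

theorem eventually_exists_chart_near (hX : X.IsTriangleBuilding) (φ₀ : X.Chart) {x y : V}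
    (h : X.Near x y) :
    ∀ᶠ v in atBot, ∃ χ : X.Chart, χ.Agree φ₀ v ∧
      χ (hX.lev φ₀ x) = x ∧ χ (hX.lev φ₀ y) = y := by
  obtain ⟨s, hs, hx, hy⟩ := h
  filter_upwards [hX.eventually_exists_chart φ₀ hs] with v ⟨χ, h1, _, h2⟩
  exact ⟨χ, h1, h2 x hx, h2 y hy⟩

theorem eventually_exists_chart_apply (hX : X.IsTriangleBuilding) (φ₀ : X.Chart) (x : V) :
    ∀ᶠ v in atBot, ∃ χ : X.Chart, χ.Agree φ₀ v ∧ χ (hX.lev φ₀ x) = x := by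
  filter_upwards [hX.eventually_exists_chart_near φ₀ (Near.refl x)] with v ⟨χ, h1, h2, _⟩
  exact ⟨χ, h1, h2⟩

theorem near_lev (hX : X.IsTriangleBuilding) (φ₀ : X.Chart) {x y : V} (h : X.Near x y) :
    CoweightLattice.Near (hX.lev φ₀ x) (hX.lev φ₀ y) := by
  obtain ⟨v, hx, hy⟩ := ((hX.eventually_retr_eq_lev φ₀ x).and
    (hX.eventually_retr_eq_lev φ₀ y)).exists
  rw [← hx, ← hy]
  exact hX.retr_near φ₀ v h

theorem vertexType_lev (hX : X.IsTriangleBuilding) (φ₀ : X.Chart) (x : V) :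
    vertexType (hX.lev φ₀ x) = X.type x := by
  obtain ⟨v, hx⟩ := (hX.eventually_retr_eq_lev φ₀ x).exists
  rw [← hx, hX.vertexType_retr]

/-- The charts through `x` that agree with `φ₀` far down all agree on `Set.Iic (lev x)`. -/
theorem exists_proj (hX : X.IsTriangleBuilding) (φ₀ : X.Chart) (x : V) {u : CoweightLattice}
    (hu : u ≤ hX.lev φ₀ x) :
    ∃ y, ∀ᶠ v in atBot, ∀ χ : X.Chart, χ.Agree φ₀ v → χ (hX.lev φ₀ x) = x → χ u = y := by
  obtain ⟨v₀, ⟨χ₀, h₀, hx₀⟩, hv₀⟩ :=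
    ((hX.eventually_exists_chart_apply φ₀ x).and (eventually_le_atBot u)).exists
  refine ⟨χ₀ u, ?_⟩
  filter_upwards [eventually_le_atBot v₀] with v hv χ hχ hx
  -- The route along `φ₀` to `v₀` and along `χ₀` to `x` has its ends on `χ`, so `χ` meets `χ₀` at
  -- `v₀` as well as at `x`; convexity gives all vertices between.
  have h := hX.eq_of_between hv (hv₀.trans hu) (hχ _ (self_mem_baseChamber _))
    (h₀ _ (self_mem_baseChamber _)).symm (hx₀.trans hx.symm)
  rw [← h₀ _ (self_mem_baseChamber _)] at h
  exact hX.eq_on_Icc h (hx.trans hx₀.symm) hv₀ hu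

/-- The vertex at `u` of the sector with base vertex `x` that represents the centre of the
retraction. -/
noncomputable def proj (hX : X.IsTriangleBuilding) (φ₀ : X.Chart) (u : CoweightLattice) (x : V) :
    V := Classical.epsilon (h := ⟨x⟩) fun y =>
      ∀ᶠ v in atBot, ∀ χ : X.Chart, χ.Agree φ₀ v → χ (hX.lev φ₀ x) = x → χ u = y

theorem proj_spec (hX : X.IsTriangleBuilding) (φ₀ : X.Chart) {x : V} {u : CoweightLattice}
    (hu : u ≤ hX.lev φ₀ x) :
    ∀ᶠ v in atBot, ∀ χ : X.Chart, χ.Agree φ₀ v → χ (hX.lev φ₀ x) = x →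
      χ u = hX.proj φ₀ u x :=
  Classical.epsilon_spec (hX.exists_proj φ₀ x hu)

theorem lev_proj (hX : X.IsTriangleBuilding) (φ₀ : X.Chart) {x : V} {u : CoweightLattice}
    (hu : u ≤ hX.lev φ₀ x) : hX.lev φ₀ (hX.proj φ₀ u x) = u := by
  refine hX.lev_eq ?_
  filter_upwards [hX.proj_spec φ₀ hu, hX.eventually_exists_chart_apply φ₀ x] with v h ⟨χ, h1, h2⟩
  exact ⟨χ, h1, h χ h1 h2⟩

theorem proj_lev (hX : X.IsTriangleBuilding) (φ₀ : X.Chart) (x : V) :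
    hX.proj φ₀ (hX.lev φ₀ x) x = x := by
  obtain ⟨v, h, χ, h1, h2⟩ := ((hX.proj_spec φ₀ (x := x) le_rfl).and
    (hX.eventually_exists_chart_apply φ₀ x)).exists
  rw [← h χ h1 h2, h2]

theorem proj_proj (hX : X.IsTriangleBuilding) (φ₀ : X.Chart) {x : V} {u w : CoweightLattice}
    (huw : u ≤ w) (hw : w ≤ hX.lev φ₀ x) :
    hX.proj φ₀ u (hX.proj φ₀ w x) = hX.proj φ₀ u x := by
  have hlev := hX.lev_proj φ₀ hw
  obtain ⟨v, h, h', h'', χ, h1, h2⟩ := ((hX.proj_spec φ₀ (huw.trans hw)).and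
    ((hX.proj_spec φ₀ hw).and ((hX.proj_spec φ₀ (huw.trans hlev.ge)).and
    (hX.eventually_exists_chart_apply φ₀ x)))).exists
  rw [← h χ h1 h2, ← h'' χ h1 (by rw [hlev, h' χ h1 h2])]

/-- Adjacent vertices lie on one chart that agrees with `φ₀` at a chamber far down, and both
projections are read off from it. -/
theorem proj_eq_proj_of_near (hX : X.IsTriangleBuilding) (φ₀ : X.Chart) {x y : V}
    (h : X.Near x y) {u : CoweightLattice} (hx : u ≤ hX.lev φ₀ x) (hy : u ≤ hX.lev φ₀ y) :
    hX.proj φ₀ u x = hX.proj φ₀ u y := by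
  obtain ⟨v, h, h', χ, h1, h2, h3⟩ := ((hX.proj_spec φ₀ hx).and ((hX.proj_spec φ₀ hy).and
    (hX.eventually_exists_chart_near φ₀ h))).exists
  rw [← h χ h1 h2, ← h' χ h1 h3]

/-- How far down agreement with `φ₀` is needed depends on `u`, so one chart is obtained for finitely
many `u` at a time. -/
theorem exists_chart_proj (hX : X.IsTriangleBuilding) (φ₀ : X.Chart) (x : V)
    (s : Finset CoweightLattice) (hs : ∀ u ∈ s, u ≤ hX.lev φ₀ x) :
    ∃ χ : X.Chart, ∀ u ∈ s, χ u = hX.proj φ₀ u x := by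
  have h : ∀ᶠ v in atBot, ∀ u ∈ s, ∀ χ : X.Chart, χ.Agree φ₀ v → χ (hX.lev φ₀ x) = x →
      χ u = hX.proj φ₀ u x :=
    (Finset.eventually_all s).2 fun u hu => hX.proj_spec φ₀ (hs u hu)
  obtain ⟨v, h, χ, h1, h2⟩ := (h.and (hX.eventually_exists_chart_apply φ₀ x)).exists
  exact ⟨χ, fun u hu => h u hu χ h1 h2⟩

theorem near_proj (hX : X.IsTriangleBuilding) (φ₀ : X.Chart) {x : V} {u w : CoweightLattice}
    (hu : u ≤ hX.lev φ₀ x) (hw : w ≤ hX.lev φ₀ x) (h : CoweightLattice.Near u w) :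
    X.Near (hX.proj φ₀ u x) (hX.proj φ₀ w x) := by
  obtain ⟨χ, hχ⟩ := hX.exists_chart_proj φ₀ x {u, w} (by simp [hu, hw])
  rw [← hχ u (by simp), ← hχ w (by simp)]
  exact χ.near h

/-- The sector from `x` shares a subsector with the reference sector, again because a geodesic
composed of pieces of `φ₀` and `χ₀` stays in one apartment. -/
theorem eventually_proj_eq (hX : X.IsTriangleBuilding) (φ₀ : X.Chart) (x : V) :
    ∀ᶠ u in atBot, hX.proj φ₀ u x = φ₀ u := by
  obtain ⟨v₀, ⟨χ₀, h₀, hx₀⟩, hv₀⟩ := ((hX.eventually_exists_chart_apply φ₀ x).and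
    (eventually_le_atBot (hX.lev φ₀ x))).exists
  filter_upwards [eventually_le_atBot v₀] with u hu
  obtain ⟨v, h, hvu, χ, hχ, hx⟩ := ((hX.proj_spec φ₀ (hu.trans hv₀)).and
    ((eventually_le_atBot u).and (hX.eventually_exists_chart_apply φ₀ x))).exists
  have hv := hχ _ (self_mem_baseChamber v)
  have h1 := hX.eq_of_between (hvu.trans hu) hv₀ hv
    (h₀ _ (self_mem_baseChamber _)).symm (hx₀.trans hx.symm)
  rw [← h χ hχ hx]
  exact hX.eq_on_Icc hv h1 hvu hu

/-- A chart that agrees with `φ₀` far down. -/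
def _root_.TypedComplex.Chart.Asymp (φ φ₀ : X.Chart) : Prop := ∃ v, ∀ u ≤ v, φ u = φ₀ u

theorem _root_.TypedComplex.Chart.Asymp.eventually_agree {φ φ₀ : X.Chart} (h : φ.Asymp φ₀) :
    ∀ᶠ v in atBot, φ.Agree φ₀ v := by
  obtain ⟨v₀, h⟩ := h
  refine eventually_atBot.2 ⟨v₀ - (1, 1), fun v hv u hu => h u ?_⟩
  rw [le_sub_iff_add_le] at hv
  exact (le_add_of_mem_baseChamber hu).trans hv

theorem lev_apply (hX : X.IsTriangleBuilding) {φ φ₀ : X.Chart} (h : φ.Asymp φ₀)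
    (u : CoweightLattice) : hX.lev φ₀ (φ u) = u :=
  hX.lev_eq (h.eventually_agree.mono fun _ hv => ⟨φ, hv, rfl⟩)

theorem proj_apply (hX : X.IsTriangleBuilding) {φ φ₀ : X.Chart} (h : φ.Asymp φ₀)
    {u w : CoweightLattice} (huw : u ≤ w) : hX.proj φ₀ u (φ w) = φ u := by
  have hlev := hX.lev_apply h w
  obtain ⟨v, h1, h2⟩ := ((hX.proj_spec φ₀ (x := φ w) (huw.trans hlev.ge)).and
    h.eventually_agree).exists
  exact (h1 φ h2 (by rw [hlev])).symm

end IsTriangleBuilding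

end TypedComplex

/-! ### The links of vertices. -/

namespace CoweightLattice

instance (u v : CoweightLattice) : Decidable (Near u v) := by unfold Near; infer_instance

theorem near_add_left_iff {i u v : CoweightLattice} : Near (i + u) (i + v) ↔ Near u v := by
  simp only [Near, Prod.fst_add, Prod.snd_add, add_sub_add_left_eq_sub]

theorem near_sub_left_iff {i u v : CoweightLattice} : Near (i - u) (i - v) ↔ Near u v := by
  simp only [Near, Prod.fst_sub, Prod.snd_sub]
  omega

theorem exists_step_pair {i j k : CoweightLattice} (hj : Near i j) (hk : Near i k) (hjk : j ≠ k)
    (ht : vertexType j = vertexType k) : ∃ a b, a ≠ b ∧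
      (j = i + step a ∧ k = i + step b ∧ vertexType j = vertexType i + 1 ∨
        j = i - step a ∧ k = i - step b ∧ vertexType i = vertexType j + 1) := by
  rcases (by decide : ∀ s t : ZMod 3, s = t ∨ t = s + 1 ∨ s = t + 1)
    (vertexType i) (vertexType j) with h | h | h
  · exact absurd ((hj.eq_of_vertexType_eq h).symm.trans (hk.eq_of_vertexType_eq (h.trans ht))) hjk
  · obtain ⟨a, ha⟩ := exists_step hj h
    obtain ⟨b, hb⟩ := exists_step hk (ht ▸ h)
    exact ⟨a, b, fun hab => hjk (by rw [ha, hb, hab]), Or.inl ⟨ha, hb, h⟩⟩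
  · obtain ⟨a, ha⟩ := exists_step hj.symm h
    obtain ⟨b, hb⟩ := exists_step hk.symm (ht ▸ h)
    have ha' := eq_sub_of_add_eq ha.symm
    have hb' := eq_sub_of_add_eq hb.symm
    exact ⟨a, b, fun hab => hjk (by rw [ha', hb', hab]), Or.inr ⟨ha', hb', h⟩⟩

/-- The three steps sum to zero, so the sum of two of them is minus the third: the vertex that lies
between them in the hexagon around the origin. -/
theorem step_pair_spec : ∀ a b : Fin 3, a ≠ b → Near (step a + step b) 0 ∧
    Near (step a + step b) (step a) ∧ Near (step a + step b) (step b) ∧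
    step a + step b ≠ 0 ∧ step a + step b ≠ step a ∧ step a + step b ≠ step b := by decide

theorem step_pair_unique : ∀ a b c : Fin 3, a ≠ b → Near (-step c) (step a) →
    Near (-step c) (step b) → -step c = step a + step b := by decide

theorem near_add_sub {i j k : CoweightLattice} (hj : Near i j) (hk : Near i k) (hjk : j ≠ k)
    (ht : vertexType j = vertexType k) :
    Near (j + k - i) i ∧ Near (j + k - i) j ∧ Near (j + k - i) k ∧
      j + k - i ≠ i ∧ j + k - i ≠ j ∧ j + k - i ≠ k := by
  obtain ⟨a, b, hab, ⟨rfl, rfl, -⟩ | ⟨rfl, rfl, -⟩⟩ := exists_step_pair hj hk hjk ht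
  · obtain ⟨h1, h2, h3, h4, h5, h6⟩ := step_pair_spec a b hab
    rw [show i + step a + (i + step b) - i = i + (step a + step b) by abel]
    refine ⟨?_, near_add_left_iff.2 h2, near_add_left_iff.2 h3, by simpa using h4,
      by simpa using h5, by simpa using h6⟩
    simpa using (near_add_left_iff (i := i)).2 h1
  · obtain ⟨h1, h2, h3, h4, h5, h6⟩ := step_pair_spec a b hab
    rw [show i - step a + (i - step b) - i = i - (step a + step b) by abel]
    refine ⟨?_, near_sub_left_iff.2 h2, near_sub_left_iff.2 h3, by simpa using h4,
      fun h => h5 (sub_right_injective h), fun h => h6 (sub_right_injective h)⟩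
    simpa using (near_sub_left_iff (i := i)).2 h1

theorem eq_of_near_of_vertexType_ne {i j k t : CoweightLattice}
    (hj : Near i j) (hk : Near i k) (hjk : j ≠ k) (ht : vertexType j = vertexType k)
    (hi : Near t i) (hj' : Near t j) (hk' : Near t k)
    (h1 : vertexType t ≠ vertexType i) (h2 : vertexType t ≠ vertexType j) : t = j + k - i := by
  have h3 := (by decide : ∀ r s : ZMod 3, (r ≠ s → r ≠ s + 1 → s = r + 1) ∧
    ∀ t, r ≠ s → r ≠ t → s = t + 1 → r = s + 1)
  obtain ⟨a, b, hab, ⟨rfl, rfl, h⟩ | ⟨rfl, rfl, h⟩⟩ := exists_step_pair hj hk hjk ht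
  · obtain ⟨c, rfl⟩ := exists_step hi ((h3 _ _).1 h1 (h ▸ h2))
    have e : ∀ s, Near t (t + step c + step s) → Near (-step c) (step s) := by
      intro s hs
      rw [← near_add_left_iff (i := t + step c)]
      simpa using hs
    have := step_pair_unique a b c hab (e a hj') (e b hk')
    rw [show t + step c + step a + (t + step c + step b) - (t + step c) =
      t + step c + (step a + step b) by abel, ← this]
    abel
  · obtain ⟨c, rfl⟩ := exists_step hi.symm ((h3 _ _).2 _ h1 h2 h)
    have e : ∀ s, Near (i + step c) (i - step s) → Near (-step c) (step s) := by
      intro s hs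
      rw [← near_sub_left_iff (i := i)]
      simpa using hs
    have := step_pair_unique a b c hab (e a hj') (e b hk')
    rw [show i - step a + (i - step b) - i = i - (step a + step b) by abel, ← this]
    abel

end CoweightLattice

namespace TypedComplex

open CoweightLattice hiding ext_iff
open Filter

variable {V : Type*} {X : TypedComplex V}

namespace IsTriangleBuilding

theorem eq_of_near_of_type_eq (hX : X.IsTriangleBuilding) {x y : V} (h : X.Near x y)
    (ht : X.type x = X.type y) : x = y := by
  obtain ⟨s, hs, hx, hy⟩ := h
  obtain ⟨χ, hχ, -⟩ := hX.exists_apartment s hs s hs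
  obtain ⟨a, rfl⟩ := Chart.mem_range_of_mem hχ hx
  obtain ⟨b, rfl⟩ := Chart.mem_range_of_mem hχ hy
  rw [χ.type_eq, χ.type_eq] at ht
  rw [(Chart.near_of_mem_image hχ hx hy).eq_of_vertexType_eq ht]

/-- An apartment containing the edge and the third vertex sees the same adjacencies, and Σ is a flag
complex. -/
theorem exists_face_of_near (hX : X.IsTriangleBuilding) {x y z : V} (hxy : X.Near x y)
    (hxz : X.Near x z) (hyz : X.Near y z) : ∃ s ∈ X.complex.faces, x ∈ s ∧ y ∈ s ∧ z ∈ s := by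
  obtain ⟨s, hs, hx, hy⟩ := hxy
  obtain ⟨χ, hsχ, hz⟩ := hX.exists_apartment s hs _ (X.complex.singleton_mem z)
  obtain ⟨a, rfl⟩ := Chart.mem_range_of_mem hsχ hx
  obtain ⟨b, rfl⟩ := Chart.mem_range_of_mem hsχ hy
  obtain ⟨c, rfl⟩ := Chart.mem_range_of_mem hz (by simp : z ∈ _)
  have h1 := Chart.near_of_mem_image hsχ hx hy
  have h2 := hX.near_of_near_apply χ hxz
  have h3 := hX.near_of_near_apply χ hyz
  refine ⟨({a, b, c} : Finset CoweightLattice).map χ.toEmb, χ.map_face _ ?_, ?_, ?_, ?_⟩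
  · rw [mem_coxeterComplex_faces]
    refine ⟨by simp, ?_⟩
    simp [h1, h2, h3, h1.symm, h2.symm, h3.symm, CoweightLattice.Near.refl]
  all_goals exact Finset.mem_map_of_mem _ (by simp)

/-- The vertices that form a chamber with the edge `{x, y}`. -/
def _root_.TypedComplex.thirds (X : TypedComplex V) (x y : V) : Set V :=
  {z | X.Near z x ∧ X.Near z y ∧ z ≠ x ∧ z ≠ y}

-- Adding a vertex to the edge is a bijection from the third vertices to the chambers on the edge.
open Classical in
theorem ncard_thirds (hX : X.IsTriangleBuilding) {q : ℕ} (hq : X.HasOrder q) {x y : V}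
    (hxy : X.Near x y) (hne : x ≠ y) : (X.thirds x y).ncard = q + 1 := by
  have hface : ({x, y} : Finset V) ∈ X.complex.faces := by
    obtain ⟨s, hs, hx, hy⟩ := hxy
    exact (X.complex.isRelLowerSet_faces hs).2
      (by simp [Finset.insert_subset_iff, hx, hy]) (by simp)
  rw [← hq _ hface (Finset.card_pair hne)]
  have himg : {c : Finset V | c ∈ X.complex.faces ∧ c.card = 3 ∧ {x, y} ⊆ c} =
      (fun z => insert z ({x, y} : Finset V)) '' X.thirds x y := by
    ext c
    constructor
    · rintro ⟨hc, hcard, hsub⟩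
      have h1 : (c \ {x, y}).card = 1 := by
        rw [Finset.card_sdiff_of_subset hsub, hcard, Finset.card_pair hne]
      obtain ⟨z, hz⟩ := Finset.card_eq_one.1 h1
      have hz' : z ∈ c \ {x, y} := by rw [hz]; simp
      simp only [Finset.mem_sdiff, Finset.mem_insert, Finset.mem_singleton, not_or] at hz'
      refine ⟨z, ⟨⟨c, hc, hz'.1, hsub (by simp)⟩, ⟨c, hc, hz'.1, hsub (by simp)⟩, hz'.2⟩, ?_⟩
      change insert z ({x, y} : Finset V) = c
      rw [Finset.insert_eq z, ← hz, Finset.sdiff_union_of_subset hsub]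
    · rintro ⟨z, ⟨hzx, hzy, hzx', hzy'⟩, rfl⟩
      obtain ⟨s, hs, h1, h2, h3⟩ := hX.exists_face_of_near hzx hzy hxy
      refine ⟨(X.complex.isRelLowerSet_faces hs).2 ?_ (by simp), ?_, Finset.subset_insert _ _⟩
      · simp [Finset.insert_subset_iff, h1, h2, h3]
      · rw [Finset.card_insert_of_notMem (by simp [hzx', hzy']), Finset.card_pair hne]
  rw [himg, Set.InjOn.ncard_image]
  rintro z ⟨-, -, hzx, hzy⟩ z' - h
  have : z ∈ insert z' ({x, y} : Finset V) := by
    rw [← show insert z ({x, y} : Finset V) = insert z' {x, y} from h]; simp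
  simpa [hzx, hzy] using this

/-- The link of a vertex is a projective plane. -/
theorem existsUnique_join (hX : X.IsTriangleBuilding) {x y y' : V} (hy : X.Near x y)
    (hy' : X.Near x y') (hne : y ≠ y') (ht : X.type y = X.type y') :
    ∃! z, X.Near z x ∧ X.Near z y ∧ X.Near z y' ∧ z ≠ x ∧ z ≠ y ∧ z ≠ y' := by
  obtain ⟨s, hs, hxs, hys⟩ := hy
  obtain ⟨s', hs', hxs', hys'⟩ := hy'
  obtain ⟨χ, hsχ, hsχ'⟩ := hX.exists_apartment s hs s' hs'
  obtain ⟨i, rfl⟩ := Chart.mem_range_of_mem hsχ hxs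
  obtain ⟨j, rfl⟩ := Chart.mem_range_of_mem hsχ hys
  obtain ⟨k, rfl⟩ := Chart.mem_range_of_mem hsχ' hys'
  have hij := Chart.near_of_mem_image hsχ hxs hys
  have hik := Chart.near_of_mem_image hsχ' hxs' hys'
  have hjk : j ≠ k := fun h => hne (by rw [h])
  have ht' : vertexType j = vertexType k := by rwa [χ.type_eq, χ.type_eq] at ht
  obtain ⟨h1, h2, h3, h4, h5, h6⟩ := near_add_sub hij hik hjk ht'
  refine ⟨χ (j + k - i), ⟨χ.near h1, χ.near h2, χ.near h3, χ.injective.ne h4, χ.injective.ne h5,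
    χ.injective.ne h6⟩, ?_⟩
  rintro z ⟨hzi, hzj, hzk, hni, hnj, -⟩
  -- Uniqueness: the retraction centred at the chamber at `j + k - i` keeps adjacency and type, so
  -- it sends `z` to the one possible place. That place lies in the central chamber, over which the
  -- retraction is injective.
  have hr : hX.retr χ (j + k - i) z = j + k - i := by
    refine eq_of_near_of_vertexType_ne hij hik hjk ht' ?_ ?_ ?_ ?_ ?_
    · simpa [hX.retr_apply] using hX.retr_near χ (j + k - i) hzi
    · simpa [hX.retr_apply] using hX.retr_near χ (j + k - i) hzj
    · simpa [hX.retr_apply] using hX.retr_near χ (j + k - i) hzk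
    · rw [hX.vertexType_retr, ← χ.type_eq]
      exact fun h => hni (hX.eq_of_near_of_type_eq hzi h)
    · rw [hX.vertexType_retr, ← χ.type_eq]
      exact fun h => hnj (hX.eq_of_near_of_type_eq hzj h)
  have := hX.apply_retr χ (j + k - i) (x := z) (by rw [hr]; exact self_mem_baseChamber _)
  rw [← this, hr]

/-- An edge of an apartment already lies on two chambers of that apartment. -/
theorem order_pos (hX : X.IsTriangleBuilding) {q : ℕ} (hq : X.HasOrder q) (φ : X.Chart) :
    q ≠ 0 := by
  intro h0
  have h := hX.ncard_thirds hq (φ.near (u := 0) (v := fund1) (by simp [CoweightLattice.Near, fund1]))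
    (φ.injective.ne (by decide))
  rw [h0, zero_add, Set.ncard_eq_one] at h
  obtain ⟨z, hz⟩ := h
  have h1 : φ fund2 ∈ X.thirds (φ 0) (φ fund1) :=
    ⟨φ.near (by simp [CoweightLattice.Near, fund2]),
      φ.near (by simp [CoweightLattice.Near, fund1, fund2]),
      φ.injective.ne (by decide), φ.injective.ne (by decide)⟩
  have h2 : φ (fund1 - fund2) ∈ X.thirds (φ 0) (φ fund1) :=
    ⟨φ.near (by simp [CoweightLattice.Near, fund1, fund2]),
      φ.near (by simp [CoweightLattice.Near, fund1, fund2]),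
      φ.injective.ne (by decide), φ.injective.ne (by decide)⟩
  rw [hz] at h1 h2
  exact absurd (φ.injective ((Set.mem_singleton_iff.1 h1).trans (Set.mem_singleton_iff.1 h2).symm))
    (by decide)

end IsTriangleBuilding

end TypedComplex

/-! ### The building as seen from a boundary point. -/

open CoweightLattice in
/-- The vertices of a triangle building, as seen from a point of its boundary: `lev x` is the image
of `x` under the retraction centred at that point, and `proj u x`, for `u ≤ lev x`, is the vertex
with image `u` of the sector with base vertex `x` that represents the point. -/
structure HoroSystem (V : Type*) (q : ℕ) where
  /-- The image under the retraction. -/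
  lev : V → CoweightLattice
  /-- The vertices of the sector that represents the boundary point. -/
  proj : CoweightLattice → V → V
  /-- Equality or adjacency. -/
  Near : V → V → Prop
  /-- The vertices of an apartment that contains a sector representing the boundary point. -/
  base : CoweightLattice → V
  order_ne_zero : q ≠ 0
  near_symm : ∀ {x y}, Near x y → Near y x
  near_lev : ∀ {x y}, Near x y → CoweightLattice.Near (lev x) (lev y)
  lev_base : ∀ u, lev (base u) = u
  eq_of_near : ∀ {x y}, Near x y → lev x = lev y → x = y
  lev_proj : ∀ {x u}, u ≤ lev x → lev (proj u x) = u
  proj_lev : ∀ x, proj (lev x) x = x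
  proj_proj : ∀ {x u w}, u ≤ w → w ≤ lev x → proj u (proj w x) = proj u x
  proj_eq_proj : ∀ {x y u}, Near x y → u ≤ lev x → u ≤ lev y → proj u x = proj u y
  near_proj : ∀ {x u w}, u ≤ lev x → w ≤ lev x → CoweightLattice.Near u w →
    Near (proj u x) (proj w x)
  eventually_proj : ∀ x, ∀ᶠ u in Filter.atBot, proj u x = base u
  ncard_thirds : ∀ {x y}, Near x y → x ≠ y →
    {z | Near z x ∧ Near z y ∧ z ≠ x ∧ z ≠ y}.ncard = q + 1
  existsUnique_join : ∀ {x y y'}, Near x y → Near x y' → y ≠ y' →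
    vertexType (lev y) = vertexType (lev y') →
    ∃! z, Near z x ∧ Near z y ∧ Near z y' ∧ z ≠ x ∧ z ≠ y ∧ z ≠ y'

namespace TypedComplex.IsTriangleBuilding

variable {V : Type*} {X : TypedComplex V}

/-- The system given by the boundary point that the sectors `φ₀ (Set.Iic v)` represent. -/
noncomputable def horoSystem (hX : X.IsTriangleBuilding) {q : ℕ} (hq : X.HasOrder q)
    (φ₀ : X.Chart) : HoroSystem V q where
  lev := hX.lev φ₀
  proj := hX.proj φ₀
  Near := X.Near
  base := φ₀
  order_ne_zero := hX.order_pos hq φ₀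
  near_symm := Near.symm
  near_lev := hX.near_lev φ₀
  lev_base := hX.lev_apply ⟨0, fun _ _ => rfl⟩
  eq_of_near h hl := hX.eq_of_near_of_type_eq h (by
    rw [← hX.vertexType_lev φ₀, ← hX.vertexType_lev φ₀, hl])
  lev_proj := hX.lev_proj φ₀
  proj_lev := hX.proj_lev φ₀
  proj_proj := hX.proj_proj φ₀
  proj_eq_proj h hx hy := hX.proj_eq_proj_of_near φ₀ h hx hy
  near_proj := hX.near_proj φ₀
  eventually_proj := hX.eventually_proj_eq φ₀
  ncard_thirds := hX.ncard_thirds hq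
  existsUnique_join h h' hne ht := hX.existsUnique_join h h' hne (by
    rwa [hX.vertexType_lev, hX.vertexType_lev] at ht)

end TypedComplex.IsTriangleBuilding

/-! ### Counting neighbours and cones. -/

theorem Set.ncard_eq_mul_of_fibers {α β : Type*} {S : Set α} {T : Set β} {f : α → β} {m n : ℕ}
    (hf : Set.MapsTo f S T) (hT : T.ncard = m) (hm : m ≠ 0)
    (hfib : ∀ w ∈ T, {y ∈ S | f y = w}.ncard = n) (hn : n ≠ 0) : S.ncard = m * n := by
  classical
  -- `Set.ncard` vanishes on infinite sets, so nonzero counts give finiteness.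
  have hTf : T.Finite := Set.finite_of_ncard_ne_zero (hT ▸ hm)
  have hfibf : ∀ w ∈ T, {y ∈ S | f y = w}.Finite := fun w hw =>
    Set.finite_of_ncard_ne_zero (hfib w hw ▸ hn)
  have hSf : S.Finite := (hTf.biUnion hfibf).subset fun y hy =>
    Set.mem_biUnion (hf hy) ⟨hy, rfl⟩
  rw [Set.ncard_eq_toFinset_card S hSf, Finset.card_eq_sum_card_fiberwise (f := f)
    (t := hTf.toFinset) (by intro y hy; simpa using hf (by simpa using hy)),
    Finset.sum_congr rfl (g := fun _ => n), Finset.sum_const, smul_eq_mul,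
    ← Set.ncard_eq_toFinset_card T hTf, hT]
  intro w hw
  rw [← hfib w (by simpa using hw), Set.ncard_eq_toFinset_card _ (hfibf w (by simpa using hw))]
  congr 1
  ext y
  simp

namespace CoweightLattice

/-- `a` and `b` are the two fundamental co-weights, in either order. -/
def IsFundPair (a b : CoweightLattice) : Prop :=
  a = fund1 ∧ b = fund2 ∨ a = fund2 ∧ b = fund1

theorem IsFundPair.symm {a b : CoweightLattice} (h : IsFundPair a b) : IsFundPair b a := by
  rcases h with ⟨rfl, rfl⟩ | ⟨rfl, rfl⟩
  · exact Or.inr ⟨rfl, rfl⟩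
  · exact Or.inl ⟨rfl, rfl⟩

theorem isFundPair12 : IsFundPair fund1 fund2 := Or.inl ⟨rfl, rfl⟩

theorem IsFundPair.coords {a b : CoweightLattice} (h : IsFundPair a b) :
    (a.1 = 1 ∧ a.2 = 0 ∧ b.1 = 0 ∧ b.2 = 1) ∨ (a.1 = 0 ∧ a.2 = 1 ∧ b.1 = 1 ∧ b.2 = 0) := by
  rcases h with ⟨rfl, rfl⟩ | ⟨rfl, rfl⟩ <;> simp [fund1, fund2]

end CoweightLattice

namespace HoroSystem

open CoweightLattice hiding ext_iff Near

variable {V : Type*} {q : ℕ} (H : HoroSystem V q) {x y z w : V} {a b lam mu nu : CoweightLattice}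

theorem proj_eq_of_near (h : H.Near x y) (hle : H.lev x ≤ H.lev y) :
    H.proj (H.lev x) y = x := by
  rw [← H.proj_eq_proj h le_rfl hle, H.proj_lev]

theorem finite_thirds (h : H.Near x y) (hne : x ≠ y) :
    {z | H.Near z x ∧ H.Near z y ∧ z ≠ x ∧ z ≠ y}.Finite :=
  Set.finite_of_ncard_ne_zero (by rw [H.ncard_thirds h hne]; omega)

/-- Of the `q + 1` chambers on an edge, one lies below the edge and the others above it. -/
theorem ncard_above {l h : CoweightLattice} (hxy : H.Near x y) (hl : l ≤ H.lev x)
    (hn : CoweightLattice.Near l (H.lev x)) (hy : H.Near (H.proj l x) y)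
    (hlat : ∀ t, CoweightLattice.Near t (H.lev x) → CoweightLattice.Near t (H.lev y) →
      t ≠ H.lev x → t ≠ H.lev y → t ≠ l → t = h)
    (hne : H.lev x ≠ H.lev y) (hlx : l ≠ H.lev x) (hly : l ≠ H.lev y) (hlh : l ≠ h)
    (hhx : h ≠ H.lev x) (hhy : h ≠ H.lev y) :
    {z | H.lev z = h ∧ H.Near z x ∧ H.Near z y}.ncard = q := by
  have hxy' : x ≠ y := fun h => hne (by rw [h])
  have hcard := H.ncard_thirds hxy hxy'
  have hlev := H.lev_proj hl
  have heq : {z | H.Near z x ∧ H.Near z y ∧ z ≠ x ∧ z ≠ y} =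
      insert (H.proj l x) {z | H.lev z = h ∧ H.Near z x ∧ H.Near z y} := by
    ext z
    simp only [Set.mem_ofPred_eq, Set.mem_insert_iff]
    constructor
    · rintro ⟨h1, h2, h3, h4⟩
      by_cases hz : H.lev z = l
      · left
        rw [← hz, H.proj_eq_of_near h1 (hz.le.trans hl)]
      · right
        exact ⟨hlat _ (H.near_lev h1) (H.near_lev h2) (fun e => h3 (H.eq_of_near h1 e))
          (fun e => h4 (H.eq_of_near h2 e)) hz, h1, h2⟩
    · rintro (rfl | ⟨h1, h2, h3⟩)
      · refine ⟨?_, hy, fun e => hlx (by rw [← hlev, e]), fun e => hly (by rw [← hlev, e])⟩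
        simpa [H.proj_lev] using H.near_proj hl le_rfl hn
      · exact ⟨h2, h3, fun e => hhx (by rw [← h1, e]), fun e => hhy (by rw [← h1, e])⟩
  have hfin := H.finite_thirds hxy hxy'
  rw [heq] at hcard hfin
  rw [Set.ncard_insert_of_notMem (fun hm => hlh (hlev.symm.trans hm.1))
    (hfin.subset (Set.subset_insert _ _))] at hcard
  omega

theorem near_proj_self (hl : mu ≤ H.lev x) (hn : CoweightLattice.Near mu (H.lev x)) :
    H.Near (H.proj mu x) x := by
  simpa [H.proj_lev] using H.near_proj hl le_rfl hn

theorem near_of_proj_eq (hle : mu ≤ H.lev z) (h : H.proj mu z = x)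
    (hn : CoweightLattice.Near mu (H.lev z)) : H.Near z x :=
  h ▸ H.near_symm (H.near_proj_self hle hn)

section Pair

variable (hab : IsFundPair a b)
include hab

/-- These are the affine lines of the special parallel class at `x`. The edge from `x` to its vertex
at `lam - b` has its lower chamber completed at `lam - a`, and its other chambers at `lam + a - b`.
-/
theorem ncard_side (hx : H.lev x = lam) :
    {y | H.lev y = lam + a - b ∧ H.Near y x}.ncard = q := by
  have hc := hab.coords
  subst hx
  have hle : H.lev x - b ≤ H.lev x := by
    rw [Prod.le_def]; simp only [Prod.fst_sub, Prod.snd_sub]; omega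
  have hlev := H.lev_proj hle
  have hle' : H.lev x - a ≤ H.lev x := by
    rw [Prod.le_def]; simp only [Prod.fst_sub, Prod.snd_sub]; omega
  have h0 : CoweightLattice.Near (H.lev x - b) (H.lev x) := by
    simp only [CoweightLattice.Near, Prod.fst_sub, Prod.snd_sub]; omega
  have h1 : CoweightLattice.Near (H.lev x - a) (H.lev x) := by
    simp only [CoweightLattice.Near, Prod.fst_sub, Prod.snd_sub]; omega
  have h2 : CoweightLattice.Near (H.lev x - a) (H.lev x - b) := by
    simp only [CoweightLattice.Near, Prod.fst_sub, Prod.snd_sub]; omega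
  have key := H.ncard_above (x := x) (y := H.proj (H.lev x - b) x) (l := H.lev x - a)
    (h := H.lev x + a - b) (H.near_symm (H.near_proj_self hle h0)) hle' h1
    (H.near_proj hle' hle h2)
    (by
      rw [hlev]
      simp only [CoweightLattice.Near, Ne, CoweightLattice.ext_iff, Prod.fst_add, Prod.snd_add,
        Prod.fst_sub, Prod.snd_sub]
      intro t
      omega)
    (by simp only [hlev, Ne, CoweightLattice.ext_iff, Prod.fst_sub, Prod.snd_sub]; omega)
    (by simp only [Ne, CoweightLattice.ext_iff, Prod.fst_sub, Prod.snd_sub]; omega)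
    (by simp only [hlev, Ne, CoweightLattice.ext_iff, Prod.fst_sub, Prod.snd_sub]; omega)
    (by simp only [Ne, CoweightLattice.ext_iff, Prod.fst_add, Prod.snd_add, Prod.fst_sub,
        Prod.snd_sub]; omega)
    (by simp only [Ne, CoweightLattice.ext_iff, Prod.fst_add, Prod.snd_add, Prod.fst_sub,
        Prod.snd_sub]; omega)
    (by simp only [hlev, Ne, CoweightLattice.ext_iff, Prod.fst_add, Prod.snd_add, Prod.fst_sub,
        Prod.snd_sub]; omega)
  refine Eq.trans (congrArg Set.ncard ?_) key
  ext y
  -- Adjacency to the vertex at `lam - b` is automatic, because adjacent vertices have the same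
  -- projection there.
  refine ⟨fun ⟨hy, hn⟩ => ⟨hy, hn, ?_⟩, fun ⟨hy, hn, _⟩ => ⟨hy, hn⟩⟩
  have hley : H.lev x - b ≤ H.lev y := by
    rw [hy, Prod.le_def]; simp only [Prod.fst_sub, Prod.snd_sub, Prod.fst_add, Prod.snd_add]; omega
  rw [← H.proj_eq_proj hn hley hle]
  refine H.near_symm (H.near_proj_self hley ?_)
  rw [hy]
  simp only [CoweightLattice.Near, Prod.fst_sub, Prod.snd_sub, Prod.fst_add, Prod.snd_add]
  omega

/-- These are the affine points on the special line `w`; the lower chamber on the edge has its third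
vertex at `lam - b`. -/
theorem ncard_up_of_side (hx : H.lev x = lam) (hw : H.lev w = lam + a - b) (hwx : H.Near w x) :
    {y | H.lev y = lam + a ∧ H.Near y x ∧ H.Near y w}.ncard = q := by
  have hc := hab.coords
  subst hx
  have hle : H.lev x - b ≤ H.lev x := by
    rw [Prod.le_def]; simp only [Prod.fst_sub, Prod.snd_sub]; omega
  have hlev := H.lev_proj hle
  have hle' : H.lev x - b ≤ H.lev w := by
    rw [hw, Prod.le_def]; simp only [Prod.fst_sub, Prod.snd_sub, Prod.fst_add, Prod.snd_add]; omega
  refine H.ncard_above (l := H.lev x - b) (H.near_symm hwx) hle ?_ ?_ ?_ ?_ ?_ ?_ ?_ ?_ ?_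
  · simp only [CoweightLattice.Near, Prod.fst_sub, Prod.snd_sub]; omega
  · rw [← H.proj_eq_proj hwx hle' hle]
    refine H.near_proj_self hle' ?_
    rw [hw]
    simp only [CoweightLattice.Near, Prod.fst_sub, Prod.snd_sub, Prod.fst_add, Prod.snd_add]; omega
  · rw [hw]
    simp only [CoweightLattice.Near, Ne, CoweightLattice.ext_iff, Prod.fst_add, Prod.snd_add,
        Prod.fst_sub, Prod.snd_sub]
    intro t
    omega
  all_goals
    simp only [hw, Ne, CoweightLattice.ext_iff, Prod.fst_add, Prod.snd_add, Prod.fst_sub,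
      Prod.snd_sub]
    omega

theorem near_proj_side (hy : H.lev y = lam + a) (hyx : H.Near y x) (hx : H.lev x = lam) :
    H.Near (H.proj (lam + a - b) y) x ∧ H.Near (H.proj (lam + a - b) y) y ∧
      H.lev (H.proj (lam + a - b) y) = lam + a - b := by
  have hc := hab.coords
  have h1 : lam + a - b ≤ H.lev y := by
    rw [hy, Prod.le_def]; simp only [Prod.fst_sub, Prod.snd_sub, Prod.fst_add, Prod.snd_add]; omega
  have h2 : lam ≤ H.lev y := by
    rw [hy, Prod.le_def]; simp only [Prod.fst_add, Prod.snd_add]; omega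
  refine ⟨?_, H.near_proj_self h1 ?_, H.lev_proj h1⟩
  · have h3 : H.proj lam y = x := hx ▸ H.proj_eq_of_near (H.near_symm hyx) (hx.le.trans h2)
    rw [← h3]
    refine H.near_proj h1 h2 ?_
    simp only [CoweightLattice.Near, Prod.fst_sub, Prod.snd_sub, Prod.fst_add, Prod.snd_add]
    omega
  · rw [hy]
    simp only [CoweightLattice.Near, Prod.fst_sub, Prod.snd_sub, Prod.fst_add, Prod.snd_add]
    omega

theorem proj_side_eq_iff (hy : H.lev y = lam + a) (hw : H.lev w = lam + a - b) :
    H.proj (lam + a - b) y = w ↔ H.Near y w := by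
  have hc := hab.coords
  have h1 : lam + a - b ≤ H.lev y := by
    rw [hy, Prod.le_def]; simp only [Prod.fst_sub, Prod.snd_sub, Prod.fst_add, Prod.snd_add]; omega
  constructor
  · intro h
    refine H.near_of_proj_eq h1 h ?_
    rw [hy]
    simp only [CoweightLattice.Near, Prod.fst_sub, Prod.snd_sub, Prod.fst_add, Prod.snd_add]
    omega
  · intro h
    rw [← hw]
    exact H.proj_eq_of_near (H.near_symm h) (hw.le.trans h1)

/-- Each affine point lies on exactly one of the q special lines, and each such line carries q
points. -/
theorem ncard_up (hx : H.lev x = lam) :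
    {y | H.lev y = lam + a ∧ H.Near y x}.ncard = q * q := by
  refine Set.ncard_eq_mul_of_fibers (f := H.proj (lam + a - b))
    (T := {y | H.lev y = lam + a - b ∧ H.Near y x}) ?_ (H.ncard_side hab hx) H.order_ne_zero ?_
    H.order_ne_zero
  · rintro y ⟨hy, hn⟩
    have := H.near_proj_side hab hy hn hx
    exact ⟨this.2.2, this.1⟩
  · rintro w ⟨hw, hwx⟩
    refine Eq.trans (congrArg Set.ncard ?_) (H.ncard_up_of_side hab hx hw hwx)
    ext y
    constructor
    · rintro ⟨⟨h1, h2⟩, h3⟩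
      exact ⟨h1, h2, (H.proj_side_eq_iff hab h1 hw).1 h3⟩
    · rintro ⟨h1, h2, h3⟩
      exact ⟨⟨h1, h2⟩, (H.proj_side_eq_iff hab h1 hw).2 h3⟩

theorem near_proj_of_near (hz : H.lev z = lam + b) (hy : H.lev y = lam + a) (h : H.Near y z) :
    H.Near y (H.proj lam z) := by
  have hc := hab.coords
  have h1 : lam ≤ H.lev z := by
    rw [hz, Prod.le_def]; simp only [Prod.fst_add, Prod.snd_add]; omega
  have h2 : lam ≤ H.lev y := by
    rw [hy, Prod.le_def]; simp only [Prod.fst_add, Prod.snd_add]; omega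
  rw [← H.proj_eq_proj h h2 h1]
  refine H.near_symm (H.near_proj_self h2 ?_)
  rw [hy]
  simp only [CoweightLattice.Near, Prod.fst_add, Prod.snd_add]
  omega

/-- These are the affine points on the nonspecial line `z`; the remaining point of `z`, at `lam + b
- a`, lies on the line at infinity. -/
theorem ncard_across (hz : H.lev z = lam + b) :
    {y | H.lev y = lam + a ∧ H.Near y z}.ncard = q := by
  have hc := hab.coords
  have h1 : lam ≤ H.lev z := by
    rw [hz, Prod.le_def]; simp only [Prod.fst_add, Prod.snd_add]; omega
  have hlev := H.lev_proj h1
  have h2 : lam + b - a ≤ H.lev z := by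
    rw [hz, Prod.le_def]; simp only [Prod.fst_add, Prod.snd_add, Prod.fst_sub, Prod.snd_sub]; omega
  have key := H.ncard_above (x := z) (y := H.proj lam z) (l := lam + b - a) (h := lam + a)
    (H.near_symm (H.near_proj_self h1 (by
      rw [hz]; simp only [CoweightLattice.Near, Prod.fst_add, Prod.snd_add]; omega))) h2
    (by
      rw [hz]
      simp only [CoweightLattice.Near, Prod.fst_sub, Prod.snd_sub, Prod.fst_add, Prod.snd_add]
      omega)
    (H.near_proj h2 h1 (by
      simp only [CoweightLattice.Near, Prod.fst_sub, Prod.snd_sub, Prod.fst_add, Prod.snd_add]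
      omega))
    (by
      rw [hlev, hz]
      simp only [CoweightLattice.Near, Ne, CoweightLattice.ext_iff, Prod.fst_add, Prod.snd_add,
        Prod.fst_sub, Prod.snd_sub]
      intro t
      omega)
    (by simp only [hlev, hz, Ne, CoweightLattice.ext_iff, Prod.fst_add, Prod.snd_add]; omega)
    (by simp only [hz, Ne, CoweightLattice.ext_iff, Prod.fst_add, Prod.snd_add, Prod.fst_sub,
        Prod.snd_sub]; omega)
    (by simp only [hlev, Ne, CoweightLattice.ext_iff, Prod.fst_add, Prod.snd_add, Prod.fst_sub,
        Prod.snd_sub]; omega)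
    (by simp only [Ne, CoweightLattice.ext_iff, Prod.fst_add, Prod.snd_add, Prod.fst_sub,
        Prod.snd_sub]; omega)
    (by simp only [hz, Ne, CoweightLattice.ext_iff, Prod.fst_add, Prod.snd_add]; omega)
    (by simp only [hlev, Ne, CoweightLattice.ext_iff, Prod.fst_add, Prod.snd_add]; omega)
  refine Eq.trans (congrArg Set.ncard ?_) key
  ext y
  exact ⟨fun ⟨hy, hn⟩ => ⟨hy, hn, H.near_proj_of_near hab hz hy hn⟩, fun ⟨hy, hn, _⟩ => ⟨hy, hn⟩⟩

theorem ncard_top (hy : H.lev y = lam + a) (hz : H.lev z = lam + b) (hyz : H.Near y z) :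
    {t | H.lev t = lam + a + b ∧ H.Near t y ∧ H.Near t z}.ncard = q := by
  have hc := hab.coords
  have h2 : lam ≤ H.lev y := by
    rw [hy, Prod.le_def]; simp only [Prod.fst_add, Prod.snd_add]; omega
  have h1 : lam ≤ H.lev z := by
    rw [hz, Prod.le_def]; simp only [Prod.fst_add, Prod.snd_add]; omega
  refine H.ncard_above (l := lam) hyz h2 ?_ ?_ ?_ ?_ ?_ ?_ ?_ ?_ ?_
  · rw [hy]; simp only [CoweightLattice.Near, Prod.fst_add, Prod.snd_add]; omega
  · rw [H.proj_eq_proj hyz h2 h1]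
    refine H.near_proj_self h1 ?_
    rw [hz]; simp only [CoweightLattice.Near, Prod.fst_add, Prod.snd_add]; omega
  · rw [hy, hz]
    simp only [CoweightLattice.Near, Ne, CoweightLattice.ext_iff, Prod.fst_add, Prod.snd_add]
    intro t
    omega
  all_goals
    simp only [hy, hz, Ne, CoweightLattice.ext_iff, Prod.fst_add, Prod.snd_add]
    omega

end Pair

/-- The vertices at `nu` whose sector contains `x`. -/
def cone (nu : CoweightLattice) (x : V) : Set V := {z | H.lev z = nu ∧ H.proj (H.lev x) z = x}

theorem cone_add_eq (hab : IsFundPair a b) (hx : H.lev x = lam) :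
    H.cone (lam + a) x = {y | H.lev y = lam + a ∧ H.Near y x} := by
  have hc := hab.coords
  ext y
  have hle : H.lev y = lam + a → lam ≤ H.lev y := fun hy => by
    rw [hy, Prod.le_def]; simp only [Prod.fst_add, Prod.snd_add]; omega
  constructor
  · rintro ⟨hy, h⟩
    refine ⟨hy, H.near_of_proj_eq (hx.le.trans (hle hy)) h ?_⟩
    rw [hx, hy]; simp only [CoweightLattice.Near, Prod.fst_add, Prod.snd_add]; omega
  · rintro ⟨hy, h⟩
    exact ⟨hy, H.proj_eq_of_near (H.near_symm h) (hx.le.trans (hle hy))⟩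

theorem cone_fiber (hx : H.lev x ≤ mu) (hmu : mu ≤ nu) (hy : y ∈ H.cone mu x) :
    {z ∈ H.cone nu x | H.proj mu z = y} = H.cone nu y := by
  ext z
  constructor
  · rintro ⟨⟨h1, h2⟩, h3⟩
    exact ⟨h1, by rw [hy.1, h3]⟩
  · rintro ⟨h1, h2⟩
    rw [hy.1] at h2
    refine ⟨⟨h1, ?_⟩, h2⟩
    rw [← H.proj_proj hx (hmu.trans h1.ge), h2, hy.2]

theorem mapsTo_cone (hx : H.lev x ≤ mu) (hmu : mu ≤ nu) :
    Set.MapsTo (H.proj mu) (H.cone nu x) (H.cone mu x) := by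
  rintro z ⟨h1, h2⟩
  exact ⟨H.lev_proj (hmu.trans h1.ge), by rw [H.proj_proj hx (hmu.trans h1.ge), h2]⟩

/-- Each fundamental step upwards offers q² choices, and the fibres of the projection to an
intermediate position are again cones (`cone_fiber`). -/
theorem ncard_cone (hx : H.lev x ≤ nu) :
    (H.cone nu x).ncard = q ^ (2 * (level nu - level (H.lev x)).toNat) := by
  have step : ∀ a b u, IsFundPair a b → u + a ≤ nu →
      (∀ x, H.lev x = u + a →
        (H.cone nu x).ncard = q ^ (2 * (level nu - level (u + a)).toNat)) →
      ∀ x, H.lev x = u → (H.cone nu x).ncard = q ^ (2 * (level nu - level u).toNat) := by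
    intro a b u hab hle ih x hx
    have hc := hab.coords
    have hu : u ≤ u + a := by rw [Prod.le_def]; simp only [Prod.fst_add, Prod.snd_add]; omega
    rw [Set.ncard_eq_mul_of_fibers (H.mapsTo_cone (mu := u + a) (by rw [hx]; exact hu) hle)
      (m := q * q) (n := q ^ (2 * (level nu - level (u + a)).toNat))]
    · have : (level nu - level u).toNat = (level nu - level (u + a)).toNat + 1 := by
        simp only [level, Prod.le_def, Prod.fst_add, Prod.snd_add] at *
        omega
      rw [this]
      ring
    · rw [H.cone_add_eq hab hx, H.ncard_up hab hx]
    · exact mul_ne_zero H.order_ne_zero H.order_ne_zero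
    · intro y hy
      rw [H.cone_fiber (by rw [hx]; exact hu) hle hy]
      exact ih y hy.1
    · exact pow_ne_zero _ H.order_ne_zero
  refine CoweightLattice.le_induction (P := fun u => ∀ x, H.lev x = u →
    (H.cone nu x).ncard = q ^ (2 * (level nu - level u).toNat)) hx ?_
    (fun u _ h ih => step _ _ u isFundPair12 h ih) (fun u _ h ih => step _ _ u isFundPair12.symm h ih)
    x rfl
  intro x hx
  rw [sub_self, Int.toNat_zero, mul_zero, pow_zero, Set.ncard_eq_one]
  refine ⟨x, ?_⟩
  ext z
  constructor
  · rintro ⟨h1, h2⟩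
    rw [hx, ← h1, H.proj_lev] at h2
    exact h2
  · rintro rfl
    exact ⟨hx, H.proj_lev z⟩

theorem finite_cone (hx : H.lev x ≤ nu) : (H.cone nu x).Finite :=
  Set.finite_of_ncard_ne_zero (by rw [H.ncard_cone hx]; exact pow_ne_zero _ H.order_ne_zero)

-- By `eventually_proj` every vertex lies in a cone over some base vertex, and each cone is finite.
include H in
theorem countable : Countable V := by
  have h : (Set.univ : Set V) ⊆ ⋃ p ∈ {p : CoweightLattice × CoweightLattice | p.1 ≤ p.2},
      H.cone p.2 (H.base p.1) := by
    intro x _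
    obtain ⟨u, hu, hle⟩ := ((H.eventually_proj x).and
      (Filter.eventually_le_atBot (H.lev x))).exists
    exact Set.mem_biUnion (x := (u, H.lev x)) hle ⟨rfl, by rw [H.lev_base, hu]⟩
  refine Set.countable_univ_iff.1 (Set.Countable.mono h ?_)
  exact Set.Countable.biUnion (Set.to_countable _) fun p hp =>
    (H.finite_cone (by rw [H.lev_base]; exact hp)).countable

/-- At or below `lev x` the projection is the only candidate; the four other neighbouring positions
are covered by `ncard_up` and `ncard_side`. -/
theorem finite_nbr (x : V) (lam : CoweightLattice) :
    {y | H.lev y = lam ∧ H.Near y x}.Finite := by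
  by_cases hle : lam ≤ H.lev x
  · refine (Set.finite_singleton (H.proj lam x)).subset ?_
    rintro y ⟨rfl, h⟩
    exact (H.proj_eq_of_near h hle).symm
  by_cases hn : CoweightLattice.Near lam (H.lev x)
  · have hf : ∀ a b, IsFundPair a b → {y | H.lev y = H.lev x + a ∧ H.Near y x}.Finite :=
      fun a b hab => Set.finite_of_ncard_ne_zero (by
        rw [H.ncard_up hab rfl]; exact mul_ne_zero H.order_ne_zero H.order_ne_zero)
    have hs : ∀ a b, IsFundPair a b → {y | H.lev y = H.lev x + a - b ∧ H.Near y x}.Finite :=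
      fun a b hab => Set.finite_of_ncard_ne_zero (by
        rw [H.ncard_side hab rfl]; exact H.order_ne_zero)
    have : lam = H.lev x + fund1 ∨ lam = H.lev x + fund2 ∨ lam = H.lev x + fund1 - fund2 ∨
        lam = H.lev x + fund2 - fund1 := by
      simp only [CoweightLattice.Near, Prod.le_def, CoweightLattice.ext_iff, Prod.fst_add,
        Prod.snd_add, Prod.fst_sub, Prod.snd_sub, fund1, fund2] at *
      omega
    rcases this with rfl | rfl | rfl | rfl
    exacts [hf _ _ isFundPair12, hf _ _ isFundPair12.symm, hs _ _ isFundPair12,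
      hs _ _ isFundPair12.symm]
  · refine Set.finite_empty.subset ?_
    rintro y ⟨rfl, h⟩
    exact hn (H.near_lev h)

/-- The neighbours of `x` at `lam`. -/
noncomputable def nbr (x : V) (lam : CoweightLattice) : Finset V := (H.finite_nbr x lam).toFinset

@[simp]
theorem mem_nbr : y ∈ H.nbr x lam ↔ H.lev y = lam ∧ H.Near y x := by simp [nbr]

theorem card_nbr (x : V) (lam : CoweightLattice) :
    (H.nbr x lam).card = {y | H.lev y = lam ∧ H.Near y x}.ncard :=
  (Set.ncard_eq_toFinset_card _ _).symm

end HoroSystem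

/-! ### Families and diagonal chains. -/

namespace HoroSystem

open CoweightLattice hiding ext_iff Near

variable {V : Type*} {q : ℕ} (H : HoroSystem V q)

/-- The coordinates of an apartment that contains a sector representing the centre of the
retraction. -/
structure IsFamily (c : CoweightLattice → V) : Prop where
  lev_apply : ∀ u, H.lev (c u) = u
  proj_apply : ∀ u w, u ≤ w → H.proj u (c w) = c u

/-- The point `lam + n (λ₁ + λ₂)`. -/
def _root_.CoweightLattice.diag (lam : CoweightLattice) (n : ℕ) : CoweightLattice :=
  lam + ((n : ℤ), (n : ℤ))

/-- The vertices `s n` go up along the diagonal through `lam`. -/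
structure IsChain (lam : CoweightLattice) (s : ℕ → V) : Prop where
  lev_apply : ∀ n, H.lev (s n) = lam.diag n
  proj_succ : ∀ n, H.proj (lam.diag n) (s (n + 1)) = s n

/-- The family determined by a chain. -/
def familyOfChain (lam : CoweightLattice) (s : ℕ → V) (u : CoweightLattice) : V :=
  H.proj u (s ((u.1 - lam.1) ⊔ (u.2 - lam.2)).toNat)

variable {H} {lam : CoweightLattice} {s : ℕ → V}

theorem _root_.CoweightLattice.diag_le_diag {m n : ℕ} (h : m ≤ n) : lam.diag m ≤ lam.diag n := by
  rw [Prod.le_def]; simp [CoweightLattice.diag, h]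

theorem _root_.CoweightLattice.le_diag_toNat (lam u : CoweightLattice) :
    u ≤ lam.diag ((u.1 - lam.1) ⊔ (u.2 - lam.2)).toNat := by
  rw [Prod.le_def]; simp only [CoweightLattice.diag, Prod.fst_add, Prod.snd_add]; omega

theorem IsChain.proj_apply (hs : H.IsChain lam s) {m n : ℕ} (h : m ≤ n) :
    H.proj (lam.diag m) (s n) = s m := by
  induction n, h using Nat.le_induction with
  | base => rw [← hs.lev_apply, H.proj_lev]
  | succ n hmn ih =>
    rw [← ih, ← hs.proj_succ n, H.proj_proj (diag_le_diag hmn)]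
    rw [hs.lev_apply]
    exact diag_le_diag (Nat.le_succ n)

/-- The diagonal is cofinal and the projections compose, so any vertex of the chain far enough up
gives the same value. -/
theorem IsChain.familyOfChain_eq (hs : H.IsChain lam s) {u : CoweightLattice} {n : ℕ}
    (h : u ≤ lam.diag n) : H.familyOfChain lam s u = H.proj u (s n) := by
  have h1 := le_diag_toNat lam u
  unfold familyOfChain
  rcases le_total ((u.1 - lam.1) ⊔ (u.2 - lam.2)).toNat n with hn | hn
  · rw [← hs.proj_apply hn, H.proj_proj h1 (by rw [hs.lev_apply]; exact diag_le_diag hn)]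
  · rw [← hs.proj_apply hn, H.proj_proj h (by rw [hs.lev_apply]; exact diag_le_diag hn)]

theorem IsChain.isFamily (hs : H.IsChain lam s) : H.IsFamily (H.familyOfChain lam s) where
  lev_apply u := H.lev_proj (by rw [hs.lev_apply]; exact le_diag_toNat lam u)
  proj_apply u w huw := by
    have h := le_diag_toNat lam w
    rw [hs.familyOfChain_eq h, hs.familyOfChain_eq (huw.trans h), H.proj_proj huw]
    rw [hs.lev_apply]
    exact h

theorem IsChain.familyOfChain_diag (hs : H.IsChain lam s) (n : ℕ) :
    H.familyOfChain lam s (lam.diag n) = s n := by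
  rw [hs.familyOfChain_eq le_rfl, ← hs.lev_apply, H.proj_lev]

/-- A diagonal step rises by two levels, each contributing a factor q². -/
theorem ncard_cone_diag (H : HoroSystem V q) (y : V) :
    Nat.card (H.cone ((H.lev y).diag 1) y) = q ^ 4 := by
  rw [Nat.card_coe_set_eq, H.ncard_cone]
  · congr 1
    simp only [level, CoweightLattice.diag, Prod.fst_add, Prod.snd_add]
    omega
  · rw [Prod.le_def]; simp [CoweightLattice.diag]

theorem finite_cone_diag (H : HoroSystem V q) (y : V) : Finite (H.cone ((H.lev y).diag 1) y) :=
  Nat.finite_of_card_ne_zero (by rw [H.ncard_cone_diag]; exact pow_ne_zero _ H.order_ne_zero)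

/-- An enumeration of the vertices one diagonal step above `y`. -/
noncomputable def coneEquiv (H : HoroSystem V q) (y : V) :
    Fin (q ^ 4) ≃ H.cone ((H.lev y).diag 1) y :=
  haveI := H.finite_cone_diag y
  (Finite.equivFinOfCardEq (H.ncard_cone_diag y)).symm

/-- The chain from `x` with prescribed steps. -/
noncomputable def walk (H : HoroSystem V q) (x : V) (t : ℕ → Fin (q ^ 4)) : ℕ → V
  | 0 => x
  | n + 1 => H.coneEquiv (walk H x t n) (t n)

theorem lev_walk (H : HoroSystem V q) (x : V) (t : ℕ → Fin (q ^ 4)) (n : ℕ) :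
    H.lev (H.walk x t n) = (H.lev x).diag n := by
  induction n with
  | zero => ext <;> simp [walk, CoweightLattice.diag]
  | succ n ih =>
    have := (H.coneEquiv (H.walk x t n) (t n)).2.1
    rw [walk, this, ih]
    ext <;> simp [CoweightLattice.diag] <;> ring

theorem isChain_walk (H : HoroSystem V q) (x : V) (t : ℕ → Fin (q ^ 4)) :
    H.IsChain (H.lev x) (H.walk x t) where
  lev_apply := H.lev_walk x t
  proj_succ n := by
    have := (H.coneEquiv (H.walk x t n) (t n)).2.2
    rwa [← H.lev_walk x t n]

theorem exists_isFamily (H : HoroSystem V q) (x : V) : ∃ c, H.IsFamily c ∧ c (H.lev x) = x := by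
  have : NeZero (q ^ 4) := ⟨pow_ne_zero _ H.order_ne_zero⟩
  refine ⟨_, (H.isChain_walk x fun _ => 0).isFamily, ?_⟩
  have := (H.isChain_walk x fun _ => 0).familyOfChain_diag 0
  rwa [show (H.lev x).diag 0 = H.lev x by ext <;> simp [CoweightLattice.diag]] at this

end HoroSystem

/-! ### Families as charts, and the normal form of sectors. -/

namespace TypedComplex

open CoweightLattice hiding ext_iff
open Filter

variable {V : Type*} {X : TypedComplex V}

namespace IsTriangleBuilding

variable (hX : X.IsTriangleBuilding) {q : ℕ} (hq : X.HasOrder q) {φ₀ : X.Chart}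

theorem isFamily_of_asymp {φ : X.Chart} (h : φ.Asymp φ₀) : (hX.horoSystem hq φ₀).IsFamily φ where
  lev_apply := hX.lev_apply h
  proj_apply _ _ huw := hX.proj_apply h huw

/-- Being a chart is tested on finite sets. On such a set `c` is the projection of its value at an
upper bound `m`, and `exists_chart_proj` supplies a chart there. -/
theorem exists_chart_of_isFamily {c : CoweightLattice → V}
    (hc : (hX.horoSystem hq φ₀).IsFamily c) :
    ∃ φ : X.Chart, φ.Asymp φ₀ ∧ ∀ u, φ u = c u := by
  have hloc : ∀ s : Finset CoweightLattice, ∃ χ : X.Chart, ∀ u ∈ s, χ u = c u := by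
    intro s
    obtain ⟨m, hm⟩ := s.bddAbove
    obtain ⟨χ, hχ⟩ := hX.exists_chart_proj φ₀ (c m) s fun u hu =>
      (hm hu).trans (hc.lev_apply m).ge
    exact ⟨χ, fun u hu => (hχ u hu).trans (hc.proj_apply u m (hm hu))⟩
  have hinj : Function.Injective c := fun u v h => by
    rw [← hc.lev_apply u, h, hc.lev_apply v]
  refine ⟨⟨⟨c, hinj⟩, fun s hs => ?_, fun v => ?_⟩, ?_, fun u => rfl⟩
  · obtain ⟨χ, hχ⟩ := hloc s
    have : s.map ⟨c, hinj⟩ = s.map χ.toEmb := by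
      ext x
      simp only [Finset.mem_map, Function.Embedding.coeFn_mk]
      constructor
      · rintro ⟨u, hu, rfl⟩; exact ⟨u, hu, hχ u hu⟩
      · rintro ⟨u, hu, rfl⟩; exact ⟨u, hu, (hχ u hu).symm⟩
    rw [this]
    exact χ.map_face s hs
  · obtain ⟨χ, hχ⟩ := hloc {v}
    rw [← χ.type_eq]
    exact congrArg _ (hχ v (by simp)).symm
  · obtain ⟨v, hv⟩ := eventually_atBot.1
      ((hX.eventually_proj_eq φ₀ (c 0)).and (eventually_le_atBot 0))
    exact ⟨v, fun u hu => (hc.proj_apply u 0 (hv u hu).2).symm.trans (hv u hu).1⟩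

-- A family through `x` shows that `x` retracts to `lev x`, and `lev_apply` excludes every other
-- value, so the choice in `retraction` is forced.
include hX hq in
theorem retraction_eq_lev (x : V) : retraction φ₀ x = (hX.horoSystem hq φ₀).lev x := by
  have huniq : ∀ lam, RetractsTo φ₀ x lam → lam = (hX.horoSystem hq φ₀).lev x := by
    rintro lam ⟨φ, rfl, h⟩
    exact (hX.lev_apply h lam).symm
  obtain ⟨c, hc, hcx⟩ := (hX.horoSystem hq φ₀).exists_isFamily x
  obtain ⟨φ, hφ, hφc⟩ := hX.exists_chart_of_isFamily hq hc
  exact huniq _ (Classical.epsilon_spec (p := RetractsTo φ₀ x)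
    ⟨_, φ, (hφc _).trans hcx, hφ⟩)

end IsTriangleBuilding

/-! ### Sectors -/

/-- A linear type-preserving automorphism of `Σ`. -/
structure _root_.CoweightLattice.IsLinearAut (w : Equiv.Perm CoweightLattice) : Prop where
  map_add : ∀ u v, w (u + v) = w u + w v
  near : ∀ u v, CoweightLattice.Near u v → CoweightLattice.Near (w u) (w v)
  vertexType_eq : ∀ u, vertexType (w u) = vertexType u

theorem _root_.CoweightLattice.isLinearAut_of_mem {w : Equiv.Perm CoweightLattice}
    (hw : w ∈ finiteWeylGroup) : IsLinearAut w := by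
  have hrefl : ∀ w ∈ ({reflection1, reflection2} : Set (Equiv.Perm CoweightLattice)),
      IsLinearAut w ∧ w⁻¹ = w := by
    rintro w (rfl | rfl)
    · refine ⟨⟨fun u v => ?_, fun u v h => ?_, fun u => ?_⟩, rfl⟩
      · ext <;> simp [reflection1] <;> ring
      · simp only [CoweightLattice.Near, reflection1, Equiv.coe_fn_mk] at *; omega
      · rw [vertexType_eq_iff]; simp only [reflection1, Equiv.coe_fn_mk]; omega
    · refine ⟨⟨fun u v => ?_, fun u v h => ?_, fun u => ?_⟩, rfl⟩
      · ext <;> simp [reflection2] <;> ring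
      · simp only [CoweightLattice.Near, reflection2, Equiv.coe_fn_mk] at *; omega
      · rw [vertexType_eq_iff]; simp only [reflection2, Equiv.coe_fn_mk]; omega
  have hmul : ∀ w w', IsLinearAut w → IsLinearAut w' → IsLinearAut (w * w') := fun w w' h h' =>
    ⟨fun u v => by simp [h.map_add, h'.map_add], fun u v huv => h.near _ _ (h'.near _ _ huv),
      fun u => (h.vertexType_eq _).trans (h'.vertexType_eq u)⟩
  have hone : IsLinearAut 1 := ⟨fun _ _ => rfl, fun _ _ h => h, fun _ => rfl⟩
  refine Subgroup.closure_induction'' (p := fun w _ => IsLinearAut w)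
    (fun w hw => (hrefl w hw).1) (fun w hw => ?_) hone (fun w w' _ _ h h' => hmul w w' h h') hw
  rw [(hrefl w hw).2]
  exact (hrefl w hw).1

/-- The longest element of the finite Weyl group. -/
def _root_.CoweightLattice.longest : Equiv.Perm CoweightLattice :=
  reflection1 * reflection2 * reflection1

theorem _root_.CoweightLattice.longest_mem : longest ∈ finiteWeylGroup :=
  have h1 : reflection1 ∈ finiteWeylGroup := Subgroup.subset_closure (by simp)
  have h2 : reflection2 ∈ finiteWeylGroup := Subgroup.subset_closure (by simp)
  mul_mem (mul_mem h1 h2) h1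

theorem _root_.CoweightLattice.longest_apply (u : CoweightLattice) : longest u = (-u.2, -u.1) := by
  ext <;> simp [longest, reflection1, reflection2]

/-- A chart composed with a linear type-preserving automorphism of `Σ`. -/
def Chart.compAut (φ : X.Chart) {w : Equiv.Perm CoweightLattice} (hw : IsLinearAut w) :
    X.Chart where
  toEmb := w.toEmbedding.trans φ.toEmb
  map_face s hs := by
    rw [← Finset.map_map]
    refine φ.map_face _ ?_
    rw [mem_coxeterComplex_faces] at hs ⊢
    refine ⟨hs.1.map, ?_⟩
    simp only [Finset.mem_map]
    rintro _ ⟨u, hu, rfl⟩ _ ⟨v, hv, rfl⟩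
    exact hw.near _ _ (hs.2 u hu v hv)
  type_eq v := (φ.type_eq _).trans (hw.vertexType_eq v)

theorem Chart.compAut_apply (φ : X.Chart) {w : Equiv.Perm CoweightLattice} (hw : IsLinearAut w)
    (u : CoweightLattice) : φ.compAut hw u = φ (w u) := rfl

theorem isSector_Iic (φ : X.Chart) (v : CoweightLattice) : X.IsSector (φ '' Set.Iic v) := by
  refine ⟨φ, v, longest, longest_mem, congrArg _ ?_⟩
  ext x
  constructor
  · intro hx
    refine ⟨longest (x - v), ?_, ?_⟩
    · rw [Set.mem_Iic, Prod.le_def] at hx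
      rw [longest_apply, Prod.le_def]
      simp only [Prod.fst_zero, Prod.snd_zero, Prod.fst_sub, Prod.snd_sub]
      omega
    · rw [longest_apply, longest_apply]; ext <;> simp
  · rintro ⟨y, hy, rfl⟩
    rw [Prod.le_def] at hy
    simp only [Prod.fst_zero, Prod.snd_zero] at hy
    rw [Set.mem_Iic, Prod.le_def, longest_apply]
    simp only [Prod.fst_add, Prod.snd_add]
    omega

/-- The longest Weyl element exchanges 𝒮₀ and -𝒮₀, which reduces sectors of either direction to
`Set.Iic`. -/
theorem Chart.image_Ici (φ : X.Chart) (v : CoweightLattice) :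
    φ '' Set.Ici v =
      φ.compAut (isLinearAut_of_mem longest_mem) '' Set.Iic (longest v) := by
  have h : ∀ u, longest (longest u) = u := fun u => by
    rw [longest_apply, longest_apply]; ext <;> simp
  ext x
  constructor
  · rintro ⟨u, hu, rfl⟩
    refine ⟨longest u, ?_, by rw [Chart.compAut_apply, h]⟩
    rw [Set.mem_Ici, Prod.le_def] at hu
    rw [Set.mem_Iic, Prod.le_def, longest_apply, longest_apply]
    simp only
    omega
  · rintro ⟨u, hu, rfl⟩
    refine ⟨longest u, ?_, rfl⟩
    rw [Set.mem_Iic, Prod.le_def, longest_apply] at hu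
    rw [Set.mem_Ici, Prod.le_def, longest_apply]
    simp only at *
    omega

theorem isSector_Ici (φ : X.Chart) (v : CoweightLattice) : X.IsSector (φ '' Set.Ici v) := by
  rw [φ.image_Ici]; exact isSector_Iic _ _

/-- The Weyl group element is absorbed into the chart. -/
theorem IsSector.exists_eq_image_Iic {S : Set V} (hS : X.IsSector S) :
    ∃ (φ : X.Chart) (v : CoweightLattice), S = φ '' Set.Iic v := by
  obtain ⟨φ, v, w, hw, rfl⟩ := hS
  have hl := isLinearAut_of_mem hw
  have : φ '' sector v w = φ.compAut hl '' Set.Ici (w⁻¹ v) := by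
    ext x
    constructor
    · rintro ⟨_, ⟨y, hy, rfl⟩, rfl⟩
      refine ⟨w⁻¹ v + y, by simpa using hy, ?_⟩
      rw [Chart.compAut_apply, hl.map_add]
      simp
    · rintro ⟨u, hu, rfl⟩
      refine ⟨w u, ⟨u - w⁻¹ v, by simpa using hu, ?_⟩, rfl⟩
      conv_rhs => lhs; rw [show v = w (w⁻¹ v) from (w.apply_symm_apply v).symm]
      rw [← hl.map_add]
      simp
  rw [this, Chart.image_Ici]
  exact ⟨_, _, rfl⟩

/-! ### Subsectors, and the opposite boundary points as families. -/

namespace IsTriangleBuilding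

theorem mem_image_of_forall_mem_range (hX : X.IsTriangleBuilding) (φ : X.Chart) {s : Finset V}
    (hs : s ∈ X.complex.faces) (h : ∀ x ∈ s, x ∈ Set.range φ) : s ∈ φ.image := by
  obtain ⟨t, rfl⟩ : ∃ t : Finset CoweightLattice, t.map φ.toEmb = s := by
    classical
    refine ⟨s.preimage φ φ.injective.injOn, ?_⟩
    ext x
    simp only [Finset.mem_map, Finset.mem_preimage]
    constructor
    · rintro ⟨u, hu, rfl⟩; exact hu
    · intro hx
      obtain ⟨u, rfl⟩ := h x hx
      exact ⟨u, hx, rfl⟩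
  refine φ.map_mem_image (mem_coxeterComplex_faces.2 ⟨?_, fun u hu v hv => ?_⟩)
  · exact Finset.map_nonempty.1 (X.complex.isRelLowerSet_faces hs).1
  · exact hX.near_of_near_apply φ
      ⟨_, hs, Finset.mem_map_of_mem _ hu, Finset.mem_map_of_mem _ hv⟩

/-- The isomorphism of apartments that have a base chamber in common. -/
theorem exists_isom_of_baseChamber (hX : X.IsTriangleBuilding) {φ φ' : X.Chart}
    {v : CoweightLattice} (h : ∀ u ∈ baseChamber v, φ u ∈ Set.range φ') :
    ∃ ψ : X.Chart, ψ.image = φ'.image ∧ ∀ u, φ u ∈ Set.range φ' → ψ u = φ u := by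
  have hD := φ.map_mem_image (baseChamber_mem_faces v)
  refine hX.exists_isom φ φ' ⟨_, ⟨hD, hX.mem_image_of_forall_mem_range φ' (φ.image_subset_faces hD)
    ?_⟩, by rw [Finset.card_map, card_baseChamber]⟩
  intro x hx
  obtain ⟨u, hu, rfl⟩ := Finset.mem_map.1 hx
  exact h u hu

theorem mem_Iic_of_mem_baseChamber {u v : CoweightLattice} (hu : u ∈ baseChamber (v - (1, 1))) :
    u ∈ Set.Iic v := by
  simpa using le_add_of_mem_baseChamber hu

/-- In the coordinates of `φ` the inclusion is an affine map of quadrants, and boundedness above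
along both negative axes leaves only translations. -/
theorem exists_eq_image_Iic_of_subset (hX : X.IsTriangleBuilding) {φ : X.Chart}
    {v : CoweightLattice} {T : Set V} (hT : X.IsSector T) (hsub : T ⊆ φ '' Set.Iic v) :
    ∃ v', T = φ '' Set.Iic v' := by
  obtain ⟨ψ, v₁, rfl⟩ := hT.exists_eq_image_Iic
  have hr : ∀ u ≤ v₁, ψ u ∈ Set.range φ := fun u hu =>
    Set.image_subset_range _ _ (hsub ⟨u, hu, rfl⟩)
  obtain ⟨ψ', himg, hψ'⟩ := hX.exists_isom_of_baseChamber (φ := ψ) (φ' := φ) (v := v₁ - (1, 1))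
    fun u hu => hr u (mem_Iic_of_mem_baseChamber hu)
  obtain ⟨f, hf, hn, ht, hfφ⟩ := Chart.exists_reparam himg
  obtain ⟨i, k, haff⟩ := exists_affine hf hn ht
  have hle : ∀ u ≤ v₁, f u ≤ v := by
    intro u hu
    obtain ⟨t, ht, htu⟩ := hsub ⟨u, hu, rfl⟩
    rw [← hψ' u (hr u hu), hfφ] at htu
    rwa [← φ.injective htu]
  -- `N` exceeds all the offsets involved, so a wrong linear part violates one of the two bounds.
  let N : ℕ := (f 0).1.natAbs + (f 0).2.natAbs + v.1.natAbs + v.2.natAbs + v₁.1.natAbs +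
    v₁.2.natAbs + 1
  have hN1 := hle (v₁ - ((N : ℤ), 0)) (by rw [Prod.le_def]; simp)
  have hN2 := hle (v₁ - (0, (N : ℤ))) (by rw [Prod.le_def]; simp)
  rw [haff, Prod.le_def] at hN1 hN2
  -- `step 0` is λ₁ and `step 2` is -λ₂, so this choice is the identity linear part.
  have hik : i = 0 ∧ k = 2 := by
    simp only [Prod.fst_add, Prod.snd_add, Prod.fst_sub, Prod.snd_sub, Prod.smul_fst,
      Prod.smul_snd, smul_eq_mul] at hN1 hN2
    fin_cases i <;> fin_cases k <;> simp [step] at hN1 hN2 ⊢ <;> omega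
  obtain ⟨rfl, rfl⟩ := hik
  have hf' : ∀ u, f u = f 0 + u := fun u => by
    rw [haff u]; ext <;> simp [step]
  refine ⟨f 0 + v₁, ?_⟩
  ext x
  constructor
  · rintro ⟨u, hu, rfl⟩
    exact ⟨f 0 + u, by simpa using hu, by rw [← hψ' u (hr u hu), hfφ, hf' u]⟩
  · rintro ⟨u, hu, rfl⟩
    have hu' : u - f 0 ≤ v₁ := sub_le_iff_le_add'.2 hu
    exact ⟨u - f 0, hu', by rw [← hψ' _ (hr _ hu'), hfφ, hf' (u - f 0)]; simp⟩

theorem exists_eq_image_Ici_of_subset (hX : X.IsTriangleBuilding) {φ : X.Chart}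
    {v : CoweightLattice} {T : Set V} (hT : X.IsSector T) (hsub : T ⊆ φ '' Set.Ici v) :
    ∃ v', T = φ '' Set.Ici v' := by
  rw [φ.image_Ici] at hsub
  obtain ⟨v', h⟩ := hX.exists_eq_image_Iic_of_subset hT hsub
  refine ⟨longest v', ?_⟩
  rw [h, φ.image_Ici]
  congr
  rw [longest_apply, longest_apply]
  ext <;> simp

/-- Two subsectors of one sector share the subsector based at the infimum of their apices. -/
theorem sectorEquiv_of_sectorEquiv (hX : X.IsTriangleBuilding) {S S₁ S₂ : Set V}
    (hS : X.IsSector S) (h₁ : X.SectorEquiv S S₁) (h₂ : X.SectorEquiv S S₂) :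
    X.SectorEquiv S₁ S₂ := by
  obtain ⟨φ, v, rfl⟩ := hS.exists_eq_image_Iic
  obtain ⟨T₁, hT₁, h1, h1'⟩ := h₁
  obtain ⟨T₂, hT₂, h2, h2'⟩ := h₂
  obtain ⟨a, rfl⟩ := hX.exists_eq_image_Iic_of_subset hT₁ h1
  obtain ⟨b, rfl⟩ := hX.exists_eq_image_Iic_of_subset hT₂ h2
  exact ⟨φ '' Set.Iic (a ⊓ b), isSector_Iic φ _,
    (Set.image_mono (Set.Iic_subset_Iic.2 inf_le_left)).trans h1',
    (Set.image_mono (Set.Iic_subset_Iic.2 inf_le_right)).trans h2'⟩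

theorem isSector_of_mem {ω : X.Boundary} {S : Set V} (h : S ∈ ω.1) : X.IsSector S := by
  obtain ⟨S₀, -, h₀⟩ := ω.2
  rw [h₀] at h
  exact h.1

theorem sectorEquiv_of_mem (hX : X.IsTriangleBuilding) {ω : X.Boundary} {S S' : Set V}
    (h : S ∈ ω.1) (h' : S' ∈ ω.1) : X.SectorEquiv S S' := by
  obtain ⟨S₀, hS₀, h₀⟩ := ω.2
  rw [h₀] at h h'
  exact hX.sectorEquiv_of_sectorEquiv hS₀ h.2 h'.2

theorem mem_of_sectorEquiv (hX : X.IsTriangleBuilding) {ω : X.Boundary} {S S' : Set V}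
    (h : S ∈ ω.1) (hS' : X.IsSector S') (h' : X.SectorEquiv S S') : S' ∈ ω.1 := by
  have hS := isSector_of_mem h
  obtain ⟨S₀, hS₀, h₀⟩ := ω.2
  rw [h₀] at h ⊢
  refine ⟨hS', hX.sectorEquiv_of_sectorEquiv hS ?_ h'⟩
  obtain ⟨T, hT, h1, h2⟩ := h.2
  exact ⟨T, hT, h2, h1⟩

variable (hX : X.IsTriangleBuilding) {q : ℕ} (hq : X.HasOrder q) {φ₀ : X.Chart} {ω₀ : X.Boundary}

theorem mem_throughVertex_iff {ω : X.OppositeBoundary ω₀} {φ : X.Chart}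
    (h1 : φ '' Set.Ici 0 ∈ ω.1.1) (h2 : φ '' Set.Iic 0 ∈ ω₀.1)
    (h3 : ∀ A, X.Joins A ω.1 ω₀ → A = Set.range φ) (x : V) :
    ω ∈ X.throughVertex ω₀ x ↔ x ∈ Set.range φ := by
  constructor
  · rintro ⟨A, hA, hx⟩
    rwa [← h3 A hA]
  · intro hx
    exact ⟨_, ⟨⟨φ, rfl⟩, _, h1, _, h2, Set.image_subset_range _ _, Set.image_subset_range _ _⟩, hx⟩

theorem mem_range_iff {φ : X.Chart} (h : φ.Asymp φ₀) (x : V) :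
    x ∈ Set.range φ ↔ φ ((hX.horoSystem hq φ₀).lev x) = x := by
  constructor
  · rintro ⟨u, rfl⟩
    rw [(hX.isFamily_of_asymp hq h).lev_apply]
  · intro hx
    exact ⟨_, hx⟩

/-- The coordinates of the apartment `[ω, ω₀]`. -/
theorem exists_isFamily_of_opposite (hω₀ : φ₀ '' Set.Iic 0 ∈ ω₀.1) (ω : X.OppositeBoundary ω₀) :
    ∃ c, (hX.horoSystem hq φ₀).IsFamily c ∧ ∀ x,
      ω ∈ X.throughVertex ω₀ x ↔ c ((hX.horoSystem hq φ₀).lev x) = x := by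
  obtain ⟨φ, h1, h2, h3⟩ := ω.2
  obtain ⟨T, hT, hT₀, hTφ⟩ := hX.sectorEquiv_of_mem hω₀ h2
  obtain ⟨v, rfl⟩ := hX.exists_eq_image_Iic_of_subset hT hT₀
  have hr : ∀ u ≤ v, φ₀ u ∈ Set.range φ := fun u hu =>
    Set.image_subset_range _ _ (hTφ ⟨u, hu, rfl⟩)
  obtain ⟨ψ, himg, hψ⟩ := hX.exists_isom_of_baseChamber (φ := φ₀) (φ' := φ) (v := v - (1, 1))
    fun u hu => hr u (mem_Iic_of_mem_baseChamber hu)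
  have hasymp : ψ.Asymp φ₀ := ⟨v, fun u hu => hψ u (hr u hu)⟩
  refine ⟨ψ, hX.isFamily_of_asymp hq hasymp, fun x => ?_⟩
  rw [mem_throughVertex_iff h1 h2 h3, ← hX.mem_range_iff hq hasymp,
    (Chart.range_subset_of_image_subset himg.subset).antisymm
      (Chart.range_subset_of_image_subset himg.superset)]

/-- The family is an apartment whose upward sector defines ω. Any apartment joining ω to ω₀ contains
subsectors in both directions, and by convexity everything between them, which is the whole
apartment. -/
theorem exists_opposite_of_isFamily (hω₀ : φ₀ '' Set.Iic 0 ∈ ω₀.1) {c : CoweightLattice → V}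
    (hc : (hX.horoSystem hq φ₀).IsFamily c) :
    ∃ ω : X.OppositeBoundary ω₀, ∀ x,
      ω ∈ X.throughVertex ω₀ x ↔ c ((hX.horoSystem hq φ₀).lev x) = x := by
  obtain ⟨φ, hasymp, hφ⟩ := hX.exists_chart_of_isFamily hq hc
  let ω : X.Boundary := ⟨_, φ '' Set.Ici 0, isSector_Ici φ 0, rfl⟩
  have h1 : φ '' Set.Ici 0 ∈ ω.1 :=
    ⟨isSector_Ici φ 0, _, isSector_Ici φ 0, subset_rfl, subset_rfl⟩
  have h2 : φ '' Set.Iic 0 ∈ ω₀.1 := by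
    refine hX.mem_of_sectorEquiv hω₀ (isSector_Iic φ 0) ?_
    obtain ⟨v, hv⟩ := hasymp
    refine ⟨φ '' Set.Iic (v ⊓ 0), isSector_Iic φ _, ?_, Set.image_mono
      (Set.Iic_subset_Iic.2 inf_le_right)⟩
    rintro _ ⟨u, hu, rfl⟩
    have hu' : u ≤ v ⊓ 0 := hu
    exact ⟨u, hu'.trans inf_le_right, (hv u (hu'.trans inf_le_left)).symm⟩
  have h3 : ∀ A, X.Joins A ω ω₀ → A = Set.range φ := by
    rintro _ ⟨⟨χ, rfl⟩, S, hS, S', hS', hSA, hSA'⟩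
    obtain ⟨T, hT, hTφ, hTS⟩ := hX.sectorEquiv_of_mem h1 hS
    obtain ⟨T', hT', hTφ', hTS'⟩ := hX.sectorEquiv_of_mem h2 hS'
    obtain ⟨b, rfl⟩ := hX.exists_eq_image_Ici_of_subset hT hTφ
    obtain ⟨a, rfl⟩ := hX.exists_eq_image_Iic_of_subset hT' hTφ'
    have hb : ∀ u, b ≤ u → φ u ∈ Set.range χ := fun u hu => hSA (hTS ⟨u, hu, rfl⟩)
    have ha : ∀ u ≤ a, φ u ∈ Set.range χ := fun u hu => hSA' (hTS' ⟨u, hu, rfl⟩)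
    obtain ⟨ψ, himg, hψ⟩ := hX.exists_isom_of_baseChamber (φ := φ) (φ' := χ) (v := b)
      fun u hu => hb u (le_of_mem_baseChamber hu)
    -- Every `u` lies in the interval from `u ⊓ a` to `u ⊔ b`, at whose ends the two charts agree.
    have heq : ∀ u, ψ u = φ u := fun u =>
      hX.eq_on_Icc (hψ _ (ha _ (inf_le_right (a := u)))) (hψ _ (hb _ (le_sup_right (a := u))))
        inf_le_left le_sup_left
    rw [(Chart.range_subset_of_image_subset himg.superset).antisymm
      (Chart.range_subset_of_image_subset himg.subset)]
    exact congrArg Set.range (funext heq)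
  refine ⟨⟨ω, φ, h1, h2, h3⟩, fun x => ?_⟩
  rw [← hφ, ← hX.mem_range_iff hq hasymp]
  exact mem_throughVertex_iff (ω := ⟨ω, φ, h1, h2, h3⟩) h1 h2 h3 x

end IsTriangleBuilding

end TypedComplex

/-! ### Existence and uniqueness of the boundary measure. -/

namespace HoroSystem

open CoweightLattice hiding ext_iff Near

variable {V : Type*} {q : ℕ}

/-- A measurable space whose points are the families of `H`, and whose σ-field is generated by the
sets of families through a vertex. -/
structure Space (H : HoroSystem V q) (Ω : Type*) [mΩ : MeasurableSpace Ω] where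
  /-- The family that corresponds to a point. -/
  fam : Ω → CoweightLattice → V
  isFamily : ∀ ω, H.IsFamily (fam ω)
  exists_fam_eq : ∀ c, H.IsFamily c → ∃ ω, fam ω = c
  generateFrom_eq : mΩ = MeasurableSpace.generateFrom
    (Set.range fun x => {ω | fam ω (H.lev x) = x})

namespace Space

variable {H : HoroSystem V q} {Ω : Type*} [mΩ : MeasurableSpace Ω] (S : H.Space Ω)

/-- The points whose family goes through `x`. -/
def thru (x : V) : Set Ω := {ω | S.fam ω (H.lev x) = x}

/-- The property that determines the measure. -/
def IsNormalized (μ : Measure Ω) : Prop :=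
  ∀ x, μ (S.thru x) = (q : ℝ≥0∞) ^ (-2 * level (H.lev x))

variable {S} {x y z : V} {nu : CoweightLattice}

theorem mem_thru_iff {ω : Ω} (h : H.lev x = nu) : ω ∈ S.thru x ↔ S.fam ω nu = x := by
  subst h; rfl

theorem mem_thru_fam (S : H.Space Ω) (ω : Ω) (nu : CoweightLattice) :
    ω ∈ S.thru (S.fam ω nu) := by
  rw [mem_thru_iff ((S.isFamily ω).lev_apply nu)]

theorem proj_fam (S : H.Space Ω) (ω : Ω) {u w : CoweightLattice} (h : u ≤ w) :
    H.proj u (S.fam ω w) = S.fam ω u := (S.isFamily ω).proj_apply u w h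

theorem lev_fam (S : H.Space Ω) (ω : Ω) (u : CoweightLattice) : H.lev (S.fam ω u) = u :=
  (S.isFamily ω).lev_apply u

theorem measurableSet_thru (S : H.Space Ω) (x : V) : MeasurableSet (S.thru x) := by
  have := MeasurableSpace.measurableSet_generateFrom
    (s := Set.range fun x => {ω | S.fam ω (H.lev x) = x}) ⟨x, rfl⟩
  rwa [← S.generateFrom_eq] at this

theorem thru_eq_iUnion (S : H.Space Ω) (h : H.lev x ≤ nu) :
    S.thru x = ⋃ z ∈ H.cone nu x, S.thru z := by
  ext ω
  simp only [Set.mem_iUnion]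
  constructor
  · intro hω
    refine ⟨S.fam ω nu, ⟨S.lev_fam ω nu, ?_⟩, S.mem_thru_fam ω nu⟩
    rw [S.proj_fam ω h, hω]
  · rintro ⟨z, ⟨hz, hzx⟩, hω⟩
    rw [mem_thru_iff hz] at hω
    rw [mem_thru_iff rfl, ← S.proj_fam ω h, hω, hzx]

theorem disjoint_thru (S : H.Space Ω) (hx : H.lev x = nu) (hy : H.lev y = nu) (hne : x ≠ y) :
    Disjoint (S.thru x) (S.thru y) := by
  rw [Set.disjoint_left]
  intro ω h1 h2
  rw [mem_thru_iff hx] at h1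
  rw [mem_thru_iff hy] at h2
  exact hne (h1.symm.trans h2)

theorem iUnion_thru (S : H.Space Ω) (nu : CoweightLattice) :
    ⋃ x ∈ {x | H.lev x = nu}, S.thru x = Set.univ := by
  refine Set.eq_univ_of_forall fun ω => ?_
  simp only [Set.mem_iUnion]
  exact ⟨S.fam ω nu, S.lev_fam ω nu, S.mem_thru_fam ω nu⟩

theorem cast_ne_zero (H : HoroSystem V q) : (q : ℝ≥0∞) ≠ 0 := by
  exact_mod_cast H.order_ne_zero

theorem IsNormalized.ne_top {μ : Measure Ω} (h : S.IsNormalized μ) (x : V) :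
    μ (S.thru x) ≠ ∞ := by
  rw [h x]
  exact ENNReal.zpow_ne_top (cast_ne_zero H) (ENNReal.natCast_ne_top q) _

theorem IsNormalized.ne_zero {μ : Measure Ω} (h : S.IsNormalized μ) (x : V) :
    μ (S.thru x) ≠ 0 := by
  rw [h x]
  exact (ENNReal.zpow_pos (cast_ne_zero H) (ENNReal.natCast_ne_top q) _).ne'

/-- The sets of families through a vertex on the upper half of the diagonal. -/
def diagSets (S : H.Space Ω) : Set (Set Ω) :=
  {s | ∃ (n : ℕ) (z : V), H.lev z = (0 : CoweightLattice).diag n ∧ s = S.thru z}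

/-- Every position lies below a point of the diagonal, so each generator is a countable union of
diagonal sets. -/
theorem generateFrom_diagSets (S : H.Space Ω) :
    mΩ = MeasurableSpace.generateFrom S.diagSets := by
  have := H.countable
  apply le_antisymm
  · conv_lhs => rw [S.generateFrom_eq]
    refine MeasurableSpace.generateFrom_le ?_
    rintro _ ⟨x, rfl⟩
    change MeasurableSet[MeasurableSpace.generateFrom S.diagSets] (S.thru x)
    rw [S.thru_eq_iUnion (CoweightLattice.le_diag_toNat 0 (H.lev x))]
    refine MeasurableSet.biUnion (Set.to_countable _) fun z hz => ?_
    exact MeasurableSpace.measurableSet_generateFrom ⟨_, z, hz.1, rfl⟩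
  · refine MeasurableSpace.generateFrom_le ?_
    rintro _ ⟨n, z, -, rfl⟩
    exact S.measurableSet_thru z

theorem thru_subset_of_le (S : H.Space Ω) (hle : H.lev x ≤ H.lev y)
    (h : (S.thru x ∩ S.thru y).Nonempty) : S.thru y ⊆ S.thru x := by
  obtain ⟨ω, h1, h2⟩ := h
  intro ω' h3
  rw [mem_thru_iff rfl] at *
  rw [← S.proj_fam ω hle, h2] at h1
  rw [← S.proj_fam ω' hle, h3, h1]

/-- Positions on the diagonal are totally ordered, so two of these sets are nested or disjoint. This
is the reason for restricting to the diagonal. -/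
theorem isPiSystem_diagSets (S : H.Space Ω) : IsPiSystem S.diagSets := by
  rintro _ ⟨m, x, hx, rfl⟩ _ ⟨n, y, hy, rfl⟩ h
  rcases le_total m n with hmn | hmn
  · have hle : H.lev x ≤ H.lev y := by rw [hx, hy]; exact CoweightLattice.diag_le_diag hmn
    rw [Set.inter_eq_right.2 (S.thru_subset_of_le hle h)]
    exact ⟨n, y, hy, rfl⟩
  · have hle : H.lev y ≤ H.lev x := by rw [hx, hy]; exact CoweightLattice.diag_le_diag hmn
    rw [Set.inter_comm] at h
    rw [Set.inter_eq_left.2 (S.thru_subset_of_le hle h)]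
    exact ⟨m, x, hx, rfl⟩

theorem diag_zero : (0 : CoweightLattice).diag 0 = 0 := by
  ext <;> simp [CoweightLattice.diag]

theorem IsNormalized.eq {μ μ' : Measure Ω} (h : S.IsNormalized μ) (h' : S.IsNormalized μ') :
    μ = μ' := by
  have := H.countable
  refine Measure.ext_of_generateFrom_of_cover (T := S.thru '' {x | H.lev x = 0})
    S.generateFrom_diagSets ((Set.to_countable _).image _) S.isPiSystem_diagSets ?_ ?_ ?_ ?_
  · rw [Set.sUnion_image, S.iUnion_thru]
  · rintro _ ⟨x, -, rfl⟩
    exact h.ne_top x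
  · rintro _ ⟨x, hx, rfl⟩ _ ⟨n, z, hz, rfl⟩
    by_cases hne : (S.thru x ∩ S.thru z).Nonempty
    · have hle : H.lev x ≤ H.lev z := by
        rw [hx, hz, ← diag_zero]
        exact CoweightLattice.diag_le_diag (Nat.zero_le n)
      rw [Set.inter_eq_left.2 (S.thru_subset_of_le hle hne), h, h']
    · rw [Set.inter_comm, Set.not_nonempty_iff_eq_empty.1 hne, measure_empty, measure_empty]
  · rintro _ ⟨x, -, rfl⟩
    rw [h, h']

theorem walk_succ_eq_iff (H : HoroSystem V q) (x : V) (t : ℕ → Fin (q ^ 4)) (n : ℕ) (z : V)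
    (hzy : H.proj ((H.lev x).diag n) z = y)
    (hy : z ∈ H.cone ((H.lev y).diag 1) y) :
    H.walk x t (n + 1) = z ↔ H.walk x t n = y ∧ t n = (H.coneEquiv y).symm ⟨z, hy⟩ := by
  constructor
  · rintro h
    have h1 : H.walk x t n = y := by
      rw [← hzy, ← h, (H.isChain_walk x t).proj_succ]
    refine ⟨h1, ?_⟩
    subst h1
    rw [Equiv.eq_symm_apply]
    exact Subtype.ext h
  · rintro ⟨rfl, h⟩
    rw [walk, h, Equiv.apply_symm_apply]

/-- The projections of `z` to the lower diagonal positions determine the walk up to time `n`, so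
passing through `z` is a cylinder event. -/
theorem exists_walk_eq_iff (H : HoroSystem V q) (x : V) (n : ℕ) :
    ∀ z ∈ H.cone ((H.lev x).diag n) x, ∃ k : ℕ → Fin (q ^ 4), ∀ t,
      H.walk x t n = z ↔ ∀ i < n, t i = k i := by
  have : NeZero (q ^ 4) := ⟨pow_ne_zero _ H.order_ne_zero⟩
  induction n with
  | zero =>
    rintro z ⟨h1, h2⟩
    refine ⟨fun _ => 0, fun t => ⟨fun _ i hi => absurd hi (Nat.not_lt_zero i), fun _ => ?_⟩⟩
    rw [show (H.lev x).diag 0 = H.lev x by ext <;> simp [CoweightLattice.diag]] at h1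
    rw [← h1, H.proj_lev] at h2
    rw [walk, h2]
  | succ n ih =>
    rintro z ⟨h1, h2⟩
    have hle : (H.lev x).diag n ≤ H.lev z := by
      rw [h1]; exact CoweightLattice.diag_le_diag (Nat.le_succ n)
    have hlx : H.lev x ≤ (H.lev x).diag n := by
      rw [Prod.le_def]; simp [CoweightLattice.diag]
    set y := H.proj ((H.lev x).diag n) z with hy
    have hly : H.lev y = (H.lev x).diag n := H.lev_proj hle
    obtain ⟨k, hk⟩ := ih y ⟨hly, by rw [hy, H.proj_proj hlx hle, h2]⟩
    have hzy : z ∈ H.cone ((H.lev y).diag 1) y := by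
      refine ⟨?_, by rw [hly]⟩
      rw [h1, hly]
      ext <;> simp [CoweightLattice.diag] <;> ring
    refine ⟨Function.update k n ((H.coneEquiv y).symm ⟨z, hzy⟩), fun t => ?_⟩
    rw [walk_succ_eq_iff H x t n z hy.symm hzy, hk]
    constructor
    · rintro ⟨h3, h4⟩ i hi
      rcases Nat.lt_succ_iff_lt_or_eq.1 hi with hi | rfl
      · rw [Function.update_of_ne hi.ne, h3 i hi]
      · rw [Function.update_self, h4]
    · intro h3
      refine ⟨fun i hi => ?_, ?_⟩
      · rw [h3 i (hi.trans (Nat.lt_succ_self n)), Function.update_of_ne hi.ne]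
      · rw [h3 n (Nat.lt_succ_self n), Function.update_self]

theorem nonempty_steps (H : HoroSystem V q) : Nonempty (Fin (q ^ 4)) :=
  ⟨⟨0, Nat.pos_of_ne_zero (pow_ne_zero _ H.order_ne_zero)⟩⟩

/-- The uniform distribution on the steps. -/
noncomputable def stepMeasure (H : HoroSystem V q) : Measure (Fin (q ^ 4)) :=
  haveI := nonempty_steps H
  (PMF.uniformOfFintype (Fin (q ^ 4))).toMeasure

instance (H : HoroSystem V q) : IsProbabilityMeasure (stepMeasure H) := by
  have := nonempty_steps H
  unfold stepMeasure; infer_instance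

theorem stepMeasure_singleton (H : HoroSystem V q) (k : Fin (q ^ 4)) :
    stepMeasure H {k} = ((q : ℝ≥0∞) ^ 4)⁻¹ := by
  have := nonempty_steps H
  rw [stepMeasure, PMF.toMeasure_apply_singleton _ _ (MeasurableSet.singleton _),
    PMF.uniformOfFintype_apply, Fintype.card_fin]
  push_cast
  rfl

theorem measurableSet_walk_eq (H : HoroSystem V q) (x : V) (n : ℕ) (z : V) :
    MeasurableSet {t | H.walk x t n = z} := by
  by_cases hz : z ∈ H.cone ((H.lev x).diag n) x
  · obtain ⟨k, hk⟩ := exists_walk_eq_iff H x n z hz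
    simp only [hk]
    have : {t : ℕ → Fin (q ^ 4) | ∀ i < n, t i = k i} =
        Set.pi (Finset.range n : Set ℕ) fun i => {k i} := by
      ext t; simp
    rw [this]
    exact MeasurableSet.pi (Set.to_countable _) fun _ _ => MeasurableSet.singleton _
  · convert MeasurableSet.empty
    refine Set.eq_empty_of_forall_notMem fun t ht => hz ?_
    rw [← show H.walk x t n = z from ht]
    refine ⟨H.lev_walk x t n, ?_⟩
    have := (H.isChain_walk x t).proj_apply (Nat.zero_le n)
    rwa [show (H.lev x).diag 0 = H.lev x by ext <;> simp [CoweightLattice.diag]] at this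

theorem infinitePi_walk_eq (H : HoroSystem V q) (x : V) (n : ℕ) (z : V)
    (hz : z ∈ H.cone ((H.lev x).diag n) x) :
    Measure.infinitePi (fun _ : ℕ => stepMeasure H) {t | H.walk x t n = z} =
      (((q : ℝ≥0∞) ^ 4)⁻¹) ^ n := by
  obtain ⟨k, hk⟩ := exists_walk_eq_iff H x n z hz
  simp only [hk]
  have : {t : ℕ → Fin (q ^ 4) | ∀ i < n, t i = k i} =
      Set.pi (Finset.range n : Set ℕ) fun i => {k i} := by
    ext t; simp
  rw [this, Measure.infinitePi_pi _ fun _ _ => MeasurableSet.singleton _]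
  simp [stepMeasure_singleton]

/-- The point determined by the chain from `x` with prescribed steps. -/
noncomputable def ofWalk (S : H.Space Ω) (x : V) (t : ℕ → Fin (q ^ 4)) : Ω :=
  (S.exists_fam_eq _ (H.isChain_walk x t).isFamily).choose

theorem fam_ofWalk (S : H.Space Ω) (x : V) (t : ℕ → Fin (q ^ 4)) :
    S.fam (S.ofWalk x t) = H.familyOfChain (H.lev x) (H.walk x t) :=
  (S.exists_fam_eq _ (H.isChain_walk x t).isFamily).choose_spec

theorem measurable_ofWalk (S : H.Space Ω) (x : V) : Measurable (S.ofWalk x) := by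
  have := H.countable
  have key : ∀ y, MeasurableSet (S.ofWalk x ⁻¹' S.thru y) := by
    intro y
    have : S.ofWalk x ⁻¹' S.thru y = ⋃ z ∈ {z | H.proj (H.lev y) z = y},
        {t | H.walk x t
          (((H.lev y).1 - (H.lev x).1) ⊔ ((H.lev y).2 - (H.lev x).2)).toNat = z} := by
      ext t
      rw [Set.mem_preimage, mem_thru_iff rfl, fam_ofWalk, familyOfChain]
      simp
    rw [this]
    exact MeasurableSet.biUnion (Set.to_countable _) fun z _ => measurableSet_walk_eq H x _ z
  intro s hs
  rw [S.generateFrom_eq] at hs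
  induction s, hs using MeasurableSpace.generateFrom_induction with
  | hC _ hs =>
    obtain ⟨y, rfl⟩ := hs
    exact key y
  | empty => simp
  | compl t _ ih => exact ih.compl
  | iUnion f _ ih => rw [Set.preimage_iUnion]; exact MeasurableSet.iUnion ih

/-- The measure that gives mass one to each of the sets `thru x` with `lev x = 0`, and on each of
them makes the diagonal steps independent and uniform. -/
noncomputable def canonicalMeasure (S : H.Space Ω) : Measure Ω :=
  Measure.sum fun x : {x : V // H.lev x = 0} =>
    (Measure.infinitePi fun _ : ℕ => stepMeasure H).map (S.ofWalk x)

/-- Only the walk started at the projection of `z` to the origin can reach `z`. -/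
theorem canonicalMeasure_thru_of_diag (S : H.Space Ω) {n : ℕ}
    (hz : H.lev z = (0 : CoweightLattice).diag n) :
    S.canonicalMeasure (S.thru z) = (((q : ℝ≥0∞) ^ 4)⁻¹) ^ n := by
  have hle : (0 : CoweightLattice) ≤ H.lev z := by
    rw [hz, ← diag_zero]; exact CoweightLattice.diag_le_diag (Nat.zero_le n)
  have hx₀ := H.lev_proj hle
  rw [canonicalMeasure, Measure.sum_apply _ (S.measurableSet_thru z),
    tsum_eq_single ⟨H.proj 0 z, hx₀⟩]
  · rw [Measure.map_apply (S.measurable_ofWalk _) (S.measurableSet_thru z),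
      ← infinitePi_walk_eq H (H.proj 0 z) n z ⟨by rw [hx₀, hz], by rw [hx₀]⟩]
    congr 1
    ext t
    rw [Set.mem_preimage, mem_thru_iff hz, fam_ofWalk]
    have e := (H.isChain_walk (H.proj 0 z) t).familyOfChain_diag n
    rw [hx₀] at e
    dsimp only
    rw [hx₀, e]
    rfl
  · rintro ⟨x, hx⟩ hne
    rw [Measure.map_apply (S.measurable_ofWalk _) (S.measurableSet_thru z)]
    refine (congrArg _ ?_).trans measure_empty
    refine Set.eq_empty_of_forall_notMem fun t ht => hne (Subtype.ext ?_)
    rw [Set.mem_preimage, mem_thru_iff rfl, fam_ofWalk] at ht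
    have h := (H.isChain_walk x t).isFamily.proj_apply 0 (H.lev z) hle
    rw [ht] at h
    change x = H.proj 0 z
    rw [h]
    have h0 := (H.isChain_walk x t).familyOfChain_diag 0
    rw [show (H.lev x).diag 0 = 0 by rw [hx, diag_zero]] at h0
    exact h0.symm

theorem measure_biUnion_thru (S : H.Space Ω) (μ : Measure Ω) {T : Finset V} {c : ℝ≥0∞}
    (hT : ∀ z ∈ T, H.lev z = nu) (hc : ∀ z ∈ T, μ (S.thru z) = c) :
    μ (⋃ z ∈ T, S.thru z) = T.card * c := by
  rw [measure_biUnion_finset (fun x hx y hy hne => S.disjoint_thru (hT x hx) (hT y hy) hne)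
    fun z _ => S.measurableSet_thru z, Finset.sum_congr rfl hc, Finset.sum_const, nsmul_eq_mul]

/-- Splitting at a diagonal position above `lev x` gives q^(2(2n - ⟨ρ(x), α₀⟩)) pieces, each of mass
q^(-4n). -/
theorem isNormalized_canonicalMeasure (S : H.Space Ω) : S.IsNormalized S.canonicalMeasure := by
  intro x
  obtain ⟨n, hle⟩ : ∃ n, H.lev x ≤ (0 : CoweightLattice).diag n :=
    ⟨_, CoweightLattice.le_diag_toNat 0 (H.lev x)⟩
  have hunion : S.thru x = ⋃ z ∈ (H.finite_cone hle).toFinset, S.thru z := by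
    rw [S.thru_eq_iUnion hle]; simp
  have h0 := cast_ne_zero H
  have ht := ENNReal.natCast_ne_top q
  rw [hunion, S.measure_biUnion_thru _ (nu := (0 : CoweightLattice).diag n)
    (fun z hz => ((Set.Finite.mem_toFinset _).1 hz).1)
    (fun z hz => S.canonicalMeasure_thru_of_diag ((Set.Finite.mem_toFinset _).1 hz).1),
    ← Set.ncard_eq_toFinset_card _ (H.finite_cone hle), H.ncard_cone hle]
  push_cast
  rw [← ENNReal.inv_pow, ← pow_mul, ← zpow_natCast, ← zpow_natCast, ← ENNReal.zpow_neg,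
    ← ENNReal.zpow_add h0 ht]
  congr 1
  rw [Prod.le_def] at hle
  simp only [CoweightLattice.diag, level, Prod.fst_add, Prod.snd_add, Prod.fst_zero,
    Prod.snd_zero] at hle ⊢
  push_cast
  omega

theorem existsUnique_isNormalized (S : H.Space Ω) : ∃! μ : Measure Ω, S.IsNormalized μ :=
  ⟨_, S.isNormalized_canonicalMeasure, fun _ h => h.eq S.isNormalized_canonicalMeasure⟩

end Space

end HoroSystem

/-! ### Conditional expectation given a variable with countably many values. -/

section CondExp

variable {Ω β 𝕜 : Type*} [RCLike 𝕜] {m₀ : MeasurableSpace Ω} {μ : Measure Ω} {ξ : Ω → β}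
  {f g : Ω → 𝕜}

/-- The average of `f` over the fibre of `ξ`. -/
noncomputable def fibreAverage (μ : Measure Ω) (ξ : Ω → β) (f : Ω → 𝕜) (ω : Ω) : 𝕜 :=
  ⨍ ω' in ξ ⁻¹' {ξ ω}, f ω' ∂μ

variable [Countable β] (hξ : ∀ b, MeasurableSet (ξ ⁻¹' {b})) (hfin : ∀ b, μ (ξ ⁻¹' {b}) ≠ ∞)
  (hf : ∀ b, IntegrableOn f (ξ ⁻¹' {b}) μ)
include hξ hfin

omit [Countable β] in
theorem setIntegral_fibreAverage (b : β) :
    ∫ ω in ξ ⁻¹' {b}, fibreAverage μ ξ f ω ∂μ = ∫ ω in ξ ⁻¹' {b}, f ω ∂μ := by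
  rw [setIntegral_congr_fun (g := fun _ => ⨍ ω' in ξ ⁻¹' {b}, f ω' ∂μ) (hξ b)
    (fun ω hω => by simp only [fibreAverage, show ξ ω = b from hω]), setIntegral_const,
    measureReal_def]
  exact measure_smul_setAverage f (hfin b)

omit [Countable β] in
theorem setIntegral_norm_fibreAverage_le (b : β) :
    ∫ ω in ξ ⁻¹' {b}, ‖fibreAverage μ ξ f ω‖ ∂μ ≤ ∫ ω in ξ ⁻¹' {b}, ‖f ω‖ ∂μ := by
  rw [setIntegral_congr_fun (g := fun _ => ‖⨍ ω' in ξ ⁻¹' {b}, f ω' ∂μ‖) (hξ b)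
    (fun ω hω => by simp only [fibreAverage, show ξ ω = b from hω]), setIntegral_const]
  refine le_trans (le_of_eq ?_) (norm_integral_le_integral_norm _)
  rw [← measure_smul_setAverage f (hfin b), norm_smul, Real.norm_of_nonneg measureReal_nonneg,
    smul_eq_mul]

omit [Countable β] in
theorem integrableOn_fibreAverage (b : β) : IntegrableOn (fibreAverage μ ξ f) (ξ ⁻¹' {b}) μ :=
  (integrableOn_const (C := ⨍ ω' in ξ ⁻¹' {b}, f ω' ∂μ) (hfin b)).congr_fun
    (fun ω hω => by simp only [fibreAverage, show ξ ω = b from hω]) (hξ b)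

/-- A set of the σ-field is a countable disjoint union of fibres. Averaging does not increase the
integral of the norm on a fibre, so the series over the fibres converges absolutely. -/
theorem isLocalCondExp_fibreAverage :
    IsLocalCondExp μ (MeasurableSpace.comap ξ ⊤) f (fibreAverage μ ξ f) := by
  have key : ∀ s, MeasurableSet[MeasurableSpace.comap ξ ⊤] s → IntegrableOn f s μ →
      IntegrableOn (fibreAverage μ ξ f) s μ ∧
        ∫ ω in s, fibreAverage μ ξ f ω ∂μ = ∫ ω in s, f ω ∂μ := by
    rintro _ ⟨T, -, rfl⟩ hs
    have hU : ξ ⁻¹' T = ⋃ b : T, ξ ⁻¹' {(b : β)} := by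
      ext ω; simp
    rw [hU] at hs ⊢
    have hdis : Pairwise (Function.onFun Disjoint fun b : T => ξ ⁻¹' {(b : β)}) := by
      intro b b' hne
      refine Disjoint.preimage _ ?_
      simpa using fun h => hne (Subtype.ext h)
    have hmeas : ∀ b : T, MeasurableSet (ξ ⁻¹' {(b : β)}) := fun b => hξ b
    have hint : IntegrableOn (fibreAverage μ ξ f) (⋃ b : T, ξ ⁻¹' {(b : β)}) μ := by
      refine integrableOn_iUnion_of_summable_integral_norm
        (fun b => integrableOn_fibreAverage hξ hfin _) ?_
      exact Summable.of_nonneg_of_le (fun b => integral_nonneg fun _ => norm_nonneg _)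
        (fun b => setIntegral_norm_fibreAverage_le hξ hfin _)
        (hasSum_integral_iUnion hmeas hdis hs.norm).summable
    refine ⟨hint, ?_⟩
    rw [integral_iUnion hmeas hdis hint, integral_iUnion hmeas hdis hs]
    exact tsum_congr fun b => setIntegral_fibreAverage hξ hfin _
  refine ⟨?_, fun s h1 h2 => (key s h1 h2).1, fun s h1 h2 => (key s h1 h2).2⟩
  have : Measurable[MeasurableSpace.comap ξ ⊤] (fibreAverage μ ξ f) :=
    (measurable_from_top (f := fun b => ⨍ ω' in ξ ⁻¹' {b}, f ω' ∂μ)).comp (comap_measurable ξ)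
  exact this.stronglyMeasurable.aestronglyMeasurable

include hf in
theorem IsLocalCondExp.ae_eq_fibreAverage
    (h : IsLocalCondExp μ (MeasurableSpace.comap ξ ⊤) f g) : g =ᵐ[μ] fibreAverage μ ξ f := by
  obtain ⟨g', hg', hgg'⟩ := h.aestronglyMeasurable
  -- A function measurable for the σ-field of `ξ` factors through `ξ`.
  have hconst : ∀ ω ω', ξ ω = ξ ω' → g' ω = g' ω' := by
    intro ω ω' hω
    let _ : MeasurableSpace β := ⊤
    exact hg'.factorsThrough hω
  have hb : ∀ b, ∀ᵐ ω ∂μ, ξ ω = b → g ω = fibreAverage μ ξ f ω := by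
    intro b
    -- On a null fibre there is nothing to prove; on the others the constant value is the average of
    -- `g`, hence of `f`.
    by_cases h0 : μ (ξ ⁻¹' {b}) = 0
    · filter_upwards [measure_eq_zero_iff_ae_notMem.1 h0] with ω hω hωb
      exact absurd hωb hω
    · filter_upwards [hgg'] with ω hω hωb
      have h1 : ⨍ ω' in ξ ⁻¹' {b}, f ω' ∂μ = ⨍ ω' in ξ ⁻¹' {b}, g ω' ∂μ := by
        rw [setAverage_eq, setAverage_eq, h.setIntegral_eq _ ⟨{b}, trivial, rfl⟩ (hf b)]
      have h2 : ∫ ω' in ξ ⁻¹' {b}, g ω' ∂μ = ∫ _ in ξ ⁻¹' {b}, g' ω ∂μ := by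
        rw [integral_congr_ae (ae_restrict_of_ae hgg')]
        exact setIntegral_congr_fun (hξ b) fun ω' hω' =>
          hconst _ _ ((show ξ ω' = b from hω').trans hωb.symm)
      rw [fibreAverage, hωb, h1, setAverage_eq, h2, ← setAverage_eq, setAverage_const h0 (hfin b),
        hω]
  filter_upwards [ae_all_iff.2 hb] with ω hω
  exact hω _ rfl

include hf in
/-- The conditional expectation given a random variable with countably many values. -/
theorem localCondExp_comap_ae_eq :
    localCondExp μ (MeasurableSpace.comap ξ ⊤) f =ᵐ[μ] fibreAverage μ ξ f := by
  have h : ∃ g, IsLocalCondExp μ (MeasurableSpace.comap ξ ⊤) f g :=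
    ⟨_, isLocalCondExp_fibreAverage hξ hfin⟩
  rw [localCondExp, dif_pos h]
  exact h.choose_spec.ae_eq_fibreAverage hξ hfin hf

end CondExp

/-! ### Incidence sums in the affine plane at a vertex. -/

namespace HoroSystem

open CoweightLattice hiding ext_iff Near

variable {V : Type*} {q : ℕ}

section Sums

open Classical in
/-- Two-step sums over the points of an affine plane: a second point is joined to the first by one
line, unless that line is parallel to the direction `w`. -/
theorem sum_nbr_sum_nbr (H : HoroSystem V q) {R : Type*} [Ring R] {a b lam : CoweightLattice}
    (hab : IsFundPair a b) {x y w : V} (hy : H.lev y = lam + a) (hx : H.proj lam y = x)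
    (hw : H.proj (lam + a - b) y = w) (F : V → R) :
    ∑ z ∈ H.nbr y (lam + b), ∑ y' ∈ H.nbr z (lam + a), F y' =
      q * F y + ∑ y' ∈ H.nbr x (lam + a), F y' -
        ∑ y' ∈ H.nbr x (lam + a) with H.Near y' w, F y' := by
  have hc := hab.coords
  have hle : lam ≤ H.lev y := by
    rw [hy, Prod.le_def]; simp only [Prod.fst_add, Prod.snd_add]; omega
  have hlx : H.lev x = lam := hx ▸ H.lev_proj hle
  have hyx : H.Near y x := H.near_of_proj_eq hle hx (by
    rw [hy]; simp only [CoweightLattice.Near, Prod.fst_add, Prod.snd_add]; omega)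
  obtain ⟨hwx, hwy, hlw⟩ := H.near_proj_side hab hy hyx hlx
  rw [hw] at hwx hwy hlw
  have hne_w : ∀ y', H.lev y' = lam + a → w ≠ y' := by
    intro y' h e
    rw [← e, hlw] at h
    simp only [CoweightLattice.ext_iff, Prod.fst_add, Prod.snd_add, Prod.fst_sub, Prod.snd_sub] at h
    omega
  have hne_z : ∀ y' z, H.lev y' = lam + a → H.lev z = lam + b → z ≠ y' := by
    intro y' z h h' e
    rw [← e, h'] at h
    simp only [CoweightLattice.ext_iff, Prod.fst_add, Prod.snd_add] at h
    omega
  have hzx : ∀ z ∈ H.nbr y (lam + b), H.Near z x ∧ z ≠ x ∧ H.proj lam z = x := by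
    intro z hz
    rw [mem_nbr] at hz
    refine ⟨hx ▸ H.near_proj_of_near hab.symm hy hz.1 hz.2, fun e => ?_, ?_⟩
    · have h := hz.1
      rw [e, hlx] at h
      simp only [CoweightLattice.ext_iff, Prod.fst_add, Prod.snd_add] at h
      omega
    · rw [← hx]
      refine H.proj_eq_proj hz.2 ?_ hle
      rw [hz.1, Prod.le_def]; simp only [Prod.fst_add, Prod.snd_add]; omega
  -- After the exchange, each point y' is weighted by the number of nonspecial lines through y and
  -- y'.
  rw [Finset.sum_comm' (t' := H.nbr x (lam + a))
    (s' := fun y' => {z ∈ H.nbr y (lam + b) | H.Near y' z})]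
  swap
  · intro z y'
    rw [Finset.mem_filter, mem_nbr (x := z), mem_nbr (x := x)]
    constructor
    · rintro ⟨hz, hy', hn⟩
      refine ⟨⟨hz, hn⟩, hy', ?_⟩
      rw [← (hzx z hz).2.2]
      exact H.near_proj_of_near hab (H.mem_nbr.1 hz).1 hy' hn
    · rintro ⟨⟨hz, hn⟩, hy', -⟩
      exact ⟨hz, hy', hn⟩
  -- The weight is q for y' = y, zero for the other points of the special line `w`, and one
  -- elsewhere. Since y lies on `w`, its last two terms cancel.
  have hcard : ∀ y' ∈ H.nbr x (lam + a),
      (({z ∈ H.nbr y (lam + b) | H.Near y' z} : Finset V).card : R) * F y' =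
        (if y' = y then q * F y' else 0) + F y' - if H.Near y' w then F y' else 0 := by
    intro y' hy'
    rw [mem_nbr] at hy'
    split_ifs with h1 h2 h2
    · subst h1
      rw [Finset.filter_true_of_mem fun z hz => H.near_symm (H.mem_nbr.1 hz).2,
        card_nbr, H.ncard_across hab.symm hy]
      simp
    · exact absurd (h1 ▸ H.near_symm hwy) h2
    · rw [Finset.filter_false_of_mem]
      · simp
      · intro z hz hn
        have hz' := hzx z hz
        rw [mem_nbr] at hz
        have := (H.existsUnique_join (H.near_symm hyx) (H.near_symm hy'.2) (Ne.symm h1)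
          (by rw [hy, hy'.1])).unique
          (y₁ := z) (y₂ := w) ⟨hz'.1, hz.2, H.near_symm hn, hz'.2.1, hne_z _ _ hy hz.1,
            hne_z _ _ hy'.1 hz.1⟩
          ⟨hwx, hwy, H.near_symm h2, fun e => by
            rw [e, hlx] at hlw
            simp only [CoweightLattice.ext_iff, Prod.fst_add, Prod.snd_add, Prod.fst_sub,
              Prod.snd_sub] at hlw
            omega, hne_w _ hy, hne_w _ hy'.1⟩
        rw [this] at hz
        rw [hlw] at hz
        simp only [CoweightLattice.ext_iff, Prod.fst_add, Prod.snd_add, Prod.fst_sub,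
          Prod.snd_sub] at hz
        omega
    · obtain ⟨z₀, ⟨e1, e2, e3, e4, e5, e6⟩, huniq⟩ := H.existsUnique_join (H.near_symm hyx)
        (H.near_symm hy'.2) (Ne.symm h1) (by rw [hy, hy'.1])
      -- The join could only be at `lam + b` or `lam + a - b`; the latter would be the special line
      -- through y, which misses y'.
      have hl₀ : H.lev z₀ = lam + b := by
        have n1 := H.near_lev e1
        have n2 := H.near_lev e2
        have n3 : H.lev z₀ ≠ H.lev x := fun e => e4 (H.eq_of_near e1 e)
        have n4 : H.lev z₀ ≠ H.lev y := fun e => e5 (H.eq_of_near e2 e)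
        have n5 : H.lev z₀ ≠ lam + a - b := fun e => h2 (by
          rw [← hw, (H.proj_side_eq_iff hab hy e).2 (H.near_symm e2)]
          exact H.near_symm e3)
        rw [hlx] at n1 n3
        rw [hy] at n2 n4
        simp only [CoweightLattice.Near, Ne, CoweightLattice.ext_iff, Prod.fst_add, Prod.snd_add,
          Prod.fst_sub, Prod.snd_sub] at *
        omega
      have : ({z ∈ H.nbr y (lam + b) | H.Near y' z} : Finset V) = {z₀} := by
        ext z
        rw [Finset.mem_filter, Finset.mem_singleton]
        constructor
        · rintro ⟨hz, hn⟩
          have hz' := hzx z hz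
          rw [mem_nbr] at hz
          exact huniq z ⟨hz'.1, hz.2, H.near_symm hn, hz'.2.1, hne_z _ _ hy hz.1,
            hne_z _ _ hy'.1 hz.1⟩
        · rintro rfl
          exact ⟨H.mem_nbr.2 ⟨hl₀, e2⟩, H.near_symm e3⟩
      rw [this]
      simp
  simp_rw [Finset.sum_const, nsmul_eq_mul]
  rw [Finset.sum_congr rfl hcard, Finset.sum_sub_distrib, Finset.sum_add_distrib,
    Finset.sum_ite_eq', if_pos (H.mem_nbr.2 ⟨hy, hyx⟩), Finset.sum_filter]

open Classical in
/-- The lines with direction different from that of `z` meet `z` once each. -/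
theorem sum_nbr_sum_side (H : HoroSystem V q) {R : Type*} [Ring R] {a b lam : CoweightLattice}
    (hab : IsFundPair a b) {x z : V} (hz : H.lev z = lam + b) (hx : H.proj lam z = x)
    (F : V → R) :
    ∑ y ∈ H.nbr z (lam + a),
        ∑ y' ∈ H.nbr x (lam + a) with H.Near y' (H.proj (lam + a - b) y), F y' =
      ∑ y' ∈ H.nbr x (lam + a), F y' := by
  have hc := hab.coords
  have hle : lam ≤ H.lev z := by
    rw [hz, Prod.le_def]; simp only [Prod.fst_add, Prod.snd_add]; omega
  have hlx : H.lev x = lam := hx ▸ H.lev_proj hle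
  have hzx : H.Near z x := H.near_of_proj_eq hle hx (by
    rw [hz]; simp only [CoweightLattice.Near, Prod.fst_add, Prod.snd_add]; omega)
  rw [Finset.sum_comm' (t' := H.nbr x (lam + a))
    (s' := fun y' => {y ∈ H.nbr z (lam + a) | H.Near y' (H.proj (lam + a - b) y)})]
  swap
  · intro y y'
    rw [Finset.mem_filter, Finset.mem_filter]
    tauto
  refine Finset.sum_congr rfl fun y' hy' => ?_
  rw [mem_nbr] at hy'
  obtain ⟨hwx, hwy, hlw⟩ := H.near_proj_side hab hy'.1 hy'.2 hlx
  set w := H.proj (lam + a - b) y' with hw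
  have hne : z ≠ w := fun e => by
    rw [← e, hz] at hlw
    simp only [CoweightLattice.ext_iff, Prod.fst_add, Prod.snd_add, Prod.fst_sub,
      Prod.snd_sub] at hlw
    omega
  obtain ⟨y₀, ⟨e1, e2, e3, e4, e5, e6⟩, huniq⟩ := H.existsUnique_join (H.near_symm hzx)
    (H.near_symm hwx) hne (by
      rw [hz, hlw, vertexType_eq_iff]
      simp only [Prod.fst_add, Prod.snd_add, Prod.fst_sub, Prod.snd_sub]
      omega)
  -- The lines z and w have different directions, so their common point is not at infinity.
  have hl₀ : H.lev y₀ = lam + a := by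
    have n1 := H.near_lev e1
    have n2 := H.near_lev e2
    have n5 := H.near_lev e3
    have n3 : H.lev y₀ ≠ H.lev x := fun e => e4 (H.eq_of_near e1 e)
    have n4 : H.lev y₀ ≠ H.lev z := fun e => e5 (H.eq_of_near e2 e)
    rw [hlx] at n1 n3
    rw [hz] at n2 n4
    rw [hlw] at n5
    simp only [CoweightLattice.Near, Ne, CoweightLattice.ext_iff, Prod.fst_add, Prod.snd_add,
      Prod.fst_sub, Prod.snd_sub] at *
    omega
  have : ({y ∈ H.nbr z (lam + a) | H.Near y' (H.proj (lam + a - b) y)} : Finset V) = {y₀} := by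
    ext y
    rw [Finset.mem_filter, Finset.mem_singleton, mem_nbr]
    constructor
    · rintro ⟨⟨hy, hyz⟩, hn⟩
      have hyx : H.Near y x := hx ▸ H.near_proj_of_near hab hz hy hyz
      have hs := H.near_proj_side hab hy hyx hlx
      have hwy' := (H.proj_side_eq_iff hab hy'.1 hs.2.2).2 hn
      refine huniq y ⟨hyx, hyz, ?_, fun e => ?_, fun e => ?_, fun e => ?_⟩
      · rw [hw, hwy']
        exact H.near_symm hs.2.1
      · rw [e, hlx] at hy
        simp only [CoweightLattice.ext_iff, Prod.fst_add, Prod.snd_add] at hy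
        omega
      · rw [e, hz] at hy
        simp only [CoweightLattice.ext_iff, Prod.fst_add, Prod.snd_add] at hy
        omega
      · rw [e, hlw] at hy
        simp only [CoweightLattice.ext_iff, Prod.fst_add, Prod.snd_add, Prod.fst_sub,
          Prod.snd_sub] at hy
        omega
    · rintro rfl
      refine ⟨⟨hl₀, e2⟩, ?_⟩
      rw [(H.proj_side_eq_iff hab hl₀ hlw).2 e3]
      exact H.near_symm hwy
  rw [this, Finset.sum_singleton]

end Sums

/-! ### Conditional expectations as sums over neighbours. -/

namespace Space

variable {H : HoroSystem V q} {Ω : Type*} [mΩ : MeasurableSpace Ω] {S : H.Space Ω}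
  {𝕜 : Type*} [RCLike 𝕜] {μ : Measure Ω} {f : Ω → 𝕜} {a b lam nu : CoweightLattice} {x y z : V}

/-- Integrability on the sets `thru x`. -/
def LocInt (S : H.Space Ω) (μ : Measure Ω) (f : Ω → 𝕜) : Prop :=
  ∀ x, IntegrableOn f (S.thru x) μ

/-- The average over the families through `x`. -/
noncomputable def avg (S : H.Space Ω) (μ : Measure Ω) (f : Ω → 𝕜) (x : V) : 𝕜 :=
  ⨍ ω in S.thru x, f ω ∂μ

theorem LocInt.congr (hf : S.LocInt μ f) {g : Ω → 𝕜} (h : f =ᵐ[μ] g) : S.LocInt μ g :=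
  fun x => (hf x).congr_fun_ae (ae_restrict_of_ae h)

theorem preimage_fam_eq (S : H.Space Ω) (nu : CoweightLattice) (x : V) :
    (fun ω => S.fam ω nu) ⁻¹' {x} = if H.lev x = nu then S.thru x else ∅ := by
  split_ifs with h
  · ext ω
    rw [mem_thru_iff h]
    rfl
  · refine Set.eq_empty_of_forall_notMem fun ω hω => h ?_
    rw [← show S.fam ω nu = x from hω, S.lev_fam]

theorem measurableSet_preimage_fam (S : H.Space Ω) (nu : CoweightLattice) (x : V) :
    MeasurableSet ((fun ω => S.fam ω nu) ⁻¹' {x}) := by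
  rw [S.preimage_fam_eq]
  split_ifs
  · exact S.measurableSet_thru x
  · exact MeasurableSet.empty

theorem IsNormalized.preimage_fam_ne_top (hμ : S.IsNormalized μ) (nu : CoweightLattice) (x : V) :
    μ ((fun ω => S.fam ω nu) ⁻¹' {x}) ≠ ∞ := by
  rw [S.preimage_fam_eq]
  split_ifs
  · exact hμ.ne_top x
  · simp

theorem LocInt.integrableOn_preimage_fam (hf : S.LocInt μ f) (nu : CoweightLattice) (x : V) :
    IntegrableOn f ((fun ω => S.fam ω nu) ⁻¹' {x}) μ := by
  rw [S.preimage_fam_eq]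
  split_ifs
  · exact hf x
  · exact integrableOn_empty

/-- The generators are the fibres of the random vertex at `nu`, which has countably many values. -/
theorem generateFrom_thru_eq_comap (S : H.Space Ω) (nu : CoweightLattice) :
    MeasurableSpace.generateFrom (S.thru '' {x | H.lev x = nu}) =
      MeasurableSpace.comap (fun ω => S.fam ω nu) ⊤ := by
  have := H.countable
  apply le_antisymm
  · refine MeasurableSpace.generateFrom_le ?_
    rintro _ ⟨x, hx, rfl⟩
    exact ⟨{x}, trivial, by rw [S.preimage_fam_eq, if_pos (show H.lev x = nu from hx)]⟩
  · rintro _ ⟨T, -, rfl⟩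
    have : (fun ω => S.fam ω nu) ⁻¹' T =
        ⋃ x ∈ {x | x ∈ T ∧ H.lev x = nu}, S.thru x := by
      ext ω
      simp only [Set.mem_preimage, Set.mem_iUnion]
      constructor
      · exact fun h => ⟨_, ⟨h, S.lev_fam ω nu⟩, S.mem_thru_fam ω nu⟩
      · rintro ⟨x, ⟨hT, hx⟩, h⟩
        rw [mem_thru_iff hx] at h
        rwa [h]
    rw [this]
    exact MeasurableSet.biUnion (Set.to_countable _) fun x hx =>
      MeasurableSpace.measurableSet_generateFrom ⟨x, hx.2, rfl⟩

theorem _root_.MeasurableSpace.comap_top_sup_comap_top {α β γ : Type*} [Countable β] [Countable γ]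
    (ξ : α → β) (η : α → γ) : MeasurableSpace.comap ξ ⊤ ⊔ MeasurableSpace.comap η ⊤ =
      MeasurableSpace.comap (fun ω => (ξ ω, η ω)) ⊤ := by
  apply le_antisymm
  · refine sup_le ?_ ?_
    · rintro _ ⟨T, -, rfl⟩
      exact ⟨Prod.fst ⁻¹' T, trivial, rfl⟩
    · rintro _ ⟨T, -, rfl⟩
      exact ⟨Prod.snd ⁻¹' T, trivial, rfl⟩
  · rintro _ ⟨T, -, rfl⟩
    have : (fun ω => (ξ ω, η ω)) ⁻¹' T = ⋃ p ∈ T, ξ ⁻¹' {p.1} ∩ η ⁻¹' {p.2} := by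
      ext ω
      simp only [Set.mem_preimage, Set.mem_iUnion, Set.mem_inter_iff, Set.mem_singleton_iff]
      exact ⟨fun h => ⟨_, h, rfl, rfl⟩, fun ⟨p, hp, h1, h2⟩ => by rw [h1, h2]; exact hp⟩
    rw [this]
    refine MeasurableSet.biUnion (Set.to_countable _) fun p _ => MeasurableSet.inter ?_ ?_
    · exact le_sup_left (a := MeasurableSpace.comap ξ ⊤) _ ⟨_, trivial, rfl⟩
    · exact le_sup_right (a := MeasurableSpace.comap ξ ⊤) _ ⟨_, trivial, rfl⟩

/-- The conditional expectation given the vertex at `nu`. -/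
noncomputable def condE (S : H.Space Ω) (μ : Measure Ω) (nu : CoweightLattice) (f : Ω → 𝕜) :
    Ω → 𝕜 :=
  localCondExp μ (MeasurableSpace.comap (fun ω => S.fam ω nu) ⊤) f

theorem condE_ae_eq (hμ : S.IsNormalized μ) (hf : S.LocInt μ f) (nu : CoweightLattice) :
    S.condE μ nu f =ᵐ[μ] fun ω => S.avg μ f (S.fam ω nu) := by
  have := H.countable
  refine (localCondExp_comap_ae_eq (S.measurableSet_preimage_fam nu)
    (hμ.preimage_fam_ne_top nu) (hf.integrableOn_preimage_fam nu)).trans (Filter.EventuallyEq.of_eq ?_)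
  ext ω
  rw [fibreAverage, S.preimage_fam_eq, if_pos (S.lev_fam ω nu), avg]

theorem avg_comp_fam (hμ : S.IsNormalized μ) (h : V → 𝕜) (hle : nu ≤ H.lev z) :
    S.avg μ (fun ω => h (S.fam ω nu)) z = h (H.proj nu z) := by
  rw [avg, setAverage_congr_fun (g := fun _ => h (H.proj nu z)) (S.measurableSet_thru z)]
  · exact setAverage_const (hμ.ne_zero z) (hμ.ne_top z) _
  · refine Filter.Eventually.of_forall fun ω hω => ?_
    rw [mem_thru_iff rfl] at hω
    rw [← S.proj_fam ω hle, hω]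

/-- Above the supremum of `lev x` and `nu` the set splits into finitely many pieces on which the
function is constant. Iterated conditional expectations are thus locally integrable. -/
theorem locInt_comp_fam (hμ : S.IsNormalized μ) (h : V → 𝕜) (nu : CoweightLattice) :
    S.LocInt μ fun ω => h (S.fam ω nu) := by
  intro x
  have hle : H.lev x ≤ H.lev x ⊔ nu := le_sup_left
  rw [S.thru_eq_iUnion hle, integrableOn_finite_biUnion (H.finite_cone hle)]
  intro z hz
  refine (integrableOn_const (C := h (H.proj nu z)) (hμ.ne_top z)).congr_fun (fun ω hω => ?_)
    (S.measurableSet_thru z)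
  have hnu : nu ≤ H.lev z := by rw [hz.1]; exact le_sup_right
  rw [mem_thru_iff rfl] at hω
  simp only
  rw [← S.proj_fam ω hnu, hω]

/-- Pieces at the same position have equal mass, so the average is the plain mean. -/
theorem setAverage_biUnion_thru (hμ : S.IsNormalized μ) (hf : S.LocInt μ f) {T : Finset V}
    (hT : ∀ z ∈ T, H.lev z = nu) :
    ⨍ ω in ⋃ z ∈ T, S.thru z, f ω ∂μ = (T.card : 𝕜)⁻¹ * ∑ z ∈ T, S.avg μ f z := by
  have h0 : (q : ℝ≥0∞) ^ (-2 * level nu) ≠ 0 :=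
    (ENNReal.zpow_pos (cast_ne_zero H) (ENNReal.natCast_ne_top q) _).ne'
  have ht : (q : ℝ≥0∞) ^ (-2 * level nu) ≠ ∞ :=
    ENNReal.zpow_ne_top (cast_ne_zero H) (ENNReal.natCast_ne_top q) _
  have hc : ∀ z ∈ T, μ (S.thru z) = (q : ℝ≥0∞) ^ (-2 * level nu) := fun z hz => by
    rw [hμ, hT z hz]
  generalize (q : ℝ≥0∞) ^ (-2 * level nu) = c at *
  have hint : ∀ z ∈ T, ∫ ω in S.thru z, f ω ∂μ = c.toReal • S.avg μ f z := fun z hz => by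
    rw [avg, ← hc z hz]
    exact (measure_smul_setAverage f (hμ.ne_top z)).symm
  rw [setAverage_eq, measureReal_def, S.measure_biUnion_thru μ hT hc,
    integral_biUnion_finset T (fun z _ => S.measurableSet_thru z)
      (fun x hx y hy hne => S.disjoint_thru (hT x hx) (hT y hy) hne) (fun z _ => hf z),
    Finset.sum_congr rfl hint, ← Finset.smul_sum, smul_smul, ENNReal.toReal_mul,
    ENNReal.toReal_natCast, mul_inv, mul_assoc, inv_mul_cancel₀, mul_one,
    RCLike.real_smul_eq_coe_mul]
  · push_cast
    rfl
  · exact ENNReal.toReal_ne_zero.2 ⟨h0, ht⟩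

theorem avg_eq_sum_up (hμ : S.IsNormalized μ) (hf : S.LocInt μ f) (hab : IsFundPair a b)
    (hx : H.lev x = lam) :
    S.avg μ f x = ((q : 𝕜)⁻¹ * (q : 𝕜)⁻¹) * ∑ y ∈ H.nbr x (lam + a), S.avg μ f y := by
  have hle : H.lev x ≤ lam + a := by
    have := hab.coords
    rw [hx, Prod.le_def]; simp only [Prod.fst_add, Prod.snd_add]; omega
  rw [avg, S.thru_eq_iUnion hle, H.cone_add_eq hab hx]
  have hU : ⋃ z ∈ {y | H.lev y = lam + a ∧ H.Near y x}, S.thru z =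
      ⋃ z ∈ H.nbr x (lam + a), S.thru z := by
    ext; simp
  rw [hU, setAverage_biUnion_thru hμ hf fun z hz => (H.mem_nbr.1 hz).1,
    card_nbr, H.ncard_up hab hx]
  push_cast
  rw [mul_inv]

/-- The positions `lam + a` and `lam + b` are incomparable, so the average is refined to `lam + a +
b`. Each y adjacent to z lies below q of the q² pieces there, so y is uniform. -/
theorem avg_comp_fam_across (hμ : S.IsNormalized μ) (h : V → 𝕜) (hab : IsFundPair a b)
    (hz : H.lev z = lam + b) :
    S.avg μ (fun ω => h (S.fam ω (lam + a))) z =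
      (q : 𝕜)⁻¹ * ∑ y ∈ H.nbr z (lam + a), h y := by
  classical
  have hc := hab.coords
  have hle : H.lev z ≤ lam + b + a := by
    rw [hz, Prod.le_def]; simp only [Prod.fst_add, Prod.snd_add]; omega
  have hle' : lam + a ≤ lam + b + a := by
    rw [Prod.le_def]; simp only [Prod.fst_add, Prod.snd_add]; omega
  have hU : ⋃ t ∈ H.cone (lam + b + a) z, S.thru t =
      ⋃ t ∈ H.nbr z (lam + b + a), S.thru t := by
    rw [H.cone_add_eq hab hz]; ext; simp
  have hq : (q : 𝕜) ≠ 0 := Nat.cast_ne_zero.2 H.order_ne_zero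
  rw [avg, S.thru_eq_iUnion hle, hU, setAverage_biUnion_thru hμ (locInt_comp_fam hμ h _)
    fun t ht => (H.mem_nbr.1 ht).1,
    Finset.sum_congr rfl fun t ht => avg_comp_fam hμ h (hle'.trans (H.mem_nbr.1 ht).1.ge)]
  have hnear : ∀ t ∈ H.nbr z (lam + b + a), ∀ y, H.lev y = lam + a →
      (H.proj (lam + a) t = y ↔ H.Near t y) := by
    intro t ht y hy
    rw [mem_nbr] at ht
    constructor
    · intro h
      refine H.near_of_proj_eq (hle'.trans ht.1.ge) h ?_
      rw [ht.1]; simp only [CoweightLattice.Near, Prod.fst_add, Prod.snd_add]; omega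
    · intro h
      rw [← hy]
      exact H.proj_eq_of_near (H.near_symm h) (by rw [hy, ht.1]; exact hle')
  have hmaps : ∀ t ∈ H.nbr z (lam + b + a), H.proj (lam + a) t ∈ H.nbr z (lam + a) := by
    intro t ht
    rw [mem_nbr] at ht ⊢
    refine ⟨H.lev_proj (hle'.trans ht.1.ge), ?_⟩
    have h1 : H.proj (lam + b) t = z := by
      rw [← hz]; exact H.proj_eq_of_near (H.near_symm ht.2) (hle.trans ht.1.ge)
    rw [← h1]
    refine H.near_proj (hle'.trans ht.1.ge) (by rw [← hz]; exact hle.trans ht.1.ge) ?_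
    simp only [CoweightLattice.Near, Prod.fst_add, Prod.snd_add]; omega
  rw [← Finset.sum_fiberwise_of_maps_to hmaps]
  have hfib : ∀ y ∈ H.nbr z (lam + a),
      ∑ t ∈ H.nbr z (lam + b + a) with H.proj (lam + a) t = y, h (H.proj (lam + a) t) =
        q * h y := by
    intro y hy
    rw [Finset.sum_congr rfl (g := fun _ => h y) fun t ht => by rw [(Finset.mem_filter.1 ht).2],
      Finset.sum_const, nsmul_eq_mul]
    congr 2
    rw [mem_nbr] at hy
    refine Eq.trans ?_ (H.ncard_top hab hy.1 hz hy.2)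
    rw [← Set.ncard_coe_finset]
    congr 1
    ext t
    rw [Finset.mem_coe, Finset.mem_filter]
    constructor
    · rintro ⟨ht, h1⟩
      have h2 := (hnear t ht y hy.1).1 h1
      rw [mem_nbr] at ht
      exact ⟨by rw [ht.1]; abel, h2, ht.2⟩
    · rintro ⟨h1, h2, h3⟩
      have ht : t ∈ H.nbr z (lam + b + a) := by rw [mem_nbr, h1]; exact ⟨by abel, h3⟩
      exact ⟨ht, (hnear t ht y hy.1).2 h2⟩
  rw [Finset.sum_congr rfl hfib, ← Finset.mul_sum, card_nbr,
    H.ncard_up hab hz]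
  push_cast
  rw [mul_inv, mul_assoc, inv_mul_cancel_left₀ hq]

theorem condE_across (hμ : S.IsNormalized μ) (hab : IsFundPair a b) (lam : CoweightLattice)
    {h : V → 𝕜} (hf : f =ᵐ[μ] fun ω => h (S.fam ω (lam + a))) :
    S.condE μ (lam + b) f =ᵐ[μ]
      fun ω => (q : 𝕜)⁻¹ * ∑ y ∈ H.nbr (S.fam ω (lam + b)) (lam + a), h y := by
  refine (condE_ae_eq hμ ((locInt_comp_fam hμ h _).congr hf.symm) _).trans
    (Filter.EventuallyEq.of_eq ?_)
  ext ω
  rw [← avg_comp_fam_across hμ h hab (S.lev_fam ω _), avg, avg, setAverage_eq, setAverage_eq,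
    integral_congr_ae (ae_restrict_of_ae hf)]

-- The join of the two σ-fields records an edge formed by x and a special line w; its fibre consists
-- of the q equally likely points on w.
open Classical in
theorem condE_side (hμ : S.IsNormalized μ) (hab : IsFundPair a b) (lam : CoweightLattice)
    {h : V → 𝕜} (hf : f =ᵐ[μ] fun ω => h (S.fam ω (lam + a))) :
    localCondExp μ (MeasurableSpace.comap (fun ω => S.fam ω (lam + a - b)) ⊤ ⊔
        MeasurableSpace.comap (fun ω => S.fam ω lam) ⊤) f =ᵐ[μ]
      fun ω => (q : 𝕜)⁻¹ * ∑ y ∈ H.nbr (S.fam ω lam) (lam + a) with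
        H.Near y (S.fam ω (lam + a - b)), h y := by
  have := H.countable
  have hc := hab.coords
  have hpre : ∀ p : V × V, (fun ω => (S.fam ω (lam + a - b), S.fam ω lam)) ⁻¹' {p} =
      (fun ω => S.fam ω (lam + a - b)) ⁻¹' {p.1} ∩ (fun ω => S.fam ω lam) ⁻¹' {p.2} := by
    rintro ⟨w, x⟩
    ext ω
    simp
  have hloc := (locInt_comp_fam (S := S) hμ h (lam + a)).congr hf.symm
  rw [MeasurableSpace.comap_top_sup_comap_top]
  refine (localCondExp_comap_ae_eq (fun p => ?_) (fun p => ?_) fun p => ?_).trans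
    (Filter.EventuallyEq.of_eq ?_)
  · rw [hpre]
    exact (S.measurableSet_preimage_fam _ _).inter (S.measurableSet_preimage_fam _ _)
  · rw [hpre]
    exact measure_ne_top_of_subset Set.inter_subset_right (hμ.preimage_fam_ne_top lam p.2)
  · rw [hpre]
    exact (hloc.integrableOn_preimage_fam lam p.2).mono_set Set.inter_subset_right
  ext ω
  have hle : lam ≤ lam + a := by rw [Prod.le_def]; simp only [Prod.fst_add, Prod.snd_add]; omega
  have hle' : lam + a - b ≤ lam + a := by
    rw [Prod.le_def]; simp only [Prod.fst_sub, Prod.snd_sub]; omega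
  have hwx : H.Near (S.fam ω (lam + a - b)) (S.fam ω lam) := by
    rw [← S.proj_fam ω hle, ← S.proj_fam ω hle']
    refine H.near_proj (by rwa [S.lev_fam]) (by rwa [S.lev_fam]) ?_
    simp only [CoweightLattice.Near, Prod.fst_add, Prod.snd_add, Prod.fst_sub, Prod.snd_sub]
    omega
  set w := S.fam ω (lam + a - b) with hw
  set x := S.fam ω lam with hx
  have hlw : H.lev w = lam + a - b := S.lev_fam ω _
  have hlx : H.lev x = lam := S.lev_fam ω _
  have hU : (fun ω => (S.fam ω (lam + a - b), S.fam ω lam)) ⁻¹' {(w, x)} =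
      ⋃ y ∈ ({y ∈ H.nbr x (lam + a) | H.Near y w} : Finset V), S.thru y := by
    ext ω'
    simp only [Set.mem_preimage, Set.mem_singleton_iff, Prod.mk.injEq, Set.mem_iUnion,
      Finset.mem_filter, mem_nbr, exists_prop]
    constructor
    · rintro ⟨h1, h2⟩
      refine ⟨S.fam ω' (lam + a), ⟨⟨S.lev_fam _ _, ?_⟩, ?_⟩, S.mem_thru_fam _ _⟩
      · refine H.near_of_proj_eq (mu := lam) (by rwa [S.lev_fam]) (by rw [S.proj_fam _ hle, h2]) ?_
        rw [S.lev_fam]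
        simp only [CoweightLattice.Near, Prod.fst_add, Prod.snd_add]; omega
      · rw [← H.proj_side_eq_iff hab (S.lev_fam _ _) hlw, S.proj_fam _ hle', h1]
    · rintro ⟨y, ⟨⟨hy, hyx⟩, hyw⟩, hω'⟩
      rw [mem_thru_iff hy] at hω'
      constructor
      · rw [← S.proj_fam ω' hle', hω', H.proj_side_eq_iff hab hy hlw]
        exact hyw
      · rw [← S.proj_fam ω' hle, hω', ← hlx]
        exact H.proj_eq_of_near (H.near_symm hyx) (by rw [hlx, hy]; exact hle)
  have hcard : (({y ∈ H.nbr x (lam + a) | H.Near y w} : Finset V).card : 𝕜) = q := by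
    congr 1
    refine Eq.trans ?_ (H.ncard_up_of_side hab hlx hlw hwx)
    rw [← Set.ncard_coe_finset]
    congr 1
    ext y
    simp [and_assoc]
  rw [fibreAverage, ← hw, ← hx, hU, setAverage_biUnion_thru hμ hloc (nu := lam + a)
    fun y hy => (H.mem_nbr.1 (Finset.mem_filter.1 hy).1).1, hcard]
  congr 1
  refine Finset.sum_congr rfl fun y hy => ?_
  have hy' := (H.mem_nbr.1 (Finset.mem_filter.1 hy).1).1
  have h1 := avg_comp_fam (S := S) hμ h (nu := lam + a) hy'.ge
  rw [← hy', H.proj_lev] at h1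
  rw [← h1, avg, avg, setAverage_eq, setAverage_eq, hy', integral_congr_ae (ae_restrict_of_ae hf)]

/-- The identities for the conditional expectations given the vertices at `lam + a`, `lam + b`
and `lam`. -/
theorem condE_identities (hμ : S.IsNormalized μ) (hf : S.LocInt μ f) (hab : IsFundPair a b)
    (lam : CoweightLattice) :
    S.condE μ (lam + a) (S.condE μ (lam + b) (S.condE μ (lam + a) f)) =ᵐ[μ]
        (q : 𝕜)⁻¹ • S.condE μ (lam + a) f
        - (q : 𝕜)⁻¹ • localCondExp μ
            (MeasurableSpace.comap (fun ω => S.fam ω (lam + a - b)) ⊤ ⊔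
              MeasurableSpace.comap (fun ω => S.fam ω lam) ⊤) (S.condE μ (lam + a) f)
        + S.condE μ lam f ∧
    S.condE μ (lam + b) (S.condE μ (lam + a) (S.condE μ (lam + b) (S.condE μ (lam + a) f))) =ᵐ[μ]
        (q : 𝕜)⁻¹ • S.condE μ (lam + b) (S.condE μ (lam + a) f)
        + (1 - (q : 𝕜)⁻¹) • S.condE μ lam f := by
  classical
  have hc := hab.coords
  have hq : (q : 𝕜) ≠ 0 := Nat.cast_ne_zero.2 H.order_ne_zero
  have h1 := condE_ae_eq hμ hf (lam + a)
  have h2 := condE_across hμ hab lam h1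
  have h3 := condE_across (h := fun z => (q : 𝕜)⁻¹ * ∑ y' ∈ H.nbr z (lam + a), S.avg μ f y')
    hμ hab.symm lam h2
  have h4 := condE_across (h := fun y => (q : 𝕜)⁻¹ * ∑ z ∈ H.nbr y (lam + b),
    ((q : 𝕜)⁻¹ * ∑ y' ∈ H.nbr z (lam + a), S.avg μ f y')) hμ hab lam h3
  have h5 := condE_side hμ hab lam h1
  have h6 := condE_ae_eq hμ hf lam
  have hla : lam ≤ lam + a := by rw [Prod.le_def]; simp only [Prod.fst_add, Prod.snd_add]; omega
  have hlb : lam ≤ lam + b := by rw [Prod.le_def]; simp only [Prod.fst_add, Prod.snd_add]; omega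
  have hls : lam + a - b ≤ lam + a := by
    rw [Prod.le_def]; simp only [Prod.fst_sub, Prod.snd_sub]; omega
  -- This is the incidence sum of `sum_nbr_sum_nbr` divided by q²: the first identity, evaluated at
  -- y.
  have key : ∀ y, H.lev y = lam + a → (q : 𝕜)⁻¹ * ∑ z ∈ H.nbr y (lam + b),
      ((q : 𝕜)⁻¹ * ∑ y' ∈ H.nbr z (lam + a), S.avg μ f y') =
      (q : 𝕜)⁻¹ * S.avg μ f y - (q : 𝕜)⁻¹ * ((q : 𝕜)⁻¹ *
        ∑ y' ∈ H.nbr (H.proj lam y) (lam + a) with H.Near y' (H.proj (lam + a - b) y),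
          S.avg μ f y') +
      ((q : 𝕜)⁻¹ * (q : 𝕜)⁻¹) * ∑ y' ∈ H.nbr (H.proj lam y) (lam + a), S.avg μ f y' := by
    intro y hy
    rw [← Finset.mul_sum, H.sum_nbr_sum_nbr hab hy rfl rfl]
    field_simp
    ring
  constructor
  · filter_upwards [h1, h3, h5, h6] with ω e1 e3 e5 e6
    simp only [Pi.add_apply, Pi.sub_apply, Pi.smul_apply, smul_eq_mul]
    rw [e3, e1, e5, e6, key _ (S.lev_fam ω _), S.proj_fam ω hla, S.proj_fam ω hls,
      avg_eq_sum_up hμ hf hab (S.lev_fam ω lam)]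
  · filter_upwards [h2, h4, h6] with ω e2 e4 e6
    simp only [Pi.add_apply, Pi.smul_apply, smul_eq_mul]
    have hz := S.lev_fam ω (lam + b)
    have hx := S.proj_fam ω hlb
    rw [e4, e2, e6, avg_eq_sum_up hμ hf hab (S.lev_fam ω lam)]
    set z := S.fam ω (lam + b)
    set x := S.fam ω lam
    have hyx : ∀ y ∈ H.nbr z (lam + a), H.proj lam y = x := by
      intro y hy
      rw [mem_nbr] at hy
      rw [← hx]
      exact H.proj_eq_proj hy.2 (by rwa [hy.1]) (by rwa [hz])
    -- Average the first identity over the q points of z. By `sum_nbr_sum_side` the terms over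
    -- special lines add up to a single sum over the plane, which accounts for the coefficient -q⁻¹
    -- of 𝔼_λ f.
    rw [Finset.sum_congr rfl fun y hy => (key y (H.mem_nbr.1 hy).1).trans (by rw [hyx y hy]),
      Finset.sum_add_distrib, Finset.sum_sub_distrib, ← Finset.mul_sum, ← Finset.mul_sum,
      ← Finset.mul_sum, H.sum_nbr_sum_side hab hz hx, Finset.sum_const, nsmul_eq_mul]
    have hcard : (H.nbr z (lam + a)).card = q := by
      rw [card_nbr, H.ncard_across hab hz]
    rw [hcard]
    field_simp
    ring

end Space

end HoroSystem

/-! ### Transfer to the boundary of the building, and the theorem. -/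

namespace TypedComplex.IsTriangleBuilding

variable {V : Type*} {X : TypedComplex V}

/-- The boundary points opposite to `ω₀` are the families of the system that `ω₀` determines. -/
noncomputable def boundarySpace (hX : X.IsTriangleBuilding) {q : ℕ} (hq : X.HasOrder q)
    {φ₀ : X.Chart} {ω₀ : X.Boundary} (hω₀ : φ₀ '' Set.Iic 0 ∈ ω₀.1) :
    (hX.horoSystem hq φ₀).Space (X.OppositeBoundary ω₀) where
  fam ω := (hX.exists_isFamily_of_opposite hq hω₀ ω).choose
  isFamily ω := (hX.exists_isFamily_of_opposite hq hω₀ ω).choose_spec.1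
  exists_fam_eq c hc := by
    obtain ⟨ω, hω⟩ := hX.exists_opposite_of_isFamily hq hω₀ hc
    refine ⟨ω, funext fun u => ?_⟩
    have h := (hX.exists_isFamily_of_opposite hq hω₀ ω).choose_spec.2 (c u)
    rw [hω, hc.lev_apply] at h
    exact h.1 rfl
  generateFrom_eq := by
    refine congrArg MeasurableSpace.generateFrom (congrArg Set.range (funext fun x => ?_))
    ext ω
    exact (hX.exists_isFamily_of_opposite hq hω₀ ω).choose_spec.2 x

theorem throughVertex_eq_thru (hX : X.IsTriangleBuilding) {q : ℕ} (hq : X.HasOrder q)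
    {φ₀ : X.Chart} {ω₀ : X.Boundary} (hω₀ : φ₀ '' Set.Iic 0 ∈ ω₀.1) :
    X.throughVertex ω₀ = (hX.boundarySpace hq hω₀).thru := by
  ext x ω
  exact (hX.exists_isFamily_of_opposite hq hω₀ ω).choose_spec.2 x

theorem field_eq_comap (hX : X.IsTriangleBuilding) {q : ℕ} (hq : X.HasOrder q)
    {φ₀ : X.Chart} {ω₀ : X.Boundary} (hω₀ : φ₀ '' Set.Iic 0 ∈ ω₀.1) (lam : CoweightLattice) :
    field ω₀ φ₀ lam = MeasurableSpace.comap (fun ω => (hX.boundarySpace hq hω₀).fam ω lam) ⊤ := by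
  rw [← HoroSystem.Space.generateFrom_thru_eq_comap, field, hX.throughVertex_eq_thru hq hω₀]
  simp only [hX.retraction_eq_lev hq]

theorem isBoundaryMeasure_iff (hX : X.IsTriangleBuilding) {q : ℕ} (hq : X.HasOrder q)
    {φ₀ : X.Chart} {ω₀ : X.Boundary} (hω₀ : φ₀ '' Set.Iic 0 ∈ ω₀.1)
    (π : Measure (X.OppositeBoundary ω₀)) :
    IsBoundaryMeasure ω₀ φ₀ q π ↔ (hX.boundarySpace hq hω₀).IsNormalized π := by
  simp only [IsBoundaryMeasure, HoroSystem.Space.IsNormalized, hX.throughVertex_eq_thru hq hω₀,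
    hX.retraction_eq_lev hq]

end TypedComplex.IsTriangleBuilding

theorem mainTheorem6 {V : Type*} (X : TypedComplex V) (hX : X.IsTriangleBuilding)
    (q : ℕ) (hq : X.HasOrder q) (O : V) (ω₀ : X.Boundary) (φ₀ : X.Chart)
    (hO : φ₀ 0 = O) (hω₀ : φ₀ '' Set.Iic 0 ∈ ω₀.1) (𝕜 : Type*) [RCLike 𝕜] :
    (∃! π : Measure (X.OppositeBoundary ω₀), TypedComplex.IsBoundaryMeasure ω₀ φ₀ q π) ∧
    ∀ π : Measure (X.OppositeBoundary ω₀), TypedComplex.IsBoundaryMeasure ω₀ φ₀ q π →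
    ∀ f : X.OppositeBoundary ω₀ → 𝕜, TypedComplex.LocIntegrable ω₀ π f →
    ∀ a b : CoweightLattice,
      (a = CoweightLattice.fund1 ∧ b = CoweightLattice.fund2 ∨
        a = CoweightLattice.fund2 ∧ b = CoweightLattice.fund1) →
    ∀ lam : CoweightLattice,
      let E : CoweightLattice → (X.OppositeBoundary ω₀ → 𝕜) → X.OppositeBoundary ω₀ → 𝕜 :=
        TypedComplex.condExpAt ω₀ φ₀ π
      E (lam + a) (E (lam + b) (E (lam + a) f)) =ᵐ[π]
          (q : 𝕜)⁻¹ • E (lam + a) f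
          - (q : 𝕜)⁻¹ • localCondExp π
              (TypedComplex.field ω₀ φ₀ (lam + a - b) ⊔ TypedComplex.field ω₀ φ₀ lam)
              (E (lam + a) f)
          + E lam f ∧
      E (lam + b) (E (lam + a) (E (lam + b) (E (lam + a) f))) =ᵐ[π]
          (q : 𝕜)⁻¹ • E (lam + b) (E (lam + a) f) + (1 - (q : 𝕜)⁻¹) • E lam f := by
  have hfield := hX.field_eq_comap hq hω₀
  have hcond : ∀ (π : Measure (X.OppositeBoundary ω₀)) lam,
      TypedComplex.condExpAt (𝕜 := 𝕜) ω₀ φ₀ π lam = (hX.boundarySpace hq hω₀).condE π lam := by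
    intro π lam
    ext f : 1
    rw [TypedComplex.condExpAt, HoroSystem.Space.condE, hfield]
  simp only [hX.isBoundaryMeasure_iff hq hω₀]
  refine ⟨(hX.boundarySpace hq hω₀).existsUnique_isNormalized, ?_⟩
  intro π hπ f hf a b hab lam
  have hloc : (hX.boundarySpace hq hω₀).LocInt π f := by
    intro x
    rw [← hX.throughVertex_eq_thru hq hω₀]
    exact hf x
  simp only [hcond, hfield]
  exact HoroSystem.Space.condE_identities hπ hloc hab lam
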